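/- Let $k$ be a field and let $(R,m)$ be a commutative noetherian Gorenstein $k$-algebra with at most an isolated singularity at $m$ (i.e. $R_p$ is regular for every prime $p\neq m$). Assume that we are in one of the following two situations. (a) Complete case: $R$ is a complete local ring with maximal ideal $m$. "Module" means ordinary module. (b) Graded case: $R=\bigoplus_{n\ge 0}R_n$ is a nonzero $\mathbb{N}$-graded ring with $R_0=k$ and $m=\bigoplus_{n>0}R_n$. "Module" means $\mathbb{Z}$-graded module, and morphisms of modules preserve degrees; $X(n)$ denotes the shift of a graded module, $X(n)_i=X_{n+i}$. Let $M_1,\dots,M_l$ ($l\ge 0$) be finitely generated indecomposable maximal Cohen–Macaulay $R$-modules which are pairwise non-isomorphic and not isomorphic to $R$ (in case (b): not isomorphic to $R(n)$ for any $n\in\mathbb{Z}$). Put $M_0=R$, $M=\bigoplus_{i=0}^l M_i$ and $\Lambda=\operatorname{End}_R(M)$ (in case (b) this is the ring of all $R$-linear endomorphisms, graded by the degree of endomorphisms), and assume that $\Lambda$ has finite global dimension. Let $e_i\in\Lambda$ be the idempotent given by the projection $M\to M_i$, put $P_i=\Lambda e_i$ and $S_i=P_i/\operatorname{rad}P_i$,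 where in case (b) $\operatorname{rad}$ is the graded radical (the intersection of the maximal graded submodules). For $A=\Lambda$ or $A=R$ let $D^b_f(A)$ be the full subcategory of the derived category of (left) $A$-modules consisting of the complexes with bounded cohomology all of whose cohomology modules are finitely generated. Let $\langle (S_i)_{i\ne 0}\rangle$ be the smallest strictly full triangulated subcategory of $D^b_f(\Lambda)$ containing all $S_i$ with $i\neq 0$ (in case (b): all shifts $S_i(n)$ with $i\neq0$, $n\in\mathbb{Z}$). Then the functor \[ \Xi: D^b_f(\Lambda)\to D^b_f(R),\qquad N\mapsto e_0N, \] induces an equivalence of triangulated categories between the Verdier quotient and $D^b_f(R)$: \[ D^b_f(\Lambda)/\langle (S_i)_{i\neq 0}\rangle\;\cong\; D^b_f(R). \] -/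

import Mathlib

open CategoryTheory CategoryTheory.Limits CategoryTheory.Pretriangulated
open scoped ZeroObject

universe w₁ w₂ u v

noncomputable section

namespace NCR

section Triangulated

variable {C : Type*} [Category* C] [HasZeroObject C] [HasShift C ℤ] [Preadditive C]
  [∀ n : ℤ, (shiftFunctor C n).Additive] [Pretriangulated C]

/-- `⟨P⟩`: the smallest strictly full triangulated subcategory containing the objects
satisfying `P`. -/
def triangulatedSpan (P : ObjectProperty C) : ObjectProperty C := fun X =>
  ∀ T : ObjectProperty C, T.IsTriangulated → T.IsClosedUnderIsomorphisms → P ≤ T → T X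

instance (P : ObjectProperty C) : (triangulatedSpan P).IsClosedUnderIsomorphisms where
  of_iso e hX T h₁ h₂ h₃ := T.prop_of_iso e (hX T h₁ h₂ h₃)

instance (P : ObjectProperty C) : (triangulatedSpan P).IsTriangulated where
  exists_zero := ⟨0, isZero_zero C, fun T _ _ _ => T.prop_zero⟩
  isStableUnderShiftBy n := ⟨fun _ hX T h₁ h₂ h₃ => T.le_shift n _ (hX T h₁ h₂ h₃)⟩
  toIsTriangulatedClosed₂ := .mk' fun Δ hΔ hX hZ T h₁ h₂ h₃ =>
    T.ext_of_isTriangulatedClosed₂ Δ hΔ (hX T h₁ h₂ h₃) (hZ T h₁ h₂ h₃)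

/-- The Verdier quotient `C/⟨P⟩`: the localization of `C` at the morphisms whose cone lies in
`⟨P⟩`. -/
abbrev VerdierQuotient (P : ObjectProperty C) : Type _ := (triangulatedSpan P).trW.Localization

variable {D : Type*} [Category* D]

/-- The functor `C/⟨P⟩ ⥤ D` induced by a functor `F : C ⥤ D` which inverts the morphisms whose
cone lies in `⟨P⟩`. It is the unique functor whose composition with `C ⥤ C/⟨P⟩` is `F`. -/
abbrev verdierLift (P : ObjectProperty C) (F : C ⥤ D)
    (hF : (triangulatedSpan P).trW.IsInvertedBy F) : VerdierQuotient P ⥤ D :=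
  Localization.Construction.lift F hF

variable [HasZeroObject D] [HasShift D ℤ] [Preadditive D]
  [∀ n : ℤ, (shiftFunctor D n).Additive] [Pretriangulated D]
  (P : ObjectProperty C) (F : C ⥤ D) (hF : (triangulatedSpan P).trW.IsInvertedBy F)

instance : Localization.Lifting (triangulatedSpan P).trW.Q (triangulatedSpan P).trW F
    (verdierLift P F hF) := ⟨eqToIso (Localization.Construction.fac F hF)⟩

instance [F.CommShift ℤ] : (verdierLift P F hF).CommShift ℤ :=
  Functor.commShiftOfLocalization (triangulatedSpan P).trW.Q (triangulatedSpan P).trW ℤ F _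

instance [IsTriangulated C] [F.CommShift ℤ] [F.IsTriangulated] :
    (verdierLift P F hF).IsTriangulated := by
  have : NatTrans.CommShift (Localization.Lifting.iso (triangulatedSpan P).trW.Q
      (triangulatedSpan P).trW F (verdierLift P F hF)).hom ℤ := inferInstance
  have := Localization.essSurj_mapArrow (triangulatedSpan P).trW.Q (triangulatedSpan P).trW
  exact Functor.isTriangulated_of_precomp_iso (Localization.Lifting.iso (triangulatedSpan P).trW.Q
      (triangulatedSpan P).trW F (verdierLift P F hF))

end Triangulated

section Derived

variable {A : Type*} [Category* A] [Abelian A] [HasDerivedCategory.{w₁} A]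
  {B : Type*} [Category* B] [Abelian B] [HasDerivedCategory.{w₂} B]

/-- The complexes with bounded cohomology, all of whose cohomology objects satisfy `P`. -/
def boundedCohomologyIn (P : ObjectProperty A) : ObjectProperty (DerivedCategory A) := fun X =>
  (∀ n : ℤ, P ((DerivedCategory.homologyFunctor A n).obj X)) ∧
    ∃ a b : ℤ, ∀ n : ℤ, n < a ∨ b < n → IsZero ((DerivedCategory.homologyFunctor A n).obj X)

instance (P : ObjectProperty A) [P.IsClosedUnderIsomorphisms] :
    (boundedCohomologyIn P).IsClosedUnderIsomorphisms where
  of_iso e hX := ⟨fun n => P.prop_of_iso ((DerivedCategory.homologyFunctor A n).mapIso e) (hX.1 n),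
    let ⟨a, b, h⟩ := hX.2
    ⟨a, b, fun n hn => (h n hn).of_iso ((DerivedCategory.homologyFunctor A n).mapIso e).symm⟩⟩

instance (P : ObjectProperty A) [P.IsSerreClass] : (boundedCohomologyIn P).IsTriangulated where
  exists_zero := ⟨0, isZero_zero _,
    fun n => P.prop_of_isZero ((DerivedCategory.homologyFunctor A n).map_isZero (isZero_zero _)),
    0, 0, fun n _ => (DerivedCategory.homologyFunctor A n).map_isZero (isZero_zero _)⟩
  isStableUnderShiftBy m := ⟨fun X hX => by
    have e (n : ℤ) := ((DerivedCategory.homologyFunctor A 0).shiftIso m n (m + n) rfl).app X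
    refine ⟨fun n => P.prop_of_iso (e n).symm (hX.1 (m + n)), ?_⟩
    obtain ⟨a, b, h⟩ := hX.2
    refine ⟨a - m, b - m, fun n hn => (h (m + n) (by lia)).of_iso (e n)⟩⟩
  toIsTriangulatedClosed₂ := .mk' fun T hT h₁ h₃ => by
    refine ⟨fun n => P.prop_X₂_of_exact (DerivedCategory.HomologySequence.exact₂ T hT n)
      (h₁.1 n) (h₃.1 n), ?_⟩
    obtain ⟨a, b, h⟩ := h₁.2
    obtain ⟨a', b', h'⟩ := h₃.2
    refine ⟨min a a', max b b', fun n hn => ?_⟩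
    exact (DerivedCategory.HomologySequence.exact₂ T hT n).isZero_of_both_zeros
      ((h n (by lia)).eq_of_src _ _) ((h' n (by lia)).eq_of_tgt _ _)

/-- The bounded derived category of complexes whose cohomology objects satisfy `P`. -/
abbrev BoundedDerived (P : ObjectProperty A) : Type _ := (boundedCohomologyIn P).FullSubcategory

/-- An exact functor `F` commutes with taking cohomology. -/
def mapDerivedHomologyIso (F : A ⥤ B) [F.Additive] [PreservesFiniteLimits F]
    [PreservesFiniteColimits F] (n : ℤ) (X : DerivedCategory A) :
    (DerivedCategory.homologyFunctor B n).obj (F.mapDerivedCategory.obj X) ≅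
      F.obj ((DerivedCategory.homologyFunctor A n).obj X) :=
  let K := DerivedCategory.Q.objPreimage X
  let e : DerivedCategory.Q.obj K ≅ X := DerivedCategory.Q.objObjPreimageIso X
  (DerivedCategory.homologyFunctor B n).mapIso
      (F.mapDerivedCategory.mapIso e.symm ≪≫ F.mapDerivedCategoryFactors.app K) ≪≫
    (DerivedCategory.homologyFunctorFactors B n).app _ ≪≫
    (K.sc n).mapHomologyIso F ≪≫
    F.mapIso (((DerivedCategory.homologyFunctorFactors A n).app K).symm ≪≫
      (DerivedCategory.homologyFunctor A n).mapIso e)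

lemma boundedCohomologyIn_map (P : ObjectProperty A) (P' : ObjectProperty B)
    [P'.IsClosedUnderIsomorphisms] (F : A ⥤ B) [F.Additive]
    [PreservesFiniteLimits F] [PreservesFiniteColimits F] (hF : ∀ X, P X → P' (F.obj X))
    (X : BoundedDerived P) :
    boundedCohomologyIn P' (((boundedCohomologyIn P).ι ⋙ F.mapDerivedCategory).obj X) :=
  ⟨fun n => P'.prop_of_iso (mapDerivedHomologyIso F n X.obj).symm (hF _ (X.property.1 n)),
    let ⟨a, b, h⟩ := X.property.2
    ⟨a, b, fun n hn => (F.map_isZero (h n hn)).of_iso (mapDerivedHomologyIso F n X.obj)⟩⟩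

/-- The functor on bounded derived categories obtained by applying an exact functor `F` with
`F(P) ⊆ P'` termwise to complexes. -/
abbrev boundedDerivedMap (P : ObjectProperty A) (P' : ObjectProperty B)
    [P'.IsClosedUnderIsomorphisms] (F : A ⥤ B) [F.Additive]
    [PreservesFiniteLimits F] [PreservesFiniteColimits F] (hF : ∀ X, P X → P' (F.obj X)) :
    BoundedDerived P ⥤ BoundedDerived P' :=
  (boundedCohomologyIn P').lift ((boundedCohomologyIn P).ι ⋙ F.mapDerivedCategory)
    (boundedCohomologyIn_map P P' F hF)

/-- The objects of the bounded derived category which are isomorphic to one of the objects `S j`,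
viewed as complexes concentrated in degree `0`. -/
def isSingleOf (P : ObjectProperty A) {J : Type*} (S : J → A) :
    ObjectProperty (BoundedDerived P) := fun X =>
  ∃ j, Nonempty (X.obj ≅ (DerivedCategory.singleFunctor A 0).obj (S j))

end Derived

lemma exact_of_shortExact {A B : Type*} [Category* A] [Abelian A] [Category* B] [Abelian B]
    (F : A ⥤ B) [F.Additive]
    (hF : ∀ S : ShortComplex A, S.ShortExact → (S.map F).ShortExact) :
    PreservesFiniteLimits F ∧ PreservesFiniteColimits F :=
  (F.exact_tfae.out 0 3).1 hF

section Corner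

variable {A : Type u} [Ring A]

/-- The abelian group `eN = {e • x | x ∈ N}` for an element `e` of a ring `A` and an `A`-module
`N`. -/
def Corner (e : A) (N : Type v) [AddCommGroup N] [Module A N] : Type v :=
  (DistribSMul.toAddMonoidHom N e).range

variable (R : Type u) [CommRing R] [Algebra R A] (e : A)

section

variable (N : Type v) [AddCommGroup N] [Module A N]

instance : AddCommGroup (Corner e N) :=
  inferInstanceAs (AddCommGroup (DistribSMul.toAddMonoidHom N e).range)

/-- The inclusion `eN ⊆ N`. -/
def Corner.incl : Corner e N →+ N := (DistribSMul.toAddMonoidHom N e).range.subtype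

/-- For an `R`-algebra `A`, the `R`-action on `N` preserves `eN`. -/
instance : Module R (Corner e N) where
  smul r x := ⟨algebraMap R A r • x.1, by
    obtain ⟨_, y, rfl⟩ := x
    exact ⟨algebraMap R A r • y, by simp [← mul_smul, Algebra.commutes]⟩⟩
  one_smul x := Subtype.ext (show algebraMap R A 1 • x.1 = x.1 by simp)
  mul_smul r s x := Subtype.ext
    (show algebraMap R A (r * s) • x.1 = algebraMap R A r • algebraMap R A s • x.1 by
      simp [mul_smul])
  smul_zero r := Subtype.ext (show algebraMap R A r • (0 : N) = 0 by simp)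
  smul_add r x y := Subtype.ext
    (show algebraMap R A r • (x.1 + y.1) = algebraMap R A r • x.1 + algebraMap R A r • y.1 by simp)
  add_smul r s x := Subtype.ext
    (show algebraMap R A (r + s) • x.1 = algebraMap R A r • x.1 + algebraMap R A s • x.1 by
      simp [add_smul])
  zero_smul x := Subtype.ext (show algebraMap R A 0 • x.1 = 0 by simp)

variable {N}

lemma Corner.incl_injective : Function.Injective (Corner.incl e N) := Subtype.val_injective

@[simp]
lemma Corner.incl_smul (r : R) (x : Corner e N) :
    Corner.incl e N (r • x) = algebraMap R A r • Corner.incl e N x := rfl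

lemma Corner.exists_incl_eq (y : N) : ∃ x : Corner e N, Corner.incl e N x = e • y :=
  ⟨⟨e • y, y, rfl⟩, rfl⟩

variable {e} in
lemma Corner.smul_incl (he : IsIdempotentElem e) (x : Corner e N) :
    e • Corner.incl e N x = Corner.incl e N x := by
  obtain ⟨_, y, rfl⟩ := x
  change e • (e • y) = e • y
  rw [← mul_smul, he.eq]

variable {e} in
lemma Corner.exists_incl_eq_of_smul_eq {y : N} (hy : e • y = y) :
    ∃ x : Corner e N, Corner.incl e N x = y :=
  hy ▸ Corner.exists_incl_eq e y

end

variable {N N' N'' : Type v} [AddCommGroup N] [Module A N] [AddCommGroup N'] [Module A N']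
  [AddCommGroup N''] [Module A N'']

/-- The restriction `eN → eN'` of an `A`-linear map `N → N'`. -/
def Corner.map (f : N →ₗ[A] N') : Corner e N →ₗ[R] Corner e N' where
  toFun x := ⟨f x.1, by
    obtain ⟨_, y, rfl⟩ := x
    exact ⟨f y, by simp⟩⟩
  map_add' x y := Subtype.ext (map_add f x.1 y.1)
  map_smul' r x := Subtype.ext (map_smul f (algebraMap R A r) x.1)

@[simp]
lemma Corner.incl_map (f : N →ₗ[A] N') (x : Corner e N) :
    Corner.incl e N' (Corner.map R e f x) = f (Corner.incl e N x) := rfl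

lemma Corner.map_injective (f : N →ₗ[A] N') (hf : Function.Injective f) :
    Function.Injective (Corner.map R e f) := fun x y h => Corner.incl_injective e <| hf <| by
  simpa using congrArg (Corner.incl e N') h

variable {e} in
lemma Corner.map_surjective (he : IsIdempotentElem e) (f : N →ₗ[A] N')
    (hf : Function.Surjective f) : Function.Surjective (Corner.map R e f) := fun y => by
  obtain ⟨x, hx⟩ := hf (Corner.incl e N' y)
  obtain ⟨z, hz⟩ := Corner.exists_incl_eq e x
  refine ⟨z, Corner.incl_injective e ?_⟩
  rw [Corner.incl_map, hz, map_smul, hx, Corner.smul_incl he]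

variable {e} in
lemma Corner.map_exact (he : IsIdempotentElem e) (f : N →ₗ[A] N') (g : N' →ₗ[A] N'')
    (hfg : Function.Exact f g) : Function.Exact (Corner.map R e f) (Corner.map R e g) := fun y => by
  constructor
  · intro hy
    obtain ⟨x, hx⟩ := (hfg (Corner.incl e N' y)).1 (by
      simpa using congrArg (Corner.incl e N'') hy)
    obtain ⟨z, hz⟩ := Corner.exists_incl_eq e x
    refine ⟨z, Corner.incl_injective e ?_⟩
    rw [Corner.incl_map, hz, map_smul, hx, Corner.smul_incl he]
  · rintro ⟨x, rfl⟩
    refine Corner.incl_injective e ?_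
    rw [Corner.incl_map, Corner.incl_map, map_zero]
    exact (hfg _).2 ⟨_, rfl⟩

variable {e} in
lemma Corner.finite (he : IsIdempotentElem e) [Module.Finite R A] [Module.Finite A N] :
    Module.Finite R (Corner e N) := by
  let _ : Module R N := Module.compHom N (algebraMap R A)
  have : IsScalarTower R A N := ⟨fun r a x => by
    change (r • a) • x = algebraMap R A r • (a • x)
    rw [Algebra.smul_def, mul_smul]⟩
  have : Module.Finite R N := Module.Finite.trans A N
  let f : N →ₗ[R] Corner e N :=
    { toFun x := ⟨e • x, x, rfl⟩
      map_add' x y := Subtype.ext (smul_add e x y)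
      map_smul' r x := Subtype.ext (by
        change e • (algebraMap R A r • x) = algebraMap R A r • (e • x)
        rw [← mul_smul, ← mul_smul, Algebra.commutes]) }
  refine Module.Finite.of_surjective f fun x => ⟨Corner.incl e N x, Corner.incl_injective e ?_⟩
  exact Corner.smul_incl he x

variable {e}

/-- The functor `N ↦ eN` from `A`-modules to `R`-modules, for an idempotent `e` of the
`R`-algebra `A`. -/
def cornerFunctor (_ : IsIdempotentElem e) : ModuleCat.{v} A ⥤ ModuleCat.{v} R where
  obj N := ModuleCat.of R (Corner e N)
  map f := ModuleCat.ofHom (Corner.map R e f.hom)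

variable (he : IsIdempotentElem e)

instance : (cornerFunctor.{u, v} R he).Additive where

lemma cornerFunctor_shortExact (S : ShortComplex (ModuleCat.{v} A)) (hS : S.ShortExact) :
    (S.map (cornerFunctor R he)).ShortExact :=
  ModuleCat.shortComplex_shortExact _
    (Corner.map_exact R he _ _ ((ShortComplex.ShortExact.moduleCat_exact_iff_function_exact S).1
      hS.exact))
    (Corner.map_injective R e _ hS.moduleCat_injective_f)
    (Corner.map_surjective R he _ hS.moduleCat_surjective_g)

instance : PreservesFiniteLimits (cornerFunctor.{u, v} R he) :=
  (exact_of_shortExact (cornerFunctor.{u, v} R he) (cornerFunctor_shortExact R he)).1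

instance : PreservesFiniteColimits (cornerFunctor.{u, v} R he) :=
  (exact_of_shortExact (cornerFunctor.{u, v} R he) (cornerFunctor_shortExact R he)).2

end Corner

section FinitelyGenerated

/-- The finitely generated modules. -/
def finitelyGenerated (A : Type u) [Ring A] : ObjectProperty (ModuleCat.{v} A) :=
  fun N => Module.Finite A N

instance (A : Type u) [Ring A] [IsNoetherianRing A] :
    (finitelyGenerated.{u, v} A).IsSerreClass where
  exists_zero := ⟨ModuleCat.of A PUnit.{v + 1}, ModuleCat.isZero_of_subsingleton _,
    inferInstanceAs (Module.Finite A PUnit.{v + 1})⟩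
  prop_of_mono {X Y} f _ hY := by
    have : Module.Finite A Y := hY
    exact Module.Finite.of_injective f.hom ((ModuleCat.mono_iff_injective f).1 inferInstance)
  prop_of_epi {X Y} f _ hX := by
    have : Module.Finite A X := hX
    exact Module.Finite.of_surjective f.hom ((ModuleCat.epi_iff_surjective f).1 inferInstance)
  prop_X₂_of_shortExact {S} hS h₁ h₃ := by
    have : Module.Finite A S.X₁ := h₁
    have : Module.Finite A S.X₃ := h₃
    exact Module.Finite.of_exact
      ((ShortComplex.ShortExact.moduleCat_exact_iff_function_exact S).1 hS.exact)
      hS.moduleCat_surjective_g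

end FinitelyGenerated

section Graded

/-- If a family of subgroups `D i` of `M` spans `M` and there are additive maps `p i` which are
the identity on `D i` and zero on `D j` for `j ≠ i`, then `M` is the direct sum of the `D i`. -/
lemma isInternal_of_proj {M : Type v} [AddCommGroup M] (D : ℤ → AddSubgroup M) (p : ℤ → M →+ M)
    (h₁ : ∀ i, ∀ x ∈ D i, p i x = x) (h₂ : ∀ i j, i ≠ j → ∀ x ∈ D j, p i x = 0)
    (h₃ : ∀ x, x ∈ iSup D) : DirectSum.IsInternal D := by
  have key (i : ℤ) (z : DirectSum ℤ fun i => D i) :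
      p i (DirectSum.coeAddMonoidHom D z) = z i := by
    induction z using DirectSum.induction_on with
    | zero => simp
    | of j x =>
      rw [DirectSum.coeAddMonoidHom_of]
      by_cases hij : i = j
      · subst hij; simp [h₁ i x x.2]
      · rw [h₂ i j hij x x.2, DirectSum.of_eq_of_ne _ _ _ hij, ZeroMemClass.coe_zero]
    | add x y hx hy => simp [hx, hy]
  refine ⟨fun y z h => ?_, fun x => ?_⟩
  · ext i
    rw [← key, ← key, h]
  · have h : iSup D ≤ (DirectSum.coeAddMonoidHom D).range := iSup_le fun i y hy =>
      ⟨DirectSum.of (fun i => D i) i ⟨y, hy⟩, DirectSum.coeAddMonoidHom_of D i ⟨y, hy⟩⟩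
    exact h (h₃ x)

variable {A : Type u} [Ring A]

/-- A `ℤ`-graded (left) module over a ring `A` with grading `𝒜`. -/
structure GrMod (𝒜 : ℤ → AddSubgroup A) where
  carrier : Type v
  [addCommGroup : AddCommGroup carrier]
  [module : Module A carrier]
  deg : ℤ → AddSubgroup carrier
  isInternal : DirectSum.IsInternal deg
  smul_mem : ∀ (i j : ℤ), ∀ a ∈ 𝒜 i, ∀ x ∈ deg j, a • x ∈ deg (i + j)

variable {𝒜 : ℤ → AddSubgroup A}

namespace GrMod

instance : CoeSort (GrMod.{u, v} 𝒜) (Type v) := ⟨GrMod.carrier⟩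

attribute [instance] GrMod.addCommGroup GrMod.module

/-- A morphism of graded modules: an `A`-linear map which preserves degrees. -/
@[ext]
structure Hom (X Y : GrMod.{u, v} 𝒜) where
  lin : X →ₗ[A] Y
  map_mem : ∀ (i : ℤ), ∀ x ∈ X.deg i, lin x ∈ Y.deg i

instance : Category (GrMod.{u, v} 𝒜) where
  Hom := Hom
  id X := ⟨LinearMap.id, fun _ _ h => h⟩
  comp f g := ⟨g.lin.comp f.lin, fun i x h => g.map_mem i _ (f.map_mem i x h)⟩

variable {X Y Z : GrMod.{u, v} 𝒜}

@[ext]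
lemma hom_ext {f g : X ⟶ Y} (h : f.lin = g.lin) : f = g := Hom.ext h

@[simp] lemma lin_id : Hom.lin (𝟙 X) = LinearMap.id := rfl

@[simp] lemma lin_comp (f : X ⟶ Y) (g : Y ⟶ Z) : Hom.lin (f ≫ g) = g.lin.comp f.lin := rfl

instance : Add (X ⟶ Y) :=
  ⟨fun f g => ⟨f.lin + g.lin, fun i x h => add_mem (f.map_mem i x h) (g.map_mem i x h)⟩⟩

instance : Zero (X ⟶ Y) := ⟨⟨0, fun i _ _ => zero_mem (Y.deg i)⟩⟩

instance : Neg (X ⟶ Y) := ⟨fun f => ⟨-f.lin, fun i x h => neg_mem (f.map_mem i x h)⟩⟩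

instance : AddCommGroup (X ⟶ Y) where
  add_assoc f g h := hom_ext (add_assoc f.lin g.lin h.lin)
  zero_add f := hom_ext (zero_add f.lin)
  add_zero f := hom_ext (add_zero f.lin)
  neg_add_cancel f := hom_ext (neg_add_cancel f.lin)
  add_comm f g := hom_ext (add_comm f.lin g.lin)
  nsmul := nsmulRec
  zsmul := zsmulRec

@[simp] lemma lin_add (f g : X ⟶ Y) : Hom.lin (f + g) = f.lin + g.lin := rfl

@[simp] lemma lin_zero : Hom.lin (0 : X ⟶ Y) = 0 := rfl

instance : Preadditive (GrMod.{u, v} 𝒜) where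
  add_comp _ _ _ f f' g := hom_ext (LinearMap.comp_add f.lin f'.lin g.lin)
  comp_add _ _ _ f g g' := hom_ext (LinearMap.add_comp f.lin g'.lin g.lin)

/-- The functor forgetting the grading. -/
def forgetGrading (𝒜 : ℤ → AddSubgroup A) : GrMod.{u, v} 𝒜 ⥤ ModuleCat.{v} A where
  obj X := ModuleCat.of A X
  map f := ModuleCat.ofHom f.lin

instance : (forgetGrading.{u, v} 𝒜).Additive where

/-- The homogeneous component of degree `i`, as an additive map `X → X`. -/
def proj (X : GrMod.{u, v} 𝒜) (i : ℤ) : X →+ X :=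
  letI := X.isInternal.chooseDecomposition
  (X.deg i).subtype.comp ((DFinsupp.evalAddMonoidHom i).comp
    (DirectSum.decomposeAddEquiv X.deg).toAddMonoidHom)

lemma proj_mem (X : GrMod.{u, v} 𝒜) (i : ℤ) (x : X) : X.proj i x ∈ X.deg i := Subtype.property _

lemma proj_of_mem (X : GrMod.{u, v} 𝒜) (i : ℤ) (x : X) (hx : x ∈ X.deg i) : X.proj i x = x :=
  letI := X.isInternal.chooseDecomposition
  DirectSum.decompose_of_mem_same X.deg hx

lemma proj_of_mem_ne (X : GrMod.{u, v} 𝒜) (i j : ℤ) (hij : i ≠ j) (x : X) (hx : x ∈ X.deg j) :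
    X.proj i x = 0 :=
  letI := X.isInternal.chooseDecomposition
  DirectSum.decompose_of_mem_ne X.deg hx hij.symm

lemma exists_sum_proj (X : GrMod.{u, v} 𝒜) (x : X) :
    ∃ s : Finset ℤ, ∑ i ∈ s, X.proj i x = x := by
  classical
  let := X.isInternal.chooseDecomposition
  exact ⟨_, DirectSum.sum_support_decompose X.deg x⟩

lemma mem_of_proj (X : GrMod.{u, v} 𝒜) (H : AddSubgroup X) (x : X)
    (h : ∀ i, X.proj i x ∈ H) : x ∈ H := by
  obtain ⟨s, hs⟩ := X.exists_sum_proj x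
  exact hs ▸ sum_mem fun i _ => h i

lemma induction_proj (X : GrMod.{u, v} 𝒜) {M : Type*} [AddCommGroup M] (f g : X →+ M)
    (h : ∀ i, ∀ x ∈ X.deg i, f x = g x) : f = g := by
  ext x
  have := X.mem_of_proj (f - g).ker x fun i => by
    simp [AddMonoidHom.mem_ker, h i _ (X.proj_mem i x)]
  simpa [AddMonoidHom.mem_ker, sub_eq_zero] using this

lemma Hom.proj_apply (f : X ⟶ Y) (i : ℤ) (x : X) : Y.proj i (f.lin x) = f.lin (X.proj i x) := by
  refine DFunLike.congr_fun (X.induction_proj ((Y.proj i).comp f.lin.toAddMonoidHom)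
    (f.lin.toAddMonoidHom.comp (X.proj i)) fun j y hy => ?_) x
  by_cases hij : i = j
  · subst hij
    simp [X.proj_of_mem i y hy, Y.proj_of_mem i _ (f.map_mem i y hy)]
  · simp [X.proj_of_mem_ne i j hij y hy, Y.proj_of_mem_ne i j hij _ (f.map_mem j y hy)]

/-- A submodule is homogeneous if it contains all homogeneous components of its elements. -/
def IsHomogeneous (X : GrMod.{u, v} 𝒜) (K : Submodule A X) : Prop :=
  ∀ (i : ℤ), ∀ x ∈ K, X.proj i x ∈ K

/-- A homogeneous submodule as a graded module. -/
def sub (X : GrMod.{u, v} 𝒜) (K : Submodule A X) (hK : X.IsHomogeneous K) : GrMod.{u, v} 𝒜 where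
  carrier := K
  deg i := (X.deg i).comap K.subtype.toAddMonoidHom
  isInternal := by
    refine isInternal_of_proj _
      (fun i => ((X.proj i).comp K.subtype.toAddMonoidHom).codRestrict K fun x => hK i x x.2)
      (fun i x hx => Subtype.ext (X.proj_of_mem i x hx))
      (fun i j hij x hx => Subtype.ext (X.proj_of_mem_ne i j hij x hx)) fun x => ?_
    obtain ⟨s, hs⟩ := X.exists_sum_proj x
    have : x = ∑ i ∈ s, (⟨X.proj i x, hK i x x.2⟩ : K) := Subtype.ext (by simp [hs])
    rw [this]
    exact sum_mem fun i _ => AddSubgroup.mem_iSup_of_mem i (X.proj_mem i x)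
  smul_mem i j a ha x hx := X.smul_mem i j a ha x.1 hx

/-- The quotient of a graded module by a homogeneous submodule. -/
def quot (X : GrMod.{u, v} 𝒜) (K : Submodule A X) (hK : X.IsHomogeneous K) : GrMod.{u, v} 𝒜 where
  carrier := X ⧸ K
  deg i := (X.deg i).map K.mkQ.toAddMonoidHom
  isInternal := by
    refine isInternal_of_proj _
      (fun i => QuotientAddGroup.map K.toAddSubgroup K.toAddSubgroup (X.proj i)
        fun x hx => hK i x hx)
      (fun i x hx => ?_) (fun i j hij x hx => ?_) fun x => ?_
    · obtain ⟨y, hy, rfl⟩ := hx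
      exact congrArg K.mkQ (X.proj_of_mem i y hy)
    · obtain ⟨y, hy, rfl⟩ := hx
      exact congrArg K.mkQ (X.proj_of_mem_ne i j hij y hy)
    · obtain ⟨x, rfl⟩ := K.mkQ_surjective x
      obtain ⟨s, hs⟩ := X.exists_sum_proj x
      rw [← hs, map_sum]
      exact sum_mem fun i _ => AddSubgroup.mem_iSup_of_mem i ⟨_, X.proj_mem i x, rfl⟩
  smul_mem i j a ha x hx := by
    obtain ⟨y, hy, rfl⟩ := hx
    exact ⟨a • y, X.smul_mem i j a ha y hy, rfl⟩

/-- The shift `X(n)`, with `X(n)ᵢ = Xₙ₊ᵢ`. -/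
def shift (X : GrMod.{u, v} 𝒜) (n : ℤ) : GrMod.{u, v} 𝒜 where
  carrier := X
  deg i := X.deg (n + i)
  isInternal := by
    refine isInternal_of_proj _ (fun i => X.proj (n + i)) (fun i => X.proj_of_mem (n + i))
      (fun i j hij => X.proj_of_mem_ne _ _ (by simpa using hij)) fun x => ?_
    refine X.mem_of_proj _ x fun i => AddSubgroup.mem_iSup_of_mem (i - n) ?_
    rw [add_sub_cancel]
    exact X.proj_mem i x
  smul_mem i j a ha x hx := by
    rw [add_left_comm]
    exact X.smul_mem i (n + j) a ha x hx

/-- The direct sum of two graded modules. -/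
def prod (X Y : GrMod.{u, v} 𝒜) : GrMod.{u, v} 𝒜 where
  carrier := X × Y
  deg i := (X.deg i).prod (Y.deg i)
  isInternal := by
    refine isInternal_of_proj _ (fun i => (X.proj i).prodMap (Y.proj i))
      (fun i x hx => Prod.ext (X.proj_of_mem i _ hx.1) (Y.proj_of_mem i _ hx.2))
      (fun i j hij x hx => Prod.ext (X.proj_of_mem_ne i j hij _ hx.1)
        (Y.proj_of_mem_ne i j hij _ hx.2)) fun x => ?_
    have h₁ := X.mem_of_proj ((⨆ i, (X.deg i).prod (Y.deg i)).comap (AddMonoidHom.inl X Y)) x.1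
      fun i => AddSubgroup.mem_iSup_of_mem i ⟨X.proj_mem i x.1, zero_mem _⟩
    have h₂ := Y.mem_of_proj ((⨆ i, (X.deg i).prod (Y.deg i)).comap (AddMonoidHom.inr X Y)) x.2
      fun i => AddSubgroup.mem_iSup_of_mem i ⟨zero_mem _, Y.proj_mem i x.2⟩
    have := add_mem (AddSubgroup.mem_comap.1 h₁) (AddSubgroup.mem_comap.1 h₂)
    simpa using this
  smul_mem i j a ha x hx := ⟨X.smul_mem i j a ha _ hx.1, Y.smul_mem i j a ha _ hx.2⟩

/-- The direct sum of a finite family of graded modules. -/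
def pi {n : ℕ} (X : Fin n → GrMod.{u, v} 𝒜) : GrMod.{u, v} 𝒜 where
  carrier := ∀ t, X t
  deg i := AddSubgroup.pi Set.univ fun t => (X t).deg i
  isInternal := by
    refine isInternal_of_proj _
      (fun i => AddMonoidHom.mk' (fun x t => (X t).proj i (x t)) fun x y => by ext; simp)
      (fun i x hx => funext fun t => (X t).proj_of_mem i _ (hx t trivial))
      (fun i j hij x hx => funext fun t => (X t).proj_of_mem_ne i j hij _ (hx t trivial))
      fun x => ?_
    rw [← Finset.univ_sum_single x]
    refine sum_mem fun t _ => ?_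
    refine (X t).mem_of_proj ((⨆ i, AddSubgroup.pi Set.univ fun t => (X t).deg i).comap
      (AddMonoidHom.single (fun t => X t) t)) (x t) fun i => AddSubgroup.mem_iSup_of_mem i ?_
    intro s _
    by_cases hst : s = t
    · subst hst; simpa using (X s).proj_mem i (x s)
    · simp [Pi.single_eq_of_ne hst]
  smul_mem i j a ha x hx t _ := (X t).smul_mem i j a ha _ (hx t trivial)

/-- The zero graded module. -/
def zeroObj : GrMod.{u, v} 𝒜 where
  carrier := PUnit
  deg _ := ⊤
  isInternal := isInternal_of_proj _ (fun _ => 0) (fun _ _ _ => rfl) (fun _ _ _ _ _ => rfl)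
    fun _ => AddSubgroup.mem_iSup_of_mem 0 trivial
  smul_mem _ _ _ _ _ _ := trivial

instance : HasZeroObject (GrMod.{u, v} 𝒜) :=
  ⟨⟨zeroObj, (IsZero.iff_id_eq_zero _).2 (hom_ext (LinearMap.ext fun _ => rfl))⟩⟩

instance : HasBinaryBiproducts (GrMod.{u, v} 𝒜) where
  has_binary_biproduct X Y := HasBinaryBiproduct.mk
    { bicone :=
        { pt := X.prod Y
          fst := ⟨LinearMap.fst A X Y, fun _ _ h => h.1⟩
          snd := ⟨LinearMap.snd A X Y, fun _ _ h => h.2⟩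
          inl := ⟨LinearMap.inl A X Y, fun _ _ h => ⟨h, zero_mem _⟩⟩
          inr := ⟨LinearMap.inr A X Y, fun _ _ h => ⟨zero_mem _, h⟩⟩
          inl_fst := hom_ext (LinearMap.fst_comp_inl A X Y)
          inl_snd := hom_ext (LinearMap.snd_comp_inl A X Y)
          inr_fst := hom_ext (LinearMap.fst_comp_inr A X Y)
          inr_snd := hom_ext (LinearMap.snd_comp_inr A X Y) }
      isBilimit := isBinaryBilimitOfTotal _ (hom_ext (LinearMap.ext fun x => by
        exact Prod.ext (add_zero x.1) (zero_add x.2))) }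

instance : HasFiniteProducts (GrMod.{u, v} 𝒜) := hasFiniteProducts_of_has_binary_and_terminal

/-- The factorization of a morphism through an injective morphism with larger image. -/
def liftOfInjective (f : X ⟶ Y) (hf : Function.Injective f.lin) (s : Z ⟶ Y)
    (hs : ∀ z, s.lin z ∈ LinearMap.range f.lin) : Z ⟶ X where
  lin := (LinearEquiv.ofInjective f.lin hf).symm.toLinearMap.comp (s.lin.codRestrict _ hs)
  map_mem i z hz := by
    set x := (LinearEquiv.ofInjective f.lin hf).symm ⟨s.lin z, hs z⟩ with hx
    have h : f.lin x = s.lin z :=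
      congrArg Subtype.val ((LinearEquiv.ofInjective f.lin hf).apply_symm_apply ⟨s.lin z, hs z⟩)
    have : X.proj i x = x := hf (by
      rw [← Hom.proj_apply, h, Y.proj_of_mem i _ (s.map_mem i z hz)])
    change x ∈ X.deg i
    exact this ▸ X.proj_mem i x

lemma liftOfInjective_comp (f : X ⟶ Y) (hf : Function.Injective f.lin) (s : Z ⟶ Y)
    (hs : ∀ z, s.lin z ∈ LinearMap.range f.lin) : liftOfInjective f hf s hs ≫ f = s :=
  hom_ext (LinearMap.ext fun z =>
    congrArg Subtype.val ((LinearEquiv.ofInjective f.lin hf).apply_symm_apply ⟨s.lin z, hs z⟩))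

/-- The factorization of a morphism through a surjective morphism with smaller kernel. -/
def descOfSurjective (f : X ⟶ Y) (hf : Function.Surjective f.lin) (s : X ⟶ Z)
    (hs : LinearMap.ker f.lin ≤ LinearMap.ker s.lin) : Y ⟶ Z where
  lin := ((LinearMap.ker f.lin).liftQ s.lin hs).comp
    (f.lin.quotKerEquivOfSurjective hf).symm.toLinearMap
  map_mem i y hy := by
    obtain ⟨x, rfl⟩ := hf y
    have h : f.lin x = f.lin (X.proj i x) := by
      rw [← Hom.proj_apply, Y.proj_of_mem i _ hy]
    have e : (f.lin.quotKerEquivOfSurjective hf).symm (f.lin (X.proj i x)) =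
        (LinearMap.ker f.lin).mkQ (X.proj i x) := by
      rw [LinearEquiv.symm_apply_eq]; rfl
    rw [h, LinearMap.comp_apply, LinearEquiv.coe_coe, e]
    exact s.map_mem i _ (X.proj_mem i x)

lemma comp_descOfSurjective (f : X ⟶ Y) (hf : Function.Surjective f.lin) (s : X ⟶ Z)
    (hs : LinearMap.ker f.lin ≤ LinearMap.ker s.lin) : f ≫ descOfSurjective f hf s hs = s :=
  hom_ext (LinearMap.ext fun x => by
    have e : (f.lin.quotKerEquivOfSurjective hf).symm (f.lin x) =
        (LinearMap.ker f.lin).mkQ x := by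
      rw [LinearEquiv.symm_apply_eq]; rfl
    change (LinearMap.ker f.lin).liftQ s.lin hs ((f.lin.quotKerEquivOfSurjective hf).symm _) = _
    rw [e]; rfl)

lemma isHomogeneous_ker (f : X ⟶ Y) : X.IsHomogeneous (LinearMap.ker f.lin) := fun i x hx => by
  rw [LinearMap.mem_ker] at hx ⊢
  rw [← Hom.proj_apply, hx, map_zero]

lemma isHomogeneous_range (f : X ⟶ Y) : Y.IsHomogeneous (LinearMap.range f.lin) := by
  rintro i _ ⟨x, rfl⟩
  exact ⟨X.proj i x, (Hom.proj_apply f i x).symm⟩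

/-- The inclusion of the kernel of a morphism. -/
def kerIncl (f : X ⟶ Y) : X.sub (LinearMap.ker f.lin) (isHomogeneous_ker f) ⟶ X where
  lin := (LinearMap.ker f.lin).subtype
  map_mem _ _ h := h

/-- The projection to the cokernel of a morphism. -/
def cokerProj (f : X ⟶ Y) : Y ⟶ Y.quot (LinearMap.range f.lin) (isHomogeneous_range f) where
  lin := (LinearMap.range f.lin).mkQ
  map_mem _ x h := ⟨x, h, rfl⟩

lemma kerIncl_comp (f : X ⟶ Y) : kerIncl f ≫ f = 0 := hom_ext (LinearMap.ext fun x => x.2)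

lemma comp_cokerProj (f : X ⟶ Y) : f ≫ cokerProj f = 0 :=
  hom_ext (LinearMap.range_mkQ_comp f.lin)

lemma lin_apply_eq_zero {f : X ⟶ Y} {g : Y ⟶ Z} (h : f ≫ g = 0) (x : X) :
    g.lin (f.lin x) = 0 := LinearMap.congr_fun (congrArg Hom.lin h) x

/-- An injective morphism is a kernel of any morphism whose kernel is its image. -/
def isLimitOfInjective (f : X ⟶ Y) (hf : Function.Injective f.lin) (g : Y ⟶ Z) (w : f ≫ g = 0)
    (h : LinearMap.ker g.lin ≤ LinearMap.range f.lin) : IsLimit (KernelFork.ofι f w) :=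
  KernelFork.IsLimit.ofι f w
    (fun s hs => liftOfInjective f hf s fun z => h (lin_apply_eq_zero hs z))
    (fun s hs => liftOfInjective_comp f hf s _)
    (fun s hs m hm => hom_ext (LinearMap.ext fun z => hf (by
      have h₁ := LinearMap.congr_fun (congrArg Hom.lin hm) z
      have h₂ := LinearMap.congr_fun (congrArg Hom.lin (liftOfInjective_comp f hf s
        fun z => h (lin_apply_eq_zero hs z))) z
      exact h₁.trans h₂.symm)))

/-- A surjective morphism is a cokernel of any morphism whose image is its kernel. -/
def isColimitOfSurjective (f : X ⟶ Y) (g : Y ⟶ Z) (hg : Function.Surjective g.lin)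
    (w : f ≫ g = 0) (h : LinearMap.ker g.lin ≤ LinearMap.range f.lin) :
    IsColimit (CokernelCofork.ofπ g w) :=
  have h' {W : GrMod.{u, v} 𝒜} (s : Y ⟶ W) (hs : f ≫ s = 0) :
      LinearMap.ker g.lin ≤ LinearMap.ker s.lin := fun y hy => by
    obtain ⟨x, rfl⟩ := h hy
    exact lin_apply_eq_zero hs x
  CokernelCofork.IsColimit.ofπ g w
    (fun s hs => descOfSurjective g hg s (h' s hs))
    (fun s hs => comp_descOfSurjective g hg s _)
    (fun s hs m hm => hom_ext (LinearMap.ext fun z => by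
      obtain ⟨y, rfl⟩ := hg z
      have h₁ := LinearMap.congr_fun (congrArg Hom.lin hm) y
      have h₂ := LinearMap.congr_fun (congrArg Hom.lin (comp_descOfSurjective g hg s (h' s hs))) y
      exact h₁.trans h₂.symm))

instance : HasKernels (GrMod.{u, v} 𝒜) where
  has_limit f := ⟨_, isLimitOfInjective (kerIncl f) Subtype.val_injective f (kerIncl_comp f)
    fun x hx => ⟨⟨x, hx⟩, rfl⟩⟩

instance : HasCokernels (GrMod.{u, v} 𝒜) where
  has_colimit f := ⟨_, isColimitOfSurjective f (cokerProj f) (Submodule.mkQ_surjective _)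
    (comp_cokerProj f) (Submodule.ker_mkQ _).le⟩

lemma injective_of_mono (f : X ⟶ Y) [Mono f] : Function.Injective f.lin := by
  rw [← LinearMap.ker_eq_bot, eq_bot_iff]
  intro x hx
  have h : kerIncl f = 0 := by rw [← cancel_mono f, kerIncl_comp, zero_comp]
  exact LinearMap.congr_fun (congrArg Hom.lin h) ⟨x, hx⟩

lemma surjective_of_epi (f : X ⟶ Y) [Epi f] : Function.Surjective f.lin := by
  rw [← LinearMap.range_eq_top, eq_top_iff]
  intro y _
  have h : cokerProj f = 0 := by rw [← cancel_epi f, comp_cokerProj, comp_zero]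
  exact (Submodule.Quotient.mk_eq_zero _).1 (LinearMap.congr_fun (congrArg Hom.lin h) y)

/-- Graded modules and degree-preserving maps form an abelian category. -/
instance : Abelian (GrMod.{u, v} 𝒜) where
  normalMonoOfMono f _ := ⟨{
    Z := _
    g := cokerProj f
    w := comp_cokerProj f
    isLimit := isLimitOfInjective f (injective_of_mono f) (cokerProj f) (comp_cokerProj f)
      (Submodule.ker_mkQ _).le }⟩
  normalEpiOfEpi f _ := ⟨{
    W := _
    g := kerIncl f
    w := kerIncl_comp f
    isColimit := isColimitOfSurjective (kerIncl f) f (surjective_of_epi f) (kerIncl_comp f)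
      fun x hx => ⟨⟨x, hx⟩, rfl⟩ }⟩

lemma injective_of_shortExact {S : ShortComplex (GrMod.{u, v} 𝒜)} (hS : S.ShortExact) :
    Function.Injective S.f.lin :=
  have := hS.mono_f
  injective_of_mono S.f

lemma surjective_of_shortExact {S : ShortComplex (GrMod.{u, v} 𝒜)} (hS : S.ShortExact) :
    Function.Surjective S.g.lin :=
  have := hS.epi_g
  surjective_of_epi S.g

lemma exact_of_shortExact {S : ShortComplex (GrMod.{u, v} 𝒜)} (hS : S.ShortExact) :
    Function.Exact S.f.lin S.g.lin := fun y => by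
  constructor
  · intro hy
    have e := KernelFork.IsLimit.lift' hS.fIsKernel (kerIncl S.g) (kerIncl_comp S.g)
    exact ⟨e.1.lin ⟨y, hy⟩, LinearMap.congr_fun (congrArg Hom.lin e.2) ⟨y, hy⟩⟩
  · rintro ⟨x, rfl⟩
    exact lin_apply_eq_zero S.zero x

lemma shortExact_of_exact (S : ShortComplex (GrMod.{u, v} 𝒜)) (h₁ : Function.Injective S.f.lin)
    (h₂ : Function.Exact S.f.lin S.g.lin) (h₃ : Function.Surjective S.g.lin) : S.ShortExact where
  exact := S.exact_of_f_is_kernel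
    (isLimitOfInjective S.f h₁ S.g S.zero fun y hy => (h₂ y).1 hy)
  mono_f := mono_of_isLimit_fork
    (isLimitOfInjective S.f h₁ S.g S.zero fun y hy => (h₂ y).1 hy)
  epi_g := epi_of_isColimit_cofork
    (isColimitOfSurjective S.f S.g h₃ S.zero fun y hy => (h₂ y).1 hy)

lemma forgetGrading_shortExact (S : ShortComplex (GrMod.{u, v} 𝒜)) (hS : S.ShortExact) :
    (S.map (forgetGrading 𝒜)).ShortExact :=
  ModuleCat.shortComplex_shortExact _ (exact_of_shortExact hS)
    (injective_of_shortExact hS) (surjective_of_shortExact hS)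

instance : PreservesFiniteLimits (forgetGrading.{u, v} 𝒜) :=
  (NCR.exact_of_shortExact _ forgetGrading_shortExact).1

instance : PreservesFiniteColimits (forgetGrading.{u, v} 𝒜) :=
  (NCR.exact_of_shortExact _ forgetGrading_shortExact).2

/-- The finitely generated graded modules. -/
abbrev fg (𝒜 : ℤ → AddSubgroup A) : ObjectProperty (GrMod.{u, v} 𝒜) :=
  (finitelyGenerated.{u, v} A).inverseImage (forgetGrading 𝒜)

/-- The (graded) radical of a graded module: the intersection of its maximal proper homogeneous
submodules. -/
def radical (X : GrMod.{u, v} 𝒜) : Submodule A X :=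
  sInf {K | Maximal (fun L => X.IsHomogeneous L ∧ L ≠ ⊤) K}

lemma isHomogeneous_radical (X : GrMod.{u, v} 𝒜) : X.IsHomogeneous X.radical := fun i x hx => by
  rw [radical, Submodule.mem_sInf] at hx ⊢
  exact fun K hK => (Set.mem_ofPred_eq ▸ hK : Maximal _ K).prop.1 i x (hx K hK)

/-- A nonzero graded module which is not the direct sum of two nonzero homogeneous submodules. -/
def IsIndecomposable (X : GrMod.{u, v} 𝒜) : Prop :=
  Nontrivial X ∧ ∀ K L : Submodule A X, X.IsHomogeneous K → X.IsHomogeneous L → IsCompl K L →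
    K = ⊥ ∨ L = ⊥

end GrMod

section GradedCorner

variable {R : Type u} [CommRing R] (𝓡 : ℤ → AddSubgroup R) [Algebra R A] {e : A}

lemma GrMod.proj_smul (X : GrMod.{u, v} 𝒜) (he₀ : e ∈ 𝒜 0) (i : ℤ) (x : X) :
    X.proj i (e • x) = e • X.proj i x := by
  refine DFunLike.congr_fun (X.induction_proj ((X.proj i).comp (DistribSMul.toAddMonoidHom X e))
    ((DistribSMul.toAddMonoidHom X e).comp (X.proj i)) fun j y hy => ?_) x
  have hey : e • y ∈ X.deg j := by simpa using X.smul_mem 0 j e he₀ y hy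
  by_cases hij : i = j
  · subst hij
    simp [X.proj_of_mem i y hy, X.proj_of_mem i _ hey]
  · simp [X.proj_of_mem_ne i j hij y hy, X.proj_of_mem_ne i j hij _ hey]

/-- The graded `R`-module `eX`, with `(eX)ᵢ = eX ∩ Xᵢ`, for an idempotent `e` of degree `0`. -/
def GrMod.corner (he : IsIdempotentElem e) (he₀ : e ∈ 𝒜 0)
    (h𝓡 : ∀ i, ∀ r ∈ 𝓡 i, algebraMap R A r ∈ 𝒜 i) (X : GrMod.{u, v} 𝒜) : GrMod.{u, v} 𝓡 where
  carrier := Corner e X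
  deg i := (X.deg i).comap (Corner.incl e X)
  isInternal := by
    have hp (i : ℤ) (x : Corner e X) :
        X.proj i (Corner.incl e X x) ∈ (DistribSMul.toAddMonoidHom X e).range :=
      ⟨X.proj i (Corner.incl e X x), by
        change e • X.proj i (Corner.incl e X x) = _
        rw [← X.proj_smul he₀, Corner.smul_incl he]⟩
    refine isInternal_of_proj _
      (fun i => (((X.proj i).comp (Corner.incl e X)).codRestrict _ (hp i) :
        Corner e X →+ (DistribSMul.toAddMonoidHom X e).range))
      (fun i x hx => Subtype.ext (X.proj_of_mem i x.1 hx))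
      (fun i j hij x hx => Subtype.ext (X.proj_of_mem_ne i j hij x.1 hx)) fun x => ?_
    obtain ⟨s, hs⟩ := X.exists_sum_proj (Corner.incl e X x)
    let z (i : ℤ) : Corner e X := ⟨_, hp i x⟩
    have : x = ∑ i ∈ s, z i := Corner.incl_injective e (by rw [map_sum]; exact hs.symm)
    rw [this]
    exact sum_mem fun i _ => AddSubgroup.mem_iSup_of_mem i (X.proj_mem i _)
  smul_mem i j r hr x hx := X.smul_mem i j _ (h𝓡 i r hr) _ hx

/-- The functor `X ↦ eX` from graded `A`-modules to graded `R`-modules, for an idempotent `e` of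
degree `0` of the graded `R`-algebra `A`. -/
def grCornerFunctor (he : IsIdempotentElem e) (he₀ : e ∈ 𝒜 0)
    (h𝓡 : ∀ i, ∀ r ∈ 𝓡 i, algebraMap R A r ∈ 𝒜 i) : GrMod.{u, v} 𝒜 ⥤ GrMod.{u, v} 𝓡 where
  obj X := X.corner 𝓡 he he₀ h𝓡
  map f := ⟨Corner.map R e f.lin, fun i x hx => f.map_mem i _ hx⟩

variable (he : IsIdempotentElem e) (he₀ : e ∈ 𝒜 0)
  (h𝓡 : ∀ i, ∀ r ∈ 𝓡 i, algebraMap R A r ∈ 𝒜 i)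

instance : (grCornerFunctor.{u, v} 𝓡 he he₀ h𝓡).Additive where

lemma grCornerFunctor_shortExact (S : ShortComplex (GrMod.{u, v} 𝒜)) (hS : S.ShortExact) :
    (S.map (grCornerFunctor 𝓡 he he₀ h𝓡)).ShortExact :=
  GrMod.shortExact_of_exact _
    (Corner.map_injective R e _ (GrMod.injective_of_shortExact hS))
    (Corner.map_exact R he _ _ (GrMod.exact_of_shortExact hS))
    (Corner.map_surjective R he _ (GrMod.surjective_of_shortExact hS))

instance : PreservesFiniteLimits (grCornerFunctor.{u, v} 𝓡 he he₀ h𝓡) :=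
  (exact_of_shortExact _ (grCornerFunctor_shortExact 𝓡 he he₀ h𝓡)).1

instance : PreservesFiniteColimits (grCornerFunctor.{u, v} 𝓡 he he₀ h𝓡) :=
  (exact_of_shortExact _ (grCornerFunctor_shortExact 𝓡 he he₀ h𝓡)).2

end GradedCorner

section GradedEnd

variable {R : Type u} [CommRing R] {𝓡 : ℤ → AddSubgroup R}

namespace GrMod

/-- The endomorphisms of degree `n` of a graded module `X`. -/
def endDeg (X : GrMod.{u, u} 𝓡) (n : ℤ) : AddSubgroup (Module.End R X) where
  carrier := {φ | ∀ d, ∀ x ∈ X.deg d, φ x ∈ X.deg (n + d)}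
  add_mem' hφ hψ d x hx := add_mem (hφ d x hx) (hψ d x hx)
  zero_mem' _ _ _ := zero_mem _
  neg_mem' hφ d x hx := neg_mem (hφ d x hx)

variable (X : GrMod.{u, u} 𝓡)

lemma mem_endDeg_zero (f : X ⟶ X) : f.lin ∈ X.endDeg 0 := fun d x hx => by
  simpa using f.map_mem d x hx

lemma algebraMap_mem_endDeg (i : ℤ) (r : R) (hr : r ∈ 𝓡 i) :
    algebraMap R (Module.End R X) r ∈ X.endDeg i := fun d x hx => X.smul_mem i d r hr x hx

lemma exists_sum_proj_eq (x : X) :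
    ∃ s : Finset ℤ, ∀ t, s ⊆ t → ∑ i ∈ t, X.proj i x = x := by
  classical
  obtain ⟨s, hs⟩ := X.exists_sum_proj x
  refine ⟨s, fun t hst => ?_⟩
  rw [← Finset.sum_subset hst, hs]
  intro i _ hi
  rw [← hs, map_sum]
  refine Finset.sum_eq_zero fun j hj => X.proj_of_mem_ne i j ?_ _ (X.proj_mem j x)
  rintro rfl
  exact hi hj

/-- The homogeneous component of degree `n` of an additive endomorphism `φ`: on elements of degree
`d` it is `φ` followed by the projection to degree `n + d`. -/
def addComponent (n : ℤ) (φ : X →+ X) : X →+ X :=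
  letI := X.isInternal.chooseDecomposition
  (DirectSum.toAddMonoid fun d => (X.proj (n + d)).comp (φ.comp (X.deg d).subtype)).comp
    (DirectSum.decomposeAddEquiv X.deg).toAddMonoidHom

lemma addComponent_of_mem (n d : ℤ) (φ : X →+ X) (x : X) (hx : x ∈ X.deg d) :
    X.addComponent n φ x = X.proj (n + d) (φ x) := by
  let := X.isInternal.chooseDecomposition
  change DirectSum.toAddMonoid _ (DirectSum.decompose X.deg x) = _
  rw [DirectSum.decompose_of_mem X.deg hx, DirectSum.toAddMonoid_of]
  rfl

lemma proj_smul_of_mem (i j : ℤ) (r : R) (hr : r ∈ 𝓡 i) (x : X) :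
    X.proj (i + j) (r • x) = r • X.proj j x := by
  refine DFunLike.congr_fun (X.induction_proj
    ((X.proj (i + j)).comp (DistribSMul.toAddMonoidHom X r))
    ((DistribSMul.toAddMonoidHom X r).comp (X.proj j)) fun d y hy => ?_) x
  have hry := X.smul_mem i d r hr y hy
  by_cases h : j = d
  · subst h
    simp [X.proj_of_mem j y hy, X.proj_of_mem _ _ hry]
  · simp [X.proj_of_mem_ne j d h y hy, X.proj_of_mem_ne (i + j) (i + d) (by simpa using h) _ hry]

lemma end_ext {φ ψ : Module.End R X} (h : ∀ d, ∀ x ∈ X.deg d, φ x = ψ x) : φ = ψ :=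
  LinearMap.ext fun x => DFunLike.congr_fun
    (X.induction_proj φ.toAddMonoidHom ψ.toAddMonoidHom h) x

variable [GradedRing 𝓡]

/-- The homogeneous component of degree `n` of an `R`-linear endomorphism. -/
def component (n : ℤ) (φ : Module.End R X) : Module.End R X where
  toFun := X.addComponent n φ.toAddMonoidHom
  map_add' := map_add _
  map_smul' r x := by
    have h : (⊤ : AddSubgroup R) ≤
        { carrier := {r | ∀ x, X.addComponent n φ.toAddMonoidHom (r • x) =
            r • X.addComponent n φ.toAddMonoidHom x}
          add_mem' := fun {r s} hr hs x => by
            simp only [Set.mem_ofPred_eq] at hr hs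
            rw [add_smul, map_add, hr, hs, add_smul]
          zero_mem' := fun x => by simp
          neg_mem' := fun {r} hr x => by
            simp only [Set.mem_ofPred_eq] at hr
            rw [neg_smul, map_neg, hr, neg_smul] } := by
      intro s _
      classical
      rw [← DirectSum.sum_support_decompose 𝓡 s]
      refine sum_mem fun i _ x => ?_
      generalize hs : (DirectSum.decompose 𝓡 s i : R) = s'
      have hs' : s' ∈ 𝓡 i := hs ▸ SetLike.coe_mem _
      refine DFunLike.congr_fun (X.induction_proj
        ((X.addComponent n φ.toAddMonoidHom).comp (DistribSMul.toAddMonoidHom X s'))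
        ((DistribSMul.toAddMonoidHom X s').comp (X.addComponent n φ.toAddMonoidHom))
        fun d y hy => ?_) x
      have h₁ := X.addComponent_of_mem n (i + d) φ.toAddMonoidHom _ (X.smul_mem i d s' hs' y hy)
      have h₂ := X.addComponent_of_mem n d φ.toAddMonoidHom y hy
      simp only [AddMonoidHom.comp_apply, DistribSMul.toAddMonoidHom_apply, h₁, h₂]
      rw [add_left_comm]
      simpa using X.proj_smul_of_mem i (n + d) s' hs' (φ y)
    exact h (AddSubgroup.mem_top r) x

lemma component_of_mem (n d : ℤ) (φ : Module.End R X) (x : X) (hx : x ∈ X.deg d) :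
    X.component n φ x = X.proj (n + d) (φ x) := X.addComponent_of_mem n d _ x hx

lemma exists_sum_component (φ : Module.End R X) (x : X) :
    ∃ s : Finset ℤ, ∀ t, s ⊆ t → ∑ n ∈ t, X.component n φ x = φ x := by
  classical
  refine X.mem_of_proj
    { carrier := {x | ∃ s : Finset ℤ, ∀ t, s ⊆ t → ∑ n ∈ t, X.component n φ x = φ x}
      add_mem' := ?_
      zero_mem' := ⟨∅, fun t _ => by simp⟩
      neg_mem' := ?_ } x fun d => ?_
  · rintro x y ⟨s, hs⟩ ⟨s', hs'⟩
    refine ⟨s ∪ s', fun t ht => ?_⟩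
    simp only [map_add, Finset.sum_add_distrib]
    rw [hs t (Finset.union_subset_left ht), hs' t (Finset.union_subset_right ht)]
  · rintro x ⟨s, hs⟩
    refine ⟨s, fun t ht => ?_⟩
    simp only [map_neg, Finset.sum_neg_distrib]
    rw [hs t ht]
  · generalize hy : X.proj d x = y
    have hy' : y ∈ X.deg d := hy ▸ X.proj_mem d x
    obtain ⟨s, hs⟩ := X.exists_sum_proj_eq (φ y)
    refine ⟨s.image (· - d), fun t ht => ?_⟩
    simp only [X.component_of_mem _ d φ y hy']
    have h := hs (t.image (· + d)) fun i hi => Finset.mem_image.2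
      ⟨i - d, ht (Finset.mem_image_of_mem _ hi), by simp⟩
    rwa [Finset.sum_image fun a _ b _ h => by simpa using h] at h

/-- The endomorphism ring of a finitely generated graded module is the direct sum of its subgroups
of homogeneous endomorphisms. -/
lemma isInternal_endDeg [Module.Finite R X] : DirectSum.IsInternal X.endDeg := by
  classical
  refine isInternal_of_proj _
    (fun n => AddMonoidHom.mk' (X.component n) fun φ ψ => X.end_ext fun d x hx => by
      simp [X.component_of_mem _ d _ x hx])
    (fun n φ hφ => X.end_ext fun d x hx => ?_)
    (fun n m hnm φ hφ => X.end_ext fun d x hx => ?_) fun φ => ?_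
  · simp [X.component_of_mem _ d _ x hx, X.proj_of_mem _ _ (hφ d x hx)]
  · simp [X.component_of_mem _ d _ x hx,
      X.proj_of_mem_ne (n + d) (m + d) (by simpa using hnm) _ (hφ d x hx)]
  · obtain ⟨S, hS⟩ := Module.Finite.fg_top (R := R) (M := X)
    choose s hs using X.exists_sum_component φ
    have : φ = ∑ n ∈ S.biUnion s, X.component n φ := by
      refine LinearMap.ext_on hS fun x hx => ?_
      rw [LinearMap.sum_apply, hs x]
      exact Finset.subset_biUnion_of_mem s hx
    rw [this]
    refine sum_mem fun n _ => AddSubgroup.mem_iSup_of_mem n fun d x hx => ?_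
    rw [X.component_of_mem n d φ x hx]
    exact X.proj_mem _ _

/-- The endomorphism ring `Λ` of a finitely generated graded module, as a graded `Λ`-module. -/
def endSelf [Module.Finite R X] : GrMod.{u, u} X.endDeg where
  carrier := Module.End R X
  deg := X.endDeg
  isInternal := X.isInternal_endDeg
  smul_mem i j φ hφ ψ hψ d x hx := by
    rw [add_assoc]
    exact hφ _ _ (hψ d x hx)

/-- Right multiplication by a degree-preserving endomorphism `e` of `X` on `Λ = End(X)`. -/
def endMulRight [Module.Finite R X] (e : X ⟶ X) : X.endSelf ⟶ X.endSelf where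
  lin := LinearMap.toSpanSingleton (Module.End R X) (Module.End R X) e.lin
  map_mem _ _ hφ d x hx := hφ d _ (e.map_mem d x hx)

/-- The graded `Λ`-module `Λe`. -/
def endProj [Module.Finite R X] (e : X ⟶ X) : GrMod.{u, u} X.endDeg :=
  X.endSelf.sub _ (isHomogeneous_range (X.endMulRight e))

/-- The graded `Λ`-module `Λe / rad(Λe)`. -/
def endTop [Module.Finite R X] (e : X ⟶ X) : GrMod.{u, u} X.endDeg :=
  (X.endProj e).quot _ (X.endProj e).isHomogeneous_radical

variable (𝓡) in
/-- The graded ring `R` as a graded module over itself. -/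
def self : GrMod.{u, u} 𝓡 where
  carrier := R
  deg := 𝓡
  isInternal := DirectSum.Decomposition.isInternal 𝓡
  smul_mem _ _ _ hr _ hx := SetLike.mul_mem_graded hr hx

end GrMod

end GradedEnd

end Graded

section Hypotheses

variable (R : Type u) [CommRing R]

/-- A commutative noetherian ring (of finite Krull dimension) is Gorenstein if it has finite
injective dimension as a module over itself. -/
def IsGorenstein : Prop := ∃ n : ℕ, HasInjectiveDimensionLE (ModuleCat.of R R) n

variable {R}

/-- The singular locus of `Spec R` is contained in `{m}`. -/
def HasIsolatedSingularity (m : Ideal R) : Prop :=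
  ∀ (p : Ideal R) [p.IsPrime], p ≠ m → IsRegularLocalRing (Localization.AtPrime p)

/-- `M` has depth `dim R` with respect to `m`: there is an `M`-regular sequence of length `dim R`
in `m`. For a finitely generated module over a local noetherian ring `(R, m)` this says
that `M` is a (nonzero) maximal Cohen-Macaulay module. -/
def IsMaximalCohenMacaulay (m : Ideal R) (M : Type u) [AddCommGroup M] [Module R M] : Prop :=
  ∃ rs : List R, (∀ r ∈ rs, r ∈ m) ∧ RingTheory.Sequence.IsRegular M rs ∧
    (rs.length : WithBot ℕ∞) = ringKrullDim R

variable (R) in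
/-- A nonzero module which is not the direct sum of two nonzero submodules. -/
def IsIndecomposableModule (M : Type u) [AddCommGroup M] [Module R M] : Prop :=
  Nontrivial M ∧ ∀ K L : Submodule R M, IsCompl K L → K = ⊥ ∨ L = ⊥

/-- The ring `A` has finite (left) global dimension. -/
def HasFiniteGlobalDimension (A : Type u) [Ring A] : Prop :=
  ∃ n : ℕ, ∀ N : ModuleCat.{u} A, HasProjectiveDimensionLE N n

instance (M : Type u) [AddCommGroup M] [Module R M] [IsNoetherianRing R] [Module.Finite R M] :
    IsNoetherianRing (Module.End R M) :=
  isNoetherian_of_tower R inferInstance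

instance (M : Type u) [AddCommGroup M] [Module R M] [IsNoetherianRing R] [Module.Finite R M] :
    Module.Finite R (Module.End R M) :=
  inferInstanceAs (Module.Finite R (M →ₗ[R] M))

end Hypotheses

section Complete

/-- The left `A`-module `Ae / rad(Ae)`, for an element `e` of a ring `A`. -/
def topModule {A : Type u} [Ring A] (e : A) : ModuleCat.{u} A :=
  ModuleCat.of A (Submodule.span A {e} ⧸ Module.jacobson A (Submodule.span A {e}))

variable (R : Type u) [CommRing R] {l : ℕ} (N : Fin l → Type u) [∀ i, AddCommGroup (N i)]
  [∀ i, Module R (N i)]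

/-- `M = M₀ ⊕ M₁ ⊕ ⋯ ⊕ M_l` with `M₀ = R`, where `M₁, …, M_l` are the modules `N i`. -/
abbrev Total : Type u := R × ∀ i, N i

/-- `Λ = End_R(M)`. -/
abbrev Lam : Type u := Module.End R (Total R N)

/-- The idempotent `e₀ ∈ Λ` given by the projection `M → M₀ = R`. -/
def e₀ : Lam R N := (LinearMap.inl R R (∀ i, N i)).comp (LinearMap.fst R R (∀ i, N i))

lemma isIdempotentElem_e₀ : IsIdempotentElem (e₀ R N) := rfl

/-- The idempotent of `Λ` given by the projection of `M` to the summand `N i`. -/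
def idem (i : Fin l) : Lam R N :=
  ((LinearMap.inr R R (∀ i, N i)).comp (LinearMap.single R N i)).comp
    ((LinearMap.proj i).comp (LinearMap.snd R R (∀ i, N i)))

/-- The `Λ`-module `S = P / rad P`, with `P = Λe`, for `e` the idempotent of the summand `N i`. -/
def simpleModule (i : Fin l) : ModuleCat.{u} (Lam R N) := topModule (idem R N i)

/-- `D^b_f(A)`: the bounded derived category of complexes of `A`-modules with finitely generated
cohomology. -/
abbrev Dbf (A : Type u) [Ring A] [HasDerivedCategory.{w₁} (ModuleCat.{u} A)] : Type _ :=
  BoundedDerived (finitelyGenerated.{u, u} A)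

variable [IsNoetherianRing R] [∀ i, Module.Finite R (N i)]
  [HasDerivedCategory.{w₁} (ModuleCat.{u} (Lam R N))] [HasDerivedCategory.{w₂} (ModuleCat.{u} R)]

/-- The functor `Ξ : D^b_f(Λ) ⥤ D^b_f(R)`, `X ↦ e₀X`. -/
abbrev Xi : Dbf (Lam R N) ⥤ Dbf R :=
  boundedDerivedMap (finitelyGenerated.{u, u} (Lam R N)) (finitelyGenerated.{u, u} R)
    (cornerFunctor R (isIdempotentElem_e₀ R N)) fun X hX =>
      have : Module.Finite (Lam R N) X := hX
      Corner.finite R (isIdempotentElem_e₀ R N)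

/-- The objects `S_i`, `i ≠ 0`, of `D^b_f(Λ)`. -/
abbrev simples : ObjectProperty (Dbf (Lam R N)) :=
  isSingleOf (finitelyGenerated.{u, u} (Lam R N)) (simpleModule R N)

end Complete

section GradedCase

variable {R : Type u} [CommRing R] {𝓡 : ℤ → AddSubgroup R}

/-- The ideal generated by the homogeneous elements of positive degree. -/
def irrelevantIdeal (𝓡 : ℤ → AddSubgroup R) : Ideal R :=
  Ideal.span {r | ∃ n : ℤ, 0 < n ∧ r ∈ 𝓡 n}

variable [GradedRing 𝓡] {l : ℕ} (N : Fin l → GrMod.{u, u} 𝓡)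

/-- The graded module `M = M₀ ⊕ M₁ ⊕ ⋯ ⊕ M_l` with `M₀ = R`, where `M₁, …, M_l` are the graded
modules `N i`. -/
def grTotal : GrMod.{u, u} 𝓡 := (GrMod.self 𝓡).prod (GrMod.pi N)

instance [∀ i, Module.Finite R (N i)] : Module.Finite R (grTotal N) :=
  inferInstanceAs (Module.Finite R (R × ∀ i, N i))

/-- The graded ring `Λ = End_R(M)`, whose grading is `(grTotal N).endDeg`. -/
abbrev grLam : Type u := Module.End R (grTotal N)

/-- The projection `M → M₀ = R`, as an endomorphism of `M`. -/
def grProj₀ : grTotal N ⟶ grTotal N where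
  lin := (LinearMap.inl R R (∀ i, N i)).comp (LinearMap.fst R R (∀ i, N i))
  map_mem _ _ hx := ⟨hx.1, zero_mem _⟩

/-- The projection of `M` to the summand `N i`, as an endomorphism of `M`. -/
def grProj (i : Fin l) : grTotal N ⟶ grTotal N where
  lin := ((LinearMap.inr R R (∀ i, N i)).comp (LinearMap.single R (fun i => N i) i)).comp
    ((LinearMap.proj i).comp (LinearMap.snd R R (∀ i, N i)))
  map_mem d x hx := ⟨zero_mem _, fun j _ => by
    change Pi.single (M := fun i => N i) i (x.2 i) j ∈ (N j).deg d
    by_cases hij : j = i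
    · subst hij
      simpa using hx.2 j trivial
    · simp [Pi.single_eq_of_ne hij]⟩

/-- The idempotent `e₀ ∈ Λ` given by the projection `M → M₀ = R`. -/
def grE₀ : grLam N := (grProj₀ N).lin

lemma isIdempotentElem_grE₀ : IsIdempotentElem (grE₀ N) := rfl

lemma grE₀_mem : grE₀ N ∈ (grTotal N).endDeg 0 := (grTotal N).mem_endDeg_zero (grProj₀ N)

/-- The category of graded `Λ`-modules. -/
abbrev GrModLam : Type (u + 1) := GrMod.{u, u} (grTotal N).endDeg

/-- The graded `Λ`-module `S = P / rad P`, with `P = Λe`, for `e` the idempotent of the summand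
`N i`. -/
def grSimpleModule [∀ i, Module.Finite R (N i)] (i : Fin l) : GrModLam N :=
  (grTotal N).endTop (grProj N i)

/-- `D^b_f(A)` in the graded setting: the bounded derived category of complexes of graded
`A`-modules with finitely generated cohomology. -/
abbrev grDbf {A : Type u} [Ring A] (𝒜 : ℤ → AddSubgroup A)
    [HasDerivedCategory.{w₁} (GrMod.{u, u} 𝒜)] : Type _ :=
  BoundedDerived (GrMod.fg.{u, u} 𝒜)

variable [IsNoetherianRing R] [∀ i, Module.Finite R (N i)]
  [HasDerivedCategory.{w₁} (GrModLam N)] [HasDerivedCategory.{w₂} (GrMod.{u, u} 𝓡)]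

/-- The functor `Ξ : D^b_f(Λ) ⥤ D^b_f(R)`, `X ↦ e₀X`, in the graded setting. -/
abbrev grXi : grDbf (grTotal N).endDeg ⥤ grDbf 𝓡 :=
  boundedDerivedMap (GrMod.fg.{u, u} (grTotal N).endDeg) (GrMod.fg.{u, u} 𝓡)
    (grCornerFunctor 𝓡 (isIdempotentElem_grE₀ N) (grE₀_mem N)
      (grTotal N).algebraMap_mem_endDeg) fun X hX =>
      have : Module.Finite (grLam N) X := hX
      Corner.finite R (isIdempotentElem_grE₀ N)

/-- The objects `S_i(n)`, `i ≠ 0`, `n ∈ ℤ`, of `D^b_f(Λ)`, in the graded setting. -/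
abbrev grSimples : ObjectProperty (grDbf (grTotal N).endDeg) :=
  isSingleOf (GrMod.fg.{u, u} (grTotal N).endDeg)
    fun j : Fin l × ℤ => (grSimpleModule N j.1).shift j.2

end GradedCase

end NCR

end

open NCR

/-! Multiplication by `e₀` is exact, so the theorem is an instance of a statement about an exact
functor `F` of abelian categories, `verdierLift_boundedDerivedMap`. It needs two inputs: the
finitely generated objects killed by `F` are iterated extensions of the `S_j`, and every finitely
generated target object is a quotient of some `F N` with `N` relatively projective, meaning that `N`
and `F N` are projective and `Hom(N, Y) = Hom(F N, F Y)`.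

These inputs suffice. As `F` is exact, a complex dies under `F` iff its cohomology does, and
dévissage identifies the kernel with `⟨S_j⟩`. Resolving from the top, any `X` in the target receives
a map from `F L`, with `L` built from finitely many relatively projectives and the cone in
arbitrarily low degrees (`exists_approximation`). Truncating `L` below the cohomology of `X` gives a
preimage of `X`; since maps out of `F L` lift, the same truncation turns a morphism `F X ⟶ F Y` into
a fraction. The induced functor on the quotient is thus full and essentially surjective, and it
reflects zero objects; a full triangulated functor that reflects zero objects is faithful.

The relatively projectives are the sums of copies of `Λe₀ ≅ M` (shifted in the graded case): `e₀M =
R` and both `Hom_Λ(M^n, Y)` and `Hom_R(R^n, e₀Y)` are `(e₀Y)^n`.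

For the kernel, the Gorenstein property makes `Ext^i(M_j, R)`, `i > 0`, vanish locally at `m` for
`M_j` maximal Cohen-Macaulay. At a prime `p < m` the ring `R_p` is regular, so `M_j` has finite
projective dimension there, and the vanishing of Ext makes it projective
(`IsMaximalCohenMacaulay.isLocallyProjective`). Hence a multiple of the identity of `M_j` by some `s
∉ p` factors through a free module, so it lies in `Λe₀Λ`; a finitely generated `Λ`-module killed by
`e₀` is therefore supported at `m` and has finite length. Since the endomorphism ring of `M_j` (its
degree `0` part in the graded case) is local, `Λe_j` has a unique maximal (homogeneous) submodule,
and a simple module on which `e_j` acts nontrivially is `S_j` up to shift. Finally `e₀S_j = 0`, as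
otherwise `M_j` would be a retract of `R`, hence isomorphic to it up to shift. -/

set_option linter.unusedSectionVars false

noncomputable section

namespace NCR

/-! ### A criterion for equivalence with a Verdier quotient -/

section VerdierQuotient

variable {C : Type*} [Category* C] [HasZeroObject C] [HasShift C ℤ] [Preadditive C]
  [∀ n : ℤ, (shiftFunctor C n).Additive] [Pretriangulated C]
  {D : Type*} [Category* D] [HasZeroObject D] [HasShift D ℤ] [Preadditive D]
  [∀ n : ℤ, (shiftFunctor D n).Additive] [Pretriangulated D]

section Distinguished

variable {X Y Z : C} {f : X ⟶ Y} {g : Y ⟶ Z} {h : Z ⟶ X⟦(1 : ℤ)⟧}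

lemma exists_eq_comp_of_dist (hT : Triangle.mk f g h ∈ distTriang C) {V : C} (a : Y ⟶ V)
    (ha : f ≫ a = 0) : ∃ b : Z ⟶ V, a = g ≫ b := Triangle.yoneda_exact₂ _ hT a ha

lemma exists_eq_comp_of_dist' (hT : Triangle.mk f g h ∈ distTriang C) {V : C} (a : Z ⟶ V)
    (ha : g ≫ a = 0) : ∃ b : X⟦(1 : ℤ)⟧ ⟶ V, a = h ≫ b := Triangle.yoneda_exact₃ _ hT a ha

lemma exists_comp_eq_of_dist (hT : Triangle.mk f g h ∈ distTriang C) {V : C} (a : V ⟶ Y)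
    (ha : a ≫ g = 0) : ∃ b : V ⟶ X, a = b ≫ f := Triangle.coyoneda_exact₂ _ hT a ha

lemma exists_comp_eq_of_dist' (hT : Triangle.mk f g h ∈ distTriang C) {V : C} (a : V ⟶ Z)
    (ha : a ≫ h = 0) : ∃ b : V ⟶ Y, a = b ≫ g := Triangle.coyoneda_exact₃ _ hT a ha

lemma comp_eq_zero_of_dist (hT : Triangle.mk f g h ∈ distTriang C) : f ≫ g = 0 :=
  comp_distTriang_mor_zero₁₂ _ hT

lemma comp_eq_zero_of_dist' (hT : Triangle.mk f g h ∈ distTriang C) : g ≫ h = 0 :=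
  comp_distTriang_mor_zero₂₃ _ hT

lemma map_dist (F : C ⥤ D) [F.CommShift ℤ] [F.IsTriangulated]
    (hT : Triangle.mk f g h ∈ distTriang C) :
    Triangle.mk (F.map f) (F.map g) (F.map h ≫ (F.commShiftIso (1 : ℤ)).hom.app X) ∈ distTriang D :=
  F.map_distinguished _ hT

lemma invRotate_dist (hT : Triangle.mk f g h ∈ distTriang C) :
    ∃ k : Z⟦(-1 : ℤ)⟧ ⟶ X, ∃ e : Y ⟶ (Z⟦(-1 : ℤ)⟧)⟦(1 : ℤ)⟧, Triangle.mk k f e ∈ distTriang C :=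
  ⟨_, _, inv_rot_of_distTriang _ hT⟩

lemma isZero_iff_isIso_of_dist (hT : Triangle.mk f g h ∈ distTriang C) : IsZero Z ↔ IsIso f :=
  Triangle.isZero₃_iff_isIso₁ _ hT

end Distinguished

/-- A triangulated functor which reflects zero objects reflects isomorphisms. -/
lemma isIso_of_isIso_map_of_reflects_zero (F : C ⥤ D) [F.CommShift ℤ] [F.IsTriangulated]
    (h₀ : ∀ X, IsZero (F.obj X) → IsZero X) {X Y : C} (f : X ⟶ Y) [IsIso (F.map f)] :
    IsIso f := by
  obtain ⟨Z, g, h, hT⟩ := distinguished_cocone_triangle f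
  exact (isZero_iff_isIso_of_dist hT).1 (h₀ _
    ((isZero_iff_isIso_of_dist (map_dist F hT)).2 inferInstance))

/-- A full triangulated functor which reflects zero objects is faithful. -/
lemma faithful_of_full_of_reflects_zero (F : C ⥤ D) [F.CommShift ℤ] [F.IsTriangulated] [F.Full]
    (h₀ : ∀ X, IsZero (F.obj X) → IsZero X) : F.Faithful := by
  suffices key : ∀ {X Y : C} (f : X ⟶ Y), F.map f = 0 → f = 0 from
    ⟨fun {X Y} a b hab => sub_eq_zero.1 (key _ (by rw [F.map_sub, hab, sub_self]))⟩
  intro X Y f hf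
  obtain ⟨Z, g, h, hT⟩ := distinguished_cocone_triangle f
  -- As `F f = 0`, the map `F g` has a retraction, which lifts by fullness. Then `g ≫ r` is
  -- invertible after `F`, hence invertible, while `f ≫ g = 0`.
  obtain ⟨r, hr⟩ := exists_eq_comp_of_dist (map_dist F hT) (𝟙 (F.obj Y)) (by rw [hf, zero_comp])
  obtain ⟨r, rfl⟩ := F.map_surjective r
  have : IsIso (F.map (g ≫ r)) := by rw [F.map_comp, ← hr]; infer_instance
  have := isIso_of_isIso_map_of_reflects_zero F h₀ (g ≫ r)
  rw [← cancel_mono (g ≫ r), reassoc_of% (comp_eq_zero_of_dist hT), zero_comp, zero_comp]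

variable {P : ObjectProperty C} {F : C ⥤ D} [F.CommShift ℤ] [F.IsTriangulated]

/-- `F` sends the cone of `f` to the cone of `F f`, and a morphism is invertible iff its cone is
zero. -/
lemma trW_iff_isIso_map (hP : ∀ X, triangulatedSpan P X ↔ IsZero (F.obj X))
    {X Y : C} (f : X ⟶ Y) : (triangulatedSpan P).trW f ↔ IsIso (F.map f) := by
  obtain ⟨Z, g, h, hT⟩ := distinguished_cocone_triangle f
  exact ((triangulatedSpan P).trW_iff_of_distinguished _ hT).trans <|
    (hP Z).trans (Triangle.isZero₃_iff_isIso₁ _ (F.map_distinguished _ hT))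

lemma isInvertedBy_of_isZero (hP : ∀ X, triangulatedSpan P X ↔ IsZero (F.obj X)) :
    (triangulatedSpan P).trW.IsInvertedBy F := fun _ _ f hf => (trW_iff_isIso_map hP f).1 hf

/-- A triangulated functor `F : C ⥤ D` with kernel `⟨P⟩` induces an equivalence `C/⟨P⟩ ≌ D` if it
is essentially surjective and if every morphism `F.obj X ⟶ F.obj Y` is a fraction of images of
morphisms of `C`. -/
lemma isEquivalence_verdierLift [IsTriangulated C]
    (hP : ∀ X, triangulatedSpan P X ↔ IsZero (F.obj X))
    (hF : (triangulatedSpan P).trW.IsInvertedBy F)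
    (hlift : ∀ (X Y : C) (φ : F.obj X ⟶ F.obj Y), ∃ (X' : C) (s : X' ⟶ X) (f : X' ⟶ Y),
      IsIso (F.map s) ∧ F.map f = F.map s ≫ φ)
    (hsurj : ∀ Z : D, ∃ X : C, Nonempty (F.obj X ≅ Z)) :
    (verdierLift P F hF).IsEquivalence := by
  let W := (triangulatedSpan P).trW
  let Q := W.Q
  let G := verdierLift P F hF
  have hQ {X Y : C} (f : X ⟶ Y) : G.map (Q.map f) = F.map f := by
    have := Functor.congr_hom (Localization.Construction.fac F hF) f
    exact this.trans ((Category.id_comp _).trans (Category.comp_id _))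
  have hobj : ∀ X : W.Localization, ∃ X₀ : C, X = Q.obj X₀ := fun X => ⟨X.as.obj, rfl⟩
  have hfull : G.Full := ⟨fun {X Y} φ => by
    obtain ⟨X, rfl⟩ := hobj X
    obtain ⟨Y, rfl⟩ := hobj Y
    obtain ⟨X', s, f, hs, hf⟩ := hlift X Y φ
    have : IsIso (Q.map s) := Localization.inverts Q W s ((trW_iff_isIso_map hP s).2 hs)
    refine ⟨inv (Q.map s) ≫ Q.map f, ?_⟩
    have h₁ : G.map (Q.map s) ≫ G.map (inv (Q.map s) ≫ Q.map f) = G.map (Q.map s) ≫ φ := by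
      rw [← G.map_comp, IsIso.hom_inv_id_assoc, hQ, hQ]
      exact hf
    exact (cancel_epi (G.map (Q.map s))).1 h₁⟩
  have hzero : ∀ X, IsZero (G.obj X) → IsZero X := fun X hX => by
    obtain ⟨X, rfl⟩ := hobj X
    have h₁ : triangulatedSpan P X := (hP X).2 hX
    -- An object killed by `F` becomes zero in the quotient because its map to `0` is among the
    -- inverted morphisms.
    have h₂ : W (0 : X ⟶ 0) := (trW_iff_isIso_map hP _).2
      (((hP X).1 h₁).isIso (F.map_isZero (isZero_zero C)) _)
    have := Localization.inverts Q W _ h₂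
    exact (Q.map_isZero (isZero_zero C)).of_iso (asIso (Q.map (0 : X ⟶ 0)))
  have hfaith : G.Faithful := faithful_of_full_of_reflects_zero G hzero
  have hess : G.EssSurj := ⟨fun Z => by
    obtain ⟨X, ⟨e⟩⟩ := hsurj Z
    exact ⟨Q.obj X, ⟨e⟩⟩⟩
  exact { }

end VerdierQuotient

/-! ### Pairs of objects on which a triangulated functor is bijective on morphisms -/

section HomBijective

variable {C : Type*} [Category* C] [HasZeroObject C] [HasShift C ℤ] [Preadditive C]
  [∀ n : ℤ, (shiftFunctor C n).Additive] [Pretriangulated C]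
  {D : Type*} [Category* D] [HasZeroObject D] [HasShift D ℤ] [Preadditive D]
  [∀ n : ℤ, (shiftFunctor D n).Additive] [Pretriangulated D]
  (F : C ⥤ D)

/-- `F` is bijective on morphisms from `L` to `Y`. -/
def HomBijective (L Y : C) : Prop := Function.Bijective (F.map : (L ⟶ Y) → (F.obj L ⟶ F.obj Y))

variable {F}

lemma HomBijective.of_iso {L L' Y Y' : C} (h : HomBijective F L Y) (e : L ≅ L') (e' : Y ≅ Y') :
    HomBijective F L' Y' := by
  refine ⟨fun a b hab => ?_, fun φ => ?_⟩
  · rw [← cancel_epi e.hom, ← cancel_mono e'.inv]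
    exact h.1 (by simp [hab])
  · obtain ⟨a, ha⟩ := h.2 (F.map e.hom ≫ φ ≫ F.map e'.inv)
    refine ⟨e.inv ≫ a ≫ e'.hom, ?_⟩
    rw [F.map_comp, F.map_comp, ha]
    simp [← F.map_comp, ← F.map_comp_assoc]

variable [F.CommShift ℤ]

lemma HomBijective.shift {L Y : C} (h : HomBijective F L Y) (n : ℤ) :
    HomBijective F (L⟦n⟧) (Y⟦n⟧) := by
  refine ⟨fun a b hab => ?_, fun φ => ?_⟩
  · obtain ⟨a, rfl⟩ := (shiftFunctor C n).map_surjective a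
    obtain ⟨b, rfl⟩ := (shiftFunctor C n).map_surjective b
    congr 1
    refine h.1 ((shiftFunctor D n).map_injective ?_)
    rw [← cancel_epi ((F.commShiftIso n).hom.app L), ← F.commShiftIso_hom_naturality,
      ← F.commShiftIso_hom_naturality, hab]
  · obtain ⟨ψ, hψ⟩ := (shiftFunctor D n).map_surjective
      ((F.commShiftIso n).inv.app L ≫ φ ≫ (F.commShiftIso n).hom.app Y)
    obtain ⟨a, rfl⟩ := h.2 ψ
    refine ⟨a⟦n⟧', ?_⟩
    rw [← cancel_mono ((F.commShiftIso n).hom.app Y), F.commShiftIso_hom_naturality, hψ]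
    simp

/-- `F` is bijective on morphisms of all degrees from `L` to `Y`. -/
def ShiftedHomBijective (F : C ⥤ D) (L Y : C) : Prop := ∀ n : ℤ, HomBijective F L (Y⟦n⟧)

lemma ShiftedHomBijective.homBijective {L Y : C} (h : ShiftedHomBijective F L Y) :
    HomBijective F L Y :=
  (h 0).of_iso (Iso.refl _) ((shiftFunctorZero C ℤ).app Y)

lemma ShiftedHomBijective.of_iso {L L' Y Y' : C} (h : ShiftedHomBijective F L Y) (e : L ≅ L')
    (e' : Y ≅ Y') : ShiftedHomBijective F L' Y' :=
  fun n => (h n).of_iso e ((shiftFunctor C n).mapIso e')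

lemma ShiftedHomBijective.shift_right {L Y : C} (h : ShiftedHomBijective F L Y) (m : ℤ) :
    ShiftedHomBijective F L (Y⟦m⟧) :=
  fun n => (h (m + n)).of_iso (Iso.refl _) ((shiftFunctorAdd C m n).app Y)

lemma ShiftedHomBijective.shift_left {L Y : C} (h : ShiftedHomBijective F L Y) (m : ℤ) :
    ShiftedHomBijective F (L⟦m⟧) Y :=
  fun n => ((h (n - m)).shift m).of_iso (Iso.refl _)
    ((shiftFunctorAdd' C (n - m) m n (by simp)).symm.app Y)

variable [F.IsTriangulated]

/-- The five lemma for `Hom(-, V)` along `Z⟦-1⟧ ⟶ X ⟶ Y ⟶ Z ⟶ X⟦1⟧`, carried out by chasing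
morphisms. -/
lemma homBijective_source {X Y Z : C} {f : X ⟶ Y} {g : Y ⟶ Z} {h : Z ⟶ X⟦(1 : ℤ)⟧}
    (hT : Triangle.mk f g h ∈ distTriang C) {V : C} (h₁ : HomBijective F X V)
    (h₃ : HomBijective F Z V) (h₁' : HomBijective F (X⟦(1 : ℤ)⟧) V)
    (h₃' : HomBijective F (Z⟦(-1 : ℤ)⟧) V) : HomBijective F Y V := by
  have hT' := map_dist F hT
  refine ⟨?_, fun φ => ?_⟩
  · suffices key : ∀ b : Y ⟶ V, F.map b = 0 → b = 0 from
      fun a b hab => sub_eq_zero.1 (key _ (by rw [F.map_sub, hab, sub_self]))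
    intro b hb
    obtain ⟨c, rfl⟩ := exists_eq_comp_of_dist hT b
      (h₁.1 (by rw [F.map_comp, hb, comp_zero, F.map_zero]))
    obtain ⟨d, hd⟩ := exists_eq_comp_of_dist' hT' (F.map c) (by rw [← F.map_comp, hb])
    obtain ⟨d', hd'⟩ := h₁'.2 ((F.commShiftIso (1 : ℤ)).hom.app X ≫ d)
    obtain rfl : c = h ≫ d' := h₃.1 (by rw [hd, F.map_comp, hd', Category.assoc])
    rw [reassoc_of% (comp_eq_zero_of_dist' hT), zero_comp]
  · obtain ⟨a, ha⟩ := h₁.2 (F.map f ≫ φ)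
    obtain ⟨k, e, hT₁⟩ := invRotate_dist hT
    obtain ⟨b, rfl⟩ := exists_eq_comp_of_dist hT₁ a (h₃'.1 (by
      rw [F.map_comp, ha, ← F.map_comp_assoc, comp_eq_zero_of_dist hT₁, F.map_zero, zero_comp,
        F.map_zero]))
    obtain ⟨c, hc⟩ := exists_eq_comp_of_dist hT' (φ - F.map b) (by
      rw [Preadditive.comp_sub, ← ha, F.map_comp, sub_self])
    obtain ⟨c, rfl⟩ := h₃.2 c
    refine ⟨b + g ≫ c, ?_⟩
    rw [F.map_add, F.map_comp, ← hc]
    abel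

/-- The dual chase, for `Hom(V, -)` along the same five terms. -/
lemma homBijective_target {X Y Z : C} {f : X ⟶ Y} {g : Y ⟶ Z} {h : Z ⟶ X⟦(1 : ℤ)⟧}
    (hT : Triangle.mk f g h ∈ distTriang C) {V : C} (h₁ : HomBijective F V X)
    (h₃ : HomBijective F V Z) (h₁' : HomBijective F V (X⟦(1 : ℤ)⟧))
    (h₃' : HomBijective F V (Z⟦(-1 : ℤ)⟧)) : HomBijective F V Y := by
  have hT' := map_dist F hT
  refine ⟨?_, fun φ => ?_⟩
  · suffices key : ∀ b : V ⟶ Y, F.map b = 0 → b = 0 from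
      fun a b hab => sub_eq_zero.1 (key _ (by rw [F.map_sub, hab, sub_self]))
    intro b hb
    obtain ⟨c, rfl⟩ := exists_comp_eq_of_dist hT b
      (h₃.1 (by rw [F.map_comp, hb, zero_comp, F.map_zero]))
    obtain ⟨k, e, hT₁⟩ := invRotate_dist hT
    obtain ⟨d, hd⟩ := exists_comp_eq_of_dist (map_dist F hT₁) (F.map c) (by rw [← F.map_comp, hb])
    obtain ⟨d', rfl⟩ := h₃'.2 d
    obtain rfl : c = d' ≫ k := h₁.1 (by rw [hd, F.map_comp])
    rw [Category.assoc, comp_eq_zero_of_dist hT₁, comp_zero]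
  · obtain ⟨a, ha⟩ := h₃.2 (φ ≫ F.map g)
    obtain ⟨b, rfl⟩ := exists_comp_eq_of_dist' hT a (h₁'.1 (by
      rw [F.map_comp, ha, Category.assoc, ← F.map_comp, comp_eq_zero_of_dist' hT, F.map_zero,
        comp_zero, F.map_zero]))
    obtain ⟨c, hc⟩ := exists_comp_eq_of_dist hT' (φ - F.map b) (by
      rw [Preadditive.sub_comp, ← ha, F.map_comp, sub_self])
    obtain ⟨c, rfl⟩ := h₁.2 c
    refine ⟨b + c ≫ f, ?_⟩
    rw [F.map_add, F.map_comp c, ← hc]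
    abel

/-- The objects `Y` such that `F` is bijective on morphisms of all degrees from `L` to `Y`. -/
def shiftedHomBijectiveFrom (F : C ⥤ D) (L : C) : ObjectProperty C := ShiftedHomBijective F L

instance (L : C) : (shiftedHomBijectiveFrom F L).IsClosedUnderIsomorphisms where
  of_iso e h := ShiftedHomBijective.of_iso h (Iso.refl _) e

instance (L : C) : (shiftedHomBijectiveFrom F L).IsTriangulated where
  exists_zero := ⟨0, isZero_zero C, fun n =>
    have h₁ : IsZero ((0 : C)⟦n⟧) := (shiftFunctor C n).map_isZero (isZero_zero C)
    ⟨fun _ _ _ => h₁.eq_of_tgt _ _, fun _ => ⟨0, (F.map_isZero h₁).eq_of_tgt _ _⟩⟩⟩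
  isStableUnderShiftBy m := ⟨fun _ h => ShiftedHomBijective.shift_right h m⟩
  toIsTriangulatedClosed₂ := .mk' fun T hT h₁ h₃ n => by
    have hT' := Triangle.shift_distinguished _ hT n
    exact homBijective_target hT' (h₁ n) (h₃ n)
      (ShiftedHomBijective.shift_right h₁ n 1) (ShiftedHomBijective.shift_right h₃ n (-1))

lemma shiftedHomBijective_source {X Y Z : C} {f : X ⟶ Y} {g : Y ⟶ Z} {h : Z ⟶ X⟦(1 : ℤ)⟧}
    (hT : Triangle.mk f g h ∈ distTriang C) {V : C} (h₁ : ShiftedHomBijective F X V)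
    (h₃ : ShiftedHomBijective F Z V) : ShiftedHomBijective F Y V := fun n =>
  homBijective_source hT (h₁ n) (h₃ n) (h₁.shift_left 1 n) (h₃.shift_left (-1) n)

end HomBijective

/-! ### Truncation and dévissage in derived categories -/

section Truncation

open DerivedCategory

variable {A : Type*} [Category* A] [Abelian A] [HasDerivedCategory.{w₁} A]

lemma isIso_homology_map_left {X Y Z : DerivedCategory A} {f : X ⟶ Y} {g : Y ⟶ Z}
    {h : Z ⟶ X⟦(1 : ℤ)⟧} (hT : Triangle.mk f g h ∈ distTriang (DerivedCategory A)) (i j : ℤ)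
    (hij : i + 1 = j) (h₀ : IsZero ((homologyFunctor A i).obj Z))
    (h₁ : IsZero ((homologyFunctor A j).obj Z)) : IsIso ((homologyFunctor A j).map f) := by
  have : Mono ((homologyFunctor A j).map f) :=
    (HomologySequence.mono_homologyMap_mor₁_iff _ hT i j hij).2 (h₀.eq_of_src _ _)
  have : Epi ((homologyFunctor A j).map f) :=
    (HomologySequence.epi_homologyMap_mor₁_iff _ hT j).2 (h₁.eq_of_tgt _ _)
  exact isIso_of_mono_of_epi _

lemma isIso_homology_map_right {X Y Z : DerivedCategory A} {f : X ⟶ Y} {g : Y ⟶ Z}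
    {h : Z ⟶ X⟦(1 : ℤ)⟧} (hT : Triangle.mk f g h ∈ distTriang (DerivedCategory A)) (i j : ℤ)
    (hij : i + 1 = j) (h₀ : IsZero ((homologyFunctor A i).obj X))
    (h₁ : IsZero ((homologyFunctor A j).obj X)) : IsIso ((homologyFunctor A i).map g) := by
  have : Mono ((homologyFunctor A i).map g) :=
    (HomologySequence.mono_homologyMap_mor₂_iff _ hT i).2 (h₀.eq_of_src _ _)
  have : Epi ((homologyFunctor A i).map g) :=
    (HomologySequence.epi_homologyMap_mor₂_iff _ hT i j hij).2 (h₁.eq_of_tgt _ _)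
  exact isIso_of_mono_of_epi _

lemma exists_trunc_triangle (X : DerivedCategory A) (n : ℤ) :
    ∃ h : (TStructure.t.truncGE n).obj X ⟶ ((TStructure.t.truncLT n).obj X)⟦(1 : ℤ)⟧,
      Triangle.mk ((TStructure.t.truncLTι n).app X) ((TStructure.t.truncGEπ n).app X) h ∈
        distTriang (DerivedCategory A) :=
  ⟨_, TStructure.t.triangleLTGE_distinguished n X⟩

lemma isIso_homology_truncLTι (X : DerivedCategory A) (n i : ℤ) (hi : i < n) :
    IsIso ((homologyFunctor A i).map ((TStructure.t.truncLTι n).app X)) := by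
  obtain ⟨h, hT⟩ := exists_trunc_triangle X n
  exact isIso_homology_map_left hT (i - 1) i (by lia) (isZero_of_isGE _ n _ (by lia))
    (isZero_of_isGE _ n _ (by lia))

lemma isIso_homology_truncGEπ (X : DerivedCategory A) (n i : ℤ) (hi : n ≤ i) :
    IsIso ((homologyFunctor A i).map ((TStructure.t.truncGEπ n).app X)) := by
  obtain ⟨h, hT⟩ := exists_trunc_triangle X n
  exact isIso_homology_map_right hT i (i + 1) rfl
    (isZero_of_isLE _ (n - 1) _ (by lia)) (isZero_of_isLE _ (n - 1) _ (by lia))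

variable (P : ObjectProperty A) [P.IsClosedUnderIsomorphisms] [P.ContainsZero]

lemma homology_truncGE_mem {X : DerivedCategory A} (n : ℤ)
    (hX : ∀ i, n ≤ i → P ((homologyFunctor A i).obj X)) (i : ℤ) :
    P ((homologyFunctor A i).obj ((TStructure.t.truncGE n).obj X)) := by
  by_cases hi : n ≤ i
  · have := isIso_homology_truncGEπ X n i hi
    exact P.prop_of_iso (asIso ((homologyFunctor A i).map ((TStructure.t.truncGEπ n).app X)))
      (hX i hi)
  · exact P.prop_of_isZero (isZero_of_isGE _ n _ (by lia))

lemma homology_truncLT_mem {X : DerivedCategory A} (n : ℤ)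
    (hX : ∀ i, i < n → P ((homologyFunctor A i).obj X)) (i : ℤ) :
    P ((homologyFunctor A i).obj ((TStructure.t.truncLT n).obj X)) := by
  by_cases hi : i < n
  · have := isIso_homology_truncLTι X n i hi
    exact P.prop_of_iso (asIso ((homologyFunctor A i).map ((TStructure.t.truncLTι n).app X))).symm
      (hX i hi)
  · exact P.prop_of_isZero (isZero_of_isLE _ (n - 1) _ (by lia))

lemma boundedCohomologyIn_iff (X : DerivedCategory A) :
    boundedCohomologyIn P X ↔ (∀ n, P ((homologyFunctor A n).obj X)) ∧
      ∃ a b : ℤ, X.IsGE a ∧ X.IsLE b := by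
  refine and_congr_right fun _ => exists_congr fun a => exists_congr fun b => ?_
  rw [isGE_iff, isLE_iff]
  exact ⟨fun h => ⟨fun i hi => h i (.inl hi), fun i hi => h i (.inr hi)⟩,
    fun h i hi => hi.elim (h.1 i) (h.2 i)⟩

lemma boundedCohomologyIn_truncGE {X : DerivedCategory A} (hX : boundedCohomologyIn P X) (n : ℤ) :
    boundedCohomologyIn P ((TStructure.t.truncGE n).obj X) := by
  rw [boundedCohomologyIn_iff] at hX ⊢
  obtain ⟨h, a, b, ha, hb⟩ := hX
  exact ⟨homology_truncGE_mem P n fun i _ => h i, n, b, inferInstance, inferInstance⟩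

lemma boundedCohomologyIn_single {N : A} (hN : P N) (n : ℤ) :
    boundedCohomologyIn P ((singleFunctor A n).obj N) := by
  rw [boundedCohomologyIn_iff]
  refine ⟨fun i => ?_, n, n, inferInstance, inferInstance⟩
  by_cases hi : i = n
  · subst hi
    exact P.prop_of_iso ((singleFunctorCompHomologyFunctorIso A i).symm.app N) hN
  · obtain h | h := lt_or_gt_of_ne hi
    · exact P.prop_of_isZero (isZero_of_isGE _ n _ h)
    · exact P.prop_of_isZero (isZero_of_isLE _ n _ h)

/-- An object concentrated in degree `n` is its cohomology in that degree. -/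
lemma exists_iso_single_of_mem (X : DerivedCategory A) (n : ℤ) [X.IsGE n] [X.IsLE n]
    (hX : P ((homologyFunctor A n).obj X)) :
    ∃ N : A, P N ∧ Nonempty (X ≅ (singleFunctor A n).obj N) := by
  obtain ⟨N, ⟨e⟩⟩ := exists_iso_singleFunctor_obj_of_isGE_of_isLE X n
  exact ⟨N, P.prop_of_iso ((homologyFunctor A n).mapIso e ≪≫
    (singleFunctorCompHomologyFunctorIso A n).app N) hX, ⟨e⟩⟩

/-- `N[-n]` is the shift of `N[0]`. -/
def singleIsoShift (N : A) (n : ℤ) :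
    (singleFunctor A n).obj N ≅ ((singleFunctor A 0).obj N)⟦-n⟧ :=
  (((singleFunctors A).shiftIso (-n) n 0 (by simp)).app N).symm

/-- Dévissage: a triangulated subcategory which contains the objects of `P` contains all bounded
complexes with cohomology in `P`. -/
lemma boundedCohomologyIn_le (T : ObjectProperty (DerivedCategory A)) [T.IsTriangulated]
    [T.IsClosedUnderIsomorphisms] (hT : ∀ N, P N → T ((singleFunctor A 0).obj N)) :
    boundedCohomologyIn P ≤ T := by
  -- Here `n` counts the degrees `a, …, a + n - 1` in which cohomology may live. The inductive step
  -- splits off the lowest one, which is a shifted object of `P`.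
  have key (n : ℕ) : ∀ (a : ℤ) (X : DerivedCategory A), (∀ i, P ((homologyFunctor A i).obj X)) →
      X.IsGE a → X.IsLE (a + n - 1) → T X := by
    induction n with
    | zero =>
      intro a X _ h₁ h₂
      exact T.prop_of_isZero (TStructure.t.isZero X (a + (0 : ℕ) - 1) a (by lia))
    | succ n ih =>
      intro a X hX h₁ h₂
      obtain ⟨h, hT'⟩ := exists_trunc_triangle X (a + 1)
      have : ((TStructure.t.truncLT (a + 1)).obj X).IsGE a := by
        rw [isGE_iff]
        intro i hi
        have := isIso_homology_truncLTι X (a + 1) i (by lia)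
        exact (isZero_of_isGE X a i hi).of_iso
          (asIso ((homologyFunctor A i).map ((TStructure.t.truncLTι (a + 1)).app X)))
      obtain ⟨N, hN, ⟨e⟩⟩ := exists_iso_single_of_mem P ((TStructure.t.truncLT (a + 1)).obj X) a
        (homology_truncLT_mem P (a + 1) (fun i _ => hX i) a)
      have h₁ : T ((TStructure.t.truncLT (a + 1)).obj X) :=
        T.prop_of_iso (e ≪≫ singleIsoShift N a).symm (T.le_shift (-a) _ (hT N hN))
      have h₃ : T ((TStructure.t.truncGE (a + 1)).obj X) := by
        have : X.IsLE (a + 1 + n - 1) := TStructure.t.isLE_of_le X (a + (n + 1 : ℕ) - 1) _ (by lia)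
        exact ih (a + 1) _ (homology_truncGE_mem P (a + 1) fun i _ => hX i) inferInstance
          inferInstance
      exact T.ext_of_isTriangulatedClosed₂ _ hT' h₁ h₃
  intro X hX
  obtain ⟨h, a, b, ha, hb⟩ := (boundedCohomologyIn_iff P X).1 hX
  have : X.IsLE (a + (b - a + 1).toNat - 1) := TStructure.t.isLE_of_le X b _ (by lia)
  exact key _ a X h ha this

/-- The target has a model vanishing above degree `n`, and a projective placed in degree `i > n` has
no nonzero maps into such a model. -/
lemma hom_single_eq_zero_of_projective {N : A} [Projective N] (i n : ℤ) (hn : n < i)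
    (X : DerivedCategory A) [X.IsLE n] (φ : (singleFunctor A i).obj N ⟶ X) : φ = 0 := by
  obtain ⟨K, hK, ⟨e⟩⟩ := exists_iso_Q_obj_of_isLE X n
  rw [← cancel_mono e.hom, zero_comp]
  exact from_singleFunctor_obj_eq_zero_of_projective _ n hn

end Truncation

lemma dist_of_iso {C : Type*} [Category* C] [HasZeroObject C] [HasShift C ℤ] [Preadditive C]
    [∀ n : ℤ, (shiftFunctor C n).Additive] [Pretriangulated C] {X X' Y Z : C} {f : X ⟶ Y}
    {g : Y ⟶ Z} {h : Z ⟶ X⟦(1 : ℤ)⟧} (hT : Triangle.mk f g h ∈ distTriang C) (e : X' ≅ X) :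
    Triangle.mk (e.hom ≫ f) g (h ≫ e.inv⟦(1 : ℤ)⟧') ∈ distTriang C := by
  refine isomorphic_distinguished _ hT _ (Triangle.isoMk _ _ e (Iso.refl _) (Iso.refl _) ?_ ?_ ?_)
  · exact Category.comp_id _
  · exact (Category.comp_id g).trans (Category.id_comp g).symm
  · change (h ≫ e.inv⟦(1 : ℤ)⟧') ≫ e.hom⟦(1 : ℤ)⟧' = 𝟙 _ ≫ h
    rw [Category.assoc, ← Functor.map_comp, e.inv_hom_id, CategoryTheory.Functor.map_id,
      Category.comp_id, Category.id_comp]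

/-! ### Approximation by images of relatively projective complexes -/

section Approximation

open DerivedCategory

variable {A : Type*} [Category* A] [Abelian A] [HasDerivedCategory.{w₁} A]
  {B : Type*} [Category* B] [Abelian B] [HasDerivedCategory.{w₂} B]
  (F : A ⥤ B) [F.Additive] [PreservesFiniteLimits F] [PreservesFiniteColimits F]

lemma isLE_mapDerivedCategory (X : DerivedCategory A) (n : ℤ) [X.IsLE n] :
    (F.mapDerivedCategory.obj X).IsLE n := by
  rw [isLE_iff]
  exact fun i hi => (F.map_isZero (isZero_of_isLE X n i hi)).of_iso (mapDerivedHomologyIso F i X)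

lemma isGE_mapDerivedCategory (X : DerivedCategory A) (n : ℤ) [X.IsGE n] :
    (F.mapDerivedCategory.obj X).IsGE n := by
  rw [isGE_iff]
  exact fun i hi => (F.map_isZero (isZero_of_isGE X n i hi)).of_iso (mapDerivedHomologyIso F i X)

/-- A morphism of derived categories is zero if it is invisible to cohomology for reasons of
degree. -/
lemma hom_eq_zero {X Y : DerivedCategory A} (m n : ℤ) (h : m < n) [X.IsLE m] [Y.IsGE n]
    (f : X ⟶ Y) : f = 0 := TStructure.t.zero_of_isLE_of_isGE f m n h inferInstance inferInstance

/-- The objects of `P` which are projective, with projective image under `F`, and from which `F`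
is bijective on morphisms to objects of `P`. -/
structure IsRelativelyProjective (P : ObjectProperty A) (N : A) : Prop where
  mem : P N
  projective : Projective N
  projective_obj : Projective (F.obj N)
  homBijective : ∀ Y, P Y → HomBijective F N Y

variable {F} in
-- In degree zero this is the bijection on `Hom(N, Y)`. In all other degrees both sides vanish:
-- positive Ext groups because `N` and `F N` are projective, negative ones by the t-structure.
lemma IsRelativelyProjective.shiftedHomBijective {P : ObjectProperty A}
    {N : A} (hN : IsRelativelyProjective F P N) (Y : A) (hY : P Y) :
    ShiftedHomBijective F.mapDerivedCategory ((singleFunctor A 0).obj N)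
      ((singleFunctor A 0).obj Y) := by
  intro n
  have := hN.projective
  have := hN.projective_obj
  let e₁ := (F.mapDerivedCategorySingleFunctor 0).app N
  let e := (singleFunctors A).shiftIso n (-n) 0 (by simp)
  refine HomBijective.of_iso (L := (singleFunctor A 0).obj N) (Y := (singleFunctor A (-n)).obj Y)
    ?_ (Iso.refl _) (e.symm.app Y)
  have h₀ (n : ℤ) (hn : n ≠ 0) (φ : (singleFunctor A 0).obj N ⟶ (singleFunctor A n).obj Y) :
      φ = 0 := by
    obtain hn | hn := lt_or_gt_of_ne hn
    · exact hom_single_eq_zero_of_projective 0 n hn _ _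
    · exact hom_eq_zero 0 n hn _
  have h₁ (n : ℤ) (hn : n ≠ 0) (φ : F.mapDerivedCategory.obj ((singleFunctor A 0).obj N) ⟶
      F.mapDerivedCategory.obj ((singleFunctor A n).obj Y)) : φ = 0 := by
    rw [← cancel_epi e₁.inv, comp_zero]
    have := isLE_mapDerivedCategory F ((singleFunctor A n).obj Y) n
    have := isGE_mapDerivedCategory F ((singleFunctor A n).obj Y) n
    obtain hn | hn := lt_or_gt_of_ne hn
    · exact hom_single_eq_zero_of_projective (N := F.obj N) 0 n hn _ _
    · exact hom_eq_zero (X := (singleFunctor B 0).obj (F.obj N)) 0 n hn _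
  by_cases hn : -n = 0
  · rw [hn]
    let e₂ := (F.mapDerivedCategorySingleFunctor 0).app Y
    have nat (f : N ⟶ Y) : F.mapDerivedCategory.map ((singleFunctor A 0).map f) =
        e₁.hom ≫ (singleFunctor B 0).map (F.map f) ≫ e₂.inv := by
      have := (F.mapDerivedCategorySingleFunctor 0).hom.naturality f
      dsimp at this
      rw [← Category.assoc, Iso.eq_comp_inv]
      exact this
    refine ⟨fun a b hab => ?_, fun φ => ?_⟩
    · obtain ⟨a, rfl⟩ := (singleFunctor A 0).map_surjective a
      obtain ⟨b, rfl⟩ := (singleFunctor A 0).map_surjective b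
      congr 1
      refine (hN.homBijective Y hY).1 ((singleFunctor B 0).map_injective ?_)
      rwa [nat, nat, cancel_epi, cancel_mono] at hab
    · obtain ⟨ψ, hψ⟩ := (singleFunctor B 0).map_surjective (e₁.inv ≫ φ ≫ e₂.hom)
      obtain ⟨a, rfl⟩ := (hN.homBijective Y hY).2 ψ
      refine ⟨(singleFunctor A 0).map a, ?_⟩
      rw [nat, hψ]
      simp
  · exact ⟨fun _ _ _ => (h₀ _ hn _).trans (h₀ _ hn _).symm, fun φ => ⟨0, by
      rw [h₁ _ hn φ, Functor.map_zero]⟩⟩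

variable (P : ObjectProperty A) (P' : ObjectProperty B)

/-- The complexes of `D^b_P(A)` from which `F` is bijective on morphisms of all degrees to objects
of `D^b_P(A)`. -/
def IsCofibrantFor (L : DerivedCategory A) : Prop :=
  boundedCohomologyIn P L ∧
    ∀ Y, boundedCohomologyIn P Y → ShiftedHomBijective F.mapDerivedCategory L Y

variable {P P'} [P.IsSerreClass] [P'.IsSerreClass]

variable {F} in
-- The targets on which bijectivity holds form a triangulated subcategory, so dévissage leaves only
-- objects of `P` in degree zero.
lemma IsRelativelyProjective.isCofibrantFor {N : A} (hN : IsRelativelyProjective F P N) (n : ℤ) :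
    IsCofibrantFor F P ((singleFunctor A n).obj N) := by
  refine ⟨boundedCohomologyIn_single P hN.mem n, fun Y hY => ?_⟩
  have h := boundedCohomologyIn_le P
    (shiftedHomBijectiveFrom F.mapDerivedCategory ((singleFunctor A 0).obj N))
    hN.shiftedHomBijective Y hY
  exact (ShiftedHomBijective.shift_left h (-n)).of_iso (singleIsoShift N n).symm (Iso.refl Y)

/-- The images of the cofibrant complexes. -/
def cofibrantImage (F : A ⥤ B) [F.Additive] [PreservesFiniteLimits F] [PreservesFiniteColimits F]
    (P : ObjectProperty A) : ObjectProperty (DerivedCategory B) := fun X =>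
  ∃ L : DerivedCategory A, IsCofibrantFor F P L ∧ Nonempty (F.mapDerivedCategory.obj L ≅ X)

instance : (cofibrantImage F P).IsClosedUnderIsomorphisms where
  of_iso := by
    rintro X Y e ⟨L, hL, ⟨e'⟩⟩
    exact ⟨L, hL, ⟨e' ≪≫ e⟩⟩

instance : (cofibrantImage F P).ContainsZero where
  exists_zero := ⟨0, isZero_zero _, 0, ⟨(boundedCohomologyIn P).prop_zero, fun _ _ _ =>
    ⟨fun _ _ _ => (isZero_zero _).eq_of_src _ _, fun _ => ⟨0,
      (F.mapDerivedCategory.map_isZero (isZero_zero _)).eq_of_src _ _⟩⟩⟩,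
    ⟨F.mapDerivedCategory.mapZeroObject⟩⟩

/-- Because `L₃` is cofibrant, the connecting morphism `F L₃ ⟶ (F L₁)⟦1⟧` lifts to `L₃ ⟶ L₁⟦1⟧`. The
triangle completing the lift is carried to the given one. This is what allows pieces of a resolution
to be glued upstairs. -/
instance : (cofibrantImage F P).IsTriangulatedClosed₂ := .mk' (by
  rintro T hT ⟨L₁, hL₁, ⟨e₁⟩⟩ ⟨L₃, hL₃, ⟨e₃⟩⟩
  let G := F.mapDerivedCategory
  obtain ⟨h, hh⟩ := (hL₃.2 _ hL₁.1 1).2 (e₃.hom ≫ T.mor₃ ≫ e₁.inv⟦1⟧' ≫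
    (G.commShiftIso (1 : ℤ)).inv.app L₁)
  obtain ⟨L₂, f, g, H⟩ := distinguished_cocone_triangle₂ h
  refine ⟨L₂, ⟨(boundedCohomologyIn P).ext_of_isTriangulatedClosed₂ _ H hL₁.1 hL₃.1,
    fun Y hY => shiftedHomBijective_source H (hL₁.2 Y hY) (hL₃.2 Y hY)⟩, ⟨Triangle.π₂.mapIso
      (isoTriangleOfIso₁₃ _ _ (G.map_distinguished _ H) hT e₁ e₃ ?_)⟩⟩
  change (G.map h ≫ (G.commShiftIso (1 : ℤ)).hom.app L₁) ≫ e₁.hom⟦1⟧' = e₃.hom ≫ T.mor₃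
  rw [hh, Category.assoc, Category.assoc, Category.assoc, Category.assoc,
    Iso.inv_hom_id_app_assoc, ← Functor.map_comp, e₁.inv_hom_id, CategoryTheory.Functor.map_id,
    Category.comp_id])

/-- The objects of `D^b_{P'}(B)` with cohomology in degrees `≤ n`. -/
def boundedCohomologyInLE (P' : ObjectProperty B) (n : ℤ) : ObjectProperty (DerivedCategory B) :=
  fun X => boundedCohomologyIn P' X ∧ X.IsLE n

variable {F} in
-- One step of a projective resolution. The top cohomology is covered by some `F N'`, and the
-- covering lifts to `X` itself: the obstruction lies in maps from the projective `F N'` in degree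
-- `n` to an object in degrees `≤ n - 2`. The cone of the lift has no cohomology in degree `n` any
-- more.
lemma boundedCohomologyInLE_le_extensionProduct
    (hF : ∀ X, P X → P' (F.obj X))
    (hP : ∀ N, P' N → ∃ (N' : A) (π : F.obj N' ⟶ N), IsRelativelyProjective F P N' ∧ Epi π)
    (n : ℤ) : boundedCohomologyInLE P' n ≤
      ObjectProperty.extensionProduct (cofibrantImage F P) (boundedCohomologyInLE P' (n - 1)) := by
  rintro X ⟨hX, hX'⟩
  obtain ⟨h, hT⟩ := exists_trunc_triangle X n
  obtain ⟨N, hN, ⟨e⟩⟩ := exists_iso_single_of_mem P' ((TStructure.t.truncGE n).obj X) n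
    (homology_truncGE_mem P' n (fun i _ => hX.1 i) n)
  obtain ⟨N', π, hN', hπ⟩ := hP N hN
  have := hN'.projective_obj
  have : (((TStructure.t.truncLT n).obj X)⟦(1 : ℤ)⟧).IsLE (n - 2) :=
    TStructure.t.isLE_shift _ (n - 1) 1 (n - 2) (by lia)
  obtain ⟨v, hv⟩ := exists_comp_eq_of_dist' hT ((singleFunctor B n).map π ≫ e.inv)
    (hom_single_eq_zero_of_projective n (n - 2) (by lia) _ _)
  have hepi : Epi ((homologyFunctor B n).map v) := by
    have h₁ := isIso_homology_truncGEπ X n n le_rfl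
    have h₂ : Epi ((homologyFunctor B n).map ((singleFunctor B n).map π)) :=
      ((MorphismProperty.epimorphisms B).arrow_mk_iso_iff
        (((Functor.mapArrowFunctor _ _).mapIso
          (singleFunctorCompHomologyFunctorIso B n)).app (Arrow.mk π))).2 hπ
    have h₃ : Epi ((homologyFunctor B n).map v ≫
        (homologyFunctor B n).map ((TStructure.t.truncGEπ n).app X)) := by
      rw [← Functor.map_comp, ← hv, Functor.map_comp]
      infer_instance
    have h₄ := epi_comp ((homologyFunctor B n).map v ≫
      (homologyFunctor B n).map ((TStructure.t.truncGEπ n).app X))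
      (inv ((homologyFunctor B n).map ((TStructure.t.truncGEπ n).app X)))
    simpa using h₄
  obtain ⟨Z, g, k, hT'⟩ := distinguished_cocone_triangle v
  have hFN := boundedCohomologyIn_single P' (hF _ hN'.mem) n
  refine ⟨_, _, _, _, _, hT', ⟨_, hN'.isCofibrantFor n,
    ⟨(F.mapDerivedCategorySingleFunctor n).app N'⟩⟩,
    (boundedCohomologyIn P').ext_of_isTriangulatedClosed₃ _ hT' hFN hX, ?_⟩
  rw [isLE_iff]
  intro i hi
  have h₃ : IsZero ((homologyFunctor B (i + 1)).obj ((singleFunctor B n).obj (F.obj N'))) :=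
    isZero_of_isLE _ n _ (by lia)
  have hg : (homologyFunctor B i).map g = 0 := by
    have : Epi ((homologyFunctor B i).map v) := by
      by_cases hin : i = n
      · subst hin; exact hepi
      · exact ⟨fun _ _ _ => (isZero_of_isLE X n i (by lia)).eq_of_src _ _⟩
    rw [← cancel_epi ((homologyFunctor B i).map v), ← Functor.map_comp,
      comp_eq_zero_of_dist hT', Functor.map_zero, comp_zero]
  exact (HomologySequence.exact₃ _ hT' i (i + 1) rfl).isZero_of_both_zeros hg (h₃.eq_of_tgt _ _)

variable {F} in
/-- Every object of `D^b_{P'}(B)` is, up to an object of arbitrarily negative degrees, the image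
of a cofibrant complex. -/
lemma exists_approximation
    (hF : ∀ X, P X → P' (F.obj X))
    (hP : ∀ N, P' N → ∃ (N' : A) (π : F.obj N' ⟶ N), IsRelativelyProjective F P N' ∧ Epi π)
    (X : DerivedCategory B) (hX : boundedCohomologyIn P' X) (n : ℤ) :
    ∃ (L : DerivedCategory A) (Z : DerivedCategory B) (f : F.mapDerivedCategory.obj L ⟶ X)
      (g : X ⟶ Z) (h : Z ⟶ (F.mapDerivedCategory.obj L)⟦(1 : ℤ)⟧),
      IsCofibrantFor F P L ∧ Z.IsLE n ∧ Triangle.mk f g h ∈ distTriang (DerivedCategory B) := by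
  obtain ⟨-, a, b, -, hb⟩ := (boundedCohomologyIn_iff P' X).1 hX
  have key (m : ℕ) : boundedCohomologyInLE P' b ≤
      ObjectProperty.extensionProduct (cofibrantImage F P) (boundedCohomologyInLE P' (b - m)) := by
    induction m with
    | zero =>
      rw [Nat.cast_zero, sub_zero]
      exact ObjectProperty.le_extensionProduct_right (cofibrantImage F P)
    | succ m ih =>
      refine ih.trans ((ObjectProperty.monotone_extensionProduct_right _
        (boundedCohomologyInLE_le_extensionProduct hF hP (b - m))).trans ?_)
      -- Associativity puts the new cofibrant piece next to the earlier ones; they merge into one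
      -- because cofibrant images are closed under extensions.
      rw [← ObjectProperty.extensionProduct_assoc,
        show b - m - 1 = b - (m + 1 : ℕ) by push_cast; ring]
      exact ObjectProperty.monotone_extensionProduct_left _
        (ObjectProperty.extensionProduct_le_of_isTriangulatedClosed₂ le_rfl le_rfl)
  obtain ⟨K, Z, f, g, h, hT, ⟨L, hL, ⟨e⟩⟩, hZ⟩ := key (b - n).toNat X ⟨hX, hb⟩
  have := hZ.2
  exact ⟨L, Z, e.hom ≫ f, g, h ≫ e.inv⟦1⟧', hL,
    TStructure.t.isLE_of_le Z (b - (b - n).toNat) n (by lia), dist_of_iso hT e⟩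

end Approximation

/-! ### The equivalence for an exact functor of abelian categories -/

section Quotient

open DerivedCategory

variable {A : Type*} [Category* A] [Abelian A] [HasDerivedCategory.{w₁} A]
  {B : Type*} [Category* B] [Abelian B] [HasDerivedCategory.{w₂} B]
  {F : A ⥤ B} [F.Additive] [PreservesFiniteLimits F] [PreservesFiniteColimits F]
  {P : ObjectProperty A} {P' : ObjectProperty B} [P.IsSerreClass] [P'.IsSerreClass]

/-- If `FL ⟶ Y` is an isomorphism in cohomology in degrees `≥ n` and `Y` has no cohomology in
degrees `< n`, then any factorization `F(τ≥n L) ⟶ Y` is an isomorphism. -/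
lemma isIso_of_truncGEπ_comp {L : DerivedCategory A} {Y Z : DerivedCategory B} {n : ℤ} [Y.IsGE n]
    {f : F.mapDerivedCategory.obj L ⟶ Y} {g : Y ⟶ Z}
    {h : Z ⟶ (F.mapDerivedCategory.obj L)⟦(1 : ℤ)⟧} [Z.IsLE (n - 2)]
    (hT : Triangle.mk f g h ∈ distTriang (DerivedCategory B))
    (s : F.mapDerivedCategory.obj ((TStructure.t.truncGE n).obj L) ⟶ Y)
    (hs : F.mapDerivedCategory.map ((TStructure.t.truncGEπ n).app L) ≫ s = f) : IsIso s := by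
  rw [isIso_iff]
  intro i
  have hL := isGE_mapDerivedCategory F ((TStructure.t.truncGE n).obj L) n
  by_cases hi : n ≤ i
  · obtain ⟨k, hL'⟩ := exists_trunc_triangle L n
    have := isLE_mapDerivedCategory F ((TStructure.t.truncLT n).obj L) (n - 1)
    have h₁ := isIso_homology_map_right (map_dist F.mapDerivedCategory hL') i (i + 1) rfl
      (isZero_of_isLE _ (n - 1) _ (by lia)) (isZero_of_isLE _ (n - 1) _ (by lia))
    -- Both `H^(i-1)` and `H^i` of the cone have to vanish for `i ≥ n`, which is why the cone is
    -- asked to live in degrees `≤ n - 2`.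
    have h₂ := isIso_homology_map_left hT (i - 1) i (by lia)
      (isZero_of_isLE _ (n - 2) _ (by lia)) (isZero_of_isLE _ (n - 2) _ (by lia))
    rw [← hs, Functor.map_comp] at h₂
    exact IsIso.of_isIso_comp_left ((homologyFunctor B i).map
      (F.mapDerivedCategory.map ((TStructure.t.truncGEπ n).app L))) _
  · exact (isZero_of_isGE _ n _ (by lia)).isIso (isZero_of_isGE _ n _ (by lia)) _

/-- The approximation `F L ⟶ X` is an isomorphism on cohomology in degrees `≥ n`, where `n` bounds
`X` from below. It factors through `F` of the truncation of `L` at `n`, and the factorization is an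
isomorphism. -/
lemma exists_mapDerivedCategory_iso (hF : ∀ X, P X → P' (F.obj X))
    (hP : ∀ N, P' N → ∃ (N' : A) (π : F.obj N' ⟶ N), IsRelativelyProjective F P N' ∧ Epi π)
    (X : DerivedCategory B) (hX : boundedCohomologyIn P' X) :
    ∃ Y : DerivedCategory A, boundedCohomologyIn P Y ∧
      Nonempty (F.mapDerivedCategory.obj Y ≅ X) := by
  obtain ⟨-, n, b, hn, -⟩ := (boundedCohomologyIn_iff P' X).1 hX
  obtain ⟨L, Z, f, g, h, hL, hZ, hT⟩ := exists_approximation hF hP X hX (n - 2)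
  obtain ⟨k, hL'⟩ := exists_trunc_triangle L n
  have := isLE_mapDerivedCategory F ((TStructure.t.truncLT n).obj L) (n - 1)
  obtain ⟨s, hs⟩ := exists_eq_comp_of_dist (map_dist F.mapDerivedCategory hL') f
    (hom_eq_zero (n - 1) n (by lia) _)
  have := isIso_of_truncGEπ_comp hT s hs.symm
  exact ⟨_, boundedCohomologyIn_truncGE P hL.1 n, ⟨asIso s⟩⟩

/-- Approximate `F X` by `u₀ : F L ⟶ F X`. As `L` is cofibrant, `u₀` and `u₀ ≫ φ` are images of maps
from `L` to `X` and to `Y`. Both factor through the truncation of `L` at a common lower bound of `X`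
and `Y`, which yields numerator and denominator. -/
lemma exists_fraction (hF : ∀ X, P X → P' (F.obj X))
    (hP : ∀ N, P' N → ∃ (N' : A) (π : F.obj N' ⟶ N), IsRelativelyProjective F P N' ∧ Epi π)
    (X Y : DerivedCategory A) (hX : boundedCohomologyIn P X)
    (hY : boundedCohomologyIn P Y) (φ : F.mapDerivedCategory.obj X ⟶ F.mapDerivedCategory.obj Y) :
    ∃ (X' : DerivedCategory A) (_ : boundedCohomologyIn P X') (s : X' ⟶ X) (f : X' ⟶ Y),
      IsIso (F.mapDerivedCategory.map s) ∧
      F.mapDerivedCategory.map f = F.mapDerivedCategory.map s ≫ φ := by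
  let G := F.mapDerivedCategory
  obtain ⟨-, a, -, ha, -⟩ := (boundedCohomologyIn_iff P X).1 hX
  obtain ⟨-, a', -, ha', -⟩ := (boundedCohomologyIn_iff P Y).1 hY
  let n := min a a'
  have : X.IsGE n := TStructure.t.isGE_of_ge X n a (min_le_left _ _)
  have : Y.IsGE n := TStructure.t.isGE_of_ge Y n a' (min_le_right _ _)
  have := isGE_mapDerivedCategory F X n
  have := isGE_mapDerivedCategory F Y n
  obtain ⟨L, Z, u₀, g, h, hL, hZ, hT⟩ := exists_approximation hF hP (G.obj X)
    (boundedCohomologyIn_map P P' F hF ⟨X, hX⟩) (n - 2)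
  obtain ⟨u, hu⟩ := (hL.2 X hX).homBijective.2 u₀
  obtain ⟨v, hv⟩ := (hL.2 Y hY).homBijective.2 (u₀ ≫ φ)
  let s := TStructure.t.descTruncGE u n
  let f := TStructure.t.descTruncGE v n
  have hs : G.map ((TStructure.t.truncGEπ n).app L) ≫ G.map s = u₀ := by
    rw [← G.map_comp, TStructure.t.π_descTruncGE, hu]
  have hf : G.map ((TStructure.t.truncGEπ n).app L) ≫ G.map f = u₀ ≫ φ := by
    rw [← G.map_comp, TStructure.t.π_descTruncGE, hv]
  refine ⟨_, boundedCohomologyIn_truncGE P hL.1 n, s, f, isIso_of_truncGEπ_comp hT _ hs, ?_⟩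
  obtain ⟨k, hL'⟩ := exists_trunc_triangle L n
  -- The two sides agree on `F L`, so their difference factors through an object in degrees `≤ n -
  -- 2`, which has no nonzero maps to `F Y`.
  obtain ⟨c, hc⟩ := exists_eq_comp_of_dist' (map_dist G hL') (G.map f - G.map s ≫ φ) (by
    rw [Preadditive.comp_sub, hf, reassoc_of% hs, sub_self])
  have := isLE_mapDerivedCategory F ((TStructure.t.truncLT n).obj L) (n - 1)
  have : ((G.obj ((TStructure.t.truncLT n).obj L))⟦(1 : ℤ)⟧).IsLE (n - 2) :=
    TStructure.t.isLE_shift _ (n - 1) 1 (n - 2) (by lia)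
  rw [hom_eq_zero (n - 2) n (by lia) c, comp_zero] at hc
  exact sub_eq_zero.1 hc

/-- The kernel of the functor induced by `F` on bounded derived categories is generated by the
objects `S j` if the objects of `P` annihilated by `F` are iterated extensions of these. -/
lemma triangulatedSpan_iff_isZero (hF : ∀ X, P X → P' (F.obj X)) {J : Type*} {S : J → A}
    (hS : ∀ j, IsZero (F.obj (S j)))
    (hker : ∀ T : ObjectProperty A, T.IsClosedUnderIsomorphisms → T.ContainsZero →
      T.IsClosedUnderExtensions → (∀ j, T (S j)) → ∀ N, P N → IsZero (F.obj N) → T N)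
    (hSP : ∀ j, P (S j)) (X : BoundedDerived P) :
    triangulatedSpan (isSingleOf P S) X ↔ IsZero ((boundedDerivedMap P P' F hF).obj X) := by
  let Φ := boundedDerivedMap P P' F hF
  constructor
  · intro hX
    let T : ObjectProperty (BoundedDerived P) := fun X => IsZero (Φ.obj X)
    have hT₁ : T.IsClosedUnderIsomorphisms := ⟨fun e h => h.of_iso (Φ.mapIso e).symm⟩
    have hT₂ : T.IsTriangulated :=
      { exists_zero := ⟨0, isZero_zero _, Φ.map_isZero (isZero_zero _)⟩
        isStableUnderShiftBy := fun n => ⟨fun Y hY =>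
          ((shiftFunctor _ n).map_isZero hY).of_iso ((Φ.commShiftIso n).app Y)⟩
        toIsTriangulatedClosed₂ := .mk' fun Δ hΔ h₁ h₃ =>
          (Triangle.isZero₂_iff _ (Φ.map_distinguished Δ hΔ)).2
            ⟨h₁.eq_of_src _ _, h₃.eq_of_tgt _ _⟩ }
    refine hX T hT₂ hT₁ ?_
    rintro Y ⟨j, ⟨e⟩⟩
    have h₁ : IsZero (F.mapDerivedCategory.obj Y.obj) :=
      ((singleFunctor B 0).map_isZero (hS j)).of_iso (F.mapDerivedCategory.mapIso e ≪≫
        (F.mapDerivedCategorySingleFunctor 0).app (S j))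
    exact IsZero.of_full_of_faithful_of_isZero (boundedCohomologyIn P').ι _ h₁
  · intro hX T hT₁ hT₂ hT₃
    let ι := (boundedCohomologyIn P).ι
    have hmem (Y : DerivedCategory A) (hY : boundedCohomologyIn P Y) (h : T.map ι Y) :
        T ⟨Y, hY⟩ := by
      obtain ⟨Y', hY', ⟨e⟩⟩ := (T.prop_map_iff ι Y).1 h
      exact T.prop_of_iso (ι.preimageIso (X := Y') (Y := ⟨Y, hY⟩) e) hY'
    let P₀ : ObjectProperty A := fun N => P N ∧ IsZero (F.obj N)
    have : P₀.IsClosedUnderIsomorphisms :=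
      ⟨fun e h => ⟨P.prop_of_iso e h.1, h.2.of_iso (F.mapIso e).symm⟩⟩
    have : P₀.ContainsZero := ⟨0, isZero_zero _, P.prop_zero, F.map_isZero (isZero_zero _)⟩
    -- The objects whose degree `0` complexes lie in `T` are closed under extensions, since short
    -- exact sequences give distinguished triangles. So `hker` applies to them.
    have hsingle (N : A) (hN : P₀ N) : T.map ι ((singleFunctor A 0).obj N) := by
      refine hker (fun N => T.map ι ((singleFunctor A 0).obj N)) ?_ ?_ ?_ ?_ N hN.1 hN.2
      · exact ⟨fun e h => (T.map ι).prop_of_iso ((singleFunctor A 0).mapIso e) h⟩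
      · exact ⟨0, isZero_zero _, (T.map ι).prop_of_isZero
          ((singleFunctor A 0).map_isZero (isZero_zero _))⟩
      · exact ⟨fun {E} hE h₁ h₃ => (T.map ι).ext_of_isTriangulatedClosed₂ _
          hE.singleTriangle_distinguished h₁ h₃⟩
      · intro j
        exact T.prop_map_obj ι (hT₃ ⟨_, boundedCohomologyIn_single P (hSP j) 0⟩ ⟨j, ⟨Iso.refl _⟩⟩)
    refine hmem X.obj X.property (boundedCohomologyIn_le P₀ (T.map ι) hsingle X.obj ?_)
    -- By exactness `F` also kills every cohomology object of `X`, so all of them lie in `P₀` and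
    -- dévissage applies.
    have hGX : IsZero (F.mapDerivedCategory.obj X.obj) :=
      (boundedCohomologyIn P').ι.map_isZero hX
    exact ⟨fun n => ⟨X.property.1 n, ((homologyFunctor B n).map_isZero hGX).of_iso
      (mapDerivedHomologyIso F n X.obj).symm⟩, X.property.2⟩

/-- Let `F : A ⥤ B` be an exact functor with `F(P) ⊆ P'`. If the kernel of `F` on `P` consists of
the iterated extensions of the objects `S j`, and if every object of `P'` is a quotient of the
image of a relatively projective object, then `F` induces an equivalence
`D^b_P(A)/⟨S j⟩ ≌ D^b_{P'}(B)`. -/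
theorem verdierLift_boundedDerivedMap (hF : ∀ X, P X → P' (F.obj X)) {J : Type*} {S : J → A}
    (hSP : ∀ j, P (S j)) (hS : ∀ j, IsZero (F.obj (S j)))
    (hker : ∀ T : ObjectProperty A, T.IsClosedUnderIsomorphisms → T.ContainsZero →
      T.IsClosedUnderExtensions → (∀ j, T (S j)) → ∀ N, P N → IsZero (F.obj N) → T N)
    (hP : ∀ N, P' N → ∃ (N' : A) (π : F.obj N' ⟶ N), IsRelativelyProjective F P N' ∧ Epi π) :
    ∃ h : (triangulatedSpan (isSingleOf P S)).trW.IsInvertedBy (boundedDerivedMap P P' F hF),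
      (verdierLift (isSingleOf P S) (boundedDerivedMap P P' F hF) h).IsTriangulated ∧
      (verdierLift (isSingleOf P S) (boundedDerivedMap P P' F hF) h).IsEquivalence := by
  have hzero := triangulatedSpan_iff_isZero hF hS hker hSP
  refine ⟨isInvertedBy_of_isZero hzero, inferInstance,
    isEquivalence_verdierLift hzero _ (fun X Y φ => ?_) fun Z => ?_⟩
  · obtain ⟨X', hX', s, f, hs, hf⟩ := exists_fraction hF hP X.obj Y.obj X.property Y.property
      ((boundedCohomologyIn P').ι.map φ)
    refine ⟨⟨X', hX'⟩, (boundedCohomologyIn P).fullyFaithfulι.preimage s,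
      (boundedCohomologyIn P).fullyFaithfulι.preimage f, ?_, ?_⟩
    · have : IsIso ((boundedCohomologyIn P').ι.map ((boundedDerivedMap P P' F hF).map
          (X := ⟨X', hX'⟩) (Y := X) ((boundedCohomologyIn P).fullyFaithfulι.preimage s))) := hs
      exact isIso_of_reflects_iso _ (boundedCohomologyIn P').ι
    · exact (boundedCohomologyIn P').ι.map_injective hf
  · obtain ⟨Y, hY, ⟨e⟩⟩ := exists_mapDerivedCategory_iso hF hP Z.obj Z.property
    exact ⟨⟨Y, hY⟩, ⟨(boundedCohomologyIn P').fullyFaithfulι.preimageIso e⟩⟩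

end Quotient

/-! ### Local vanishing of Ext over a Gorenstein ring -/

section LocalVanishing

open Abelian RingTheory.Sequence

variable {R : Type u} [CommRing R]

/-- The localization of `E` at (the complement of) `p` vanishes. -/
def IsLocallyZero (p : Ideal R) (E : Type*) [AddCommGroup E] [Module R E] : Prop :=
  ∀ e : E, ∃ s ∉ p, s • e = 0

lemma IsLocallyZero.of_subsingleton (p : Ideal R) [hp : p.IsPrime] (E : Type*) [AddCommGroup E]
    [Module R E] [Subsingleton E] : IsLocallyZero p E :=
  fun _ => ⟨1, hp.one_notMem, Subsingleton.elim _ _⟩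

lemma IsLocallyZero.mono {p q : Ideal R} {E : Type*} [AddCommGroup E] [Module R E]
    (h : IsLocallyZero q E) (hpq : p ≤ q) : IsLocallyZero p E := fun e =>
  let ⟨s, hs, he⟩ := h e
  ⟨s, fun h => hs (hpq h), he⟩

/-- Nakayama's lemma at a maximal ideal. -/
lemma isLocallyZero_of_smul_mem {m : Ideal R} [hm : m.IsMaximal] {E : Type*} [AddCommGroup E]
    [Module R E] [Module.Finite R E] (h : ∀ e : E, ∃ s ∉ m, s • e ∈ m • (⊤ : Submodule R E)) :
    IsLocallyZero m E := by
  have htop : (⊤ : Submodule R E) ≤ m • ⊤ := fun e _ => by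
    obtain ⟨s, hs, he⟩ := h e
    obtain ⟨t, ht⟩ := hm.exists_inv hs
    obtain ⟨i, hi, hti⟩ := ht
    have : e = t • (s • e) + i • e := by rw [← mul_smul, ← add_smul, hti, one_smul]
    rw [this]
    exact add_mem (Submodule.smul_mem _ t he) (Submodule.smul_mem_smul hi trivial)
  obtain ⟨r, hr, h⟩ := Submodule.exists_sub_one_mem_and_smul_eq_zero_of_fg_of_le_smul m ⊤
    Module.Finite.fg_top htop
  refine fun e => ⟨r, fun hrm => hm.ne_top ((Ideal.eq_top_iff_one m).2 ?_), h e trivial⟩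
  simpa using sub_mem hrm hr

section ShortExact

variable {p : Ideal R} [hp : p.IsPrime] {S : ShortComplex (ModuleCat.{u} R)} (hS : S.ShortExact)
  {L : ModuleCat.{u} R}

/-- Vanishing at `p` is witnessed by elements outside `p`, so a chase in the long exact sequence
costs one factor for each vanishing group, and no localization of Ext is needed. The next two lemmas
are the other two positions in the sequence. -/
lemma IsLocallyZero.ext_X₂ {i : ℕ} (h₁ : IsLocallyZero p (Ext S.X₁ L i))
    (h₃ : IsLocallyZero p (Ext S.X₃ L i)) (hS : S.ShortExact) :
    IsLocallyZero p (Ext S.X₂ L i) := fun e => by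
  obtain ⟨s, hs, he⟩ := h₁ ((Ext.mk₀ S.f).comp e (zero_add i))
  rw [← Ext.comp_smul] at he
  obtain ⟨e', he'⟩ := Ext.contravariant_sequence_exact₂ hS L _ he
  obtain ⟨t, ht, hte⟩ := h₃ e'
  refine ⟨t * s, hp.mul_notMem ht hs, ?_⟩
  rw [mul_smul, ← he', ← Ext.comp_smul, hte, Ext.comp_zero]

lemma IsLocallyZero.ext_X₁ {i j : ℕ} (h₂ : IsLocallyZero p (Ext S.X₂ L i))
    (h₃ : IsLocallyZero p (Ext S.X₃ L j)) (hS : S.ShortExact) (hij : 1 + i = j) :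
    IsLocallyZero p (Ext S.X₁ L i) := fun e => by
  obtain ⟨s, hs, he⟩ := h₃ (hS.extClass.comp e hij)
  rw [← Ext.comp_smul] at he
  obtain ⟨e', he'⟩ := Ext.contravariant_sequence_exact₁ hS L _ hij he
  obtain ⟨t, ht, hte⟩ := h₂ e'
  refine ⟨t * s, hp.mul_notMem ht hs, ?_⟩
  rw [mul_smul, ← he', ← Ext.comp_smul, hte, Ext.comp_zero]

lemma IsLocallyZero.ext_X₃ {i j : ℕ} (h₁ : IsLocallyZero p (Ext S.X₁ L i))
    (h₂ : IsLocallyZero p (Ext S.X₂ L j)) (hS : S.ShortExact) (hij : 1 + i = j) :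
    IsLocallyZero p (Ext S.X₃ L j) := fun e => by
  obtain ⟨s, hs, he⟩ := h₂ ((Ext.mk₀ S.g).comp e (zero_add j))
  rw [← Ext.comp_smul] at he
  obtain ⟨e', he'⟩ := Ext.contravariant_sequence_exact₃ hS L _ he hij
  obtain ⟨t, ht, hte⟩ := h₁ e'
  refine ⟨t * s, hp.mul_notMem ht hs, ?_⟩
  rw [mul_smul, ← he', ← Ext.comp_smul, hte, Ext.comp_zero]

end ShortExact

lemma IsLocallyZero.ext_of_iso {p : Ideal R} {T T' L : ModuleCat.{u} R} (e : T ≅ T') {i : ℕ}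
    (h : IsLocallyZero p (Ext T L i)) : IsLocallyZero p (Ext T' L i) := fun x => by
  obtain ⟨s, hs, hx⟩ := h ((Ext.mk₀ e.hom).comp x (zero_add i))
  refine ⟨s, hs, ?_⟩
  have := congrArg (fun y => (Ext.mk₀ e.inv).comp y (zero_add i)) hx
  rw [← Ext.comp_smul] at this
  simpa using this

lemma isLocallyZero_ext_of_mem_annihilator {p : Ideal R} {T L : ModuleCat.{u} R} {x : R}
    (hx : x ∉ p) (hxT : x ∈ Module.annihilator R T) (i : ℕ) : IsLocallyZero p (Ext T L i) :=
  fun e => ⟨x, hx, by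
    have h : x • 𝟙 T = 0 := by
      ext t
      exact Module.mem_annihilator.1 hxT t
    rw [← Ext.mk₀_id_comp e, ← Ext.smul_comp, ← Ext.mk₀_smul, h, Ext.mk₀_zero, Ext.zero_comp]⟩

variable [IsNoetherianRing R] {m : Ideal R} [hm : m.IsMaximal]

/-- If `Ext^j(Q, L)` vanishes at `m`, then `x ∈ m` acts on `Ext^i(M, L)` surjectively up to elements
outside `m`, and Nakayama's lemma applies. -/
lemma isLocallyZero_ext_of_smul {M Q L : ModuleCat.{u} R} [Module.Finite R M]
    [Module.Finite R L] {x : R} (hx : x ∈ m) {g : M ⟶ Q} (w : (x • 𝟙 M) ≫ g = 0)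
    (hS : (ShortComplex.mk (x • 𝟙 M) g w).ShortExact) {i j : ℕ} (hij : 1 + i = j)
    (h : IsLocallyZero m (Ext Q L j)) : IsLocallyZero m (Ext M L i) := by
  refine isLocallyZero_of_smul_mem fun e => ?_
  let δ : Ext Q M 1 := hS.extClass
  obtain ⟨s, hs, he⟩ := h (δ.comp e hij)
  rw [← Ext.comp_smul] at he
  obtain ⟨e', he'⟩ := Ext.contravariant_sequence_exact₁ hS L (s • e) hij he
  replace he' : (Ext.mk₀ (x • 𝟙 M)).comp e' (zero_add i) = s • e := he'
  refine ⟨s, hs, ?_⟩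
  rw [← he', Ext.mk₀_smul, Ext.smul_comp]
  exact Submodule.smul_mem_smul hx trivial

lemma isLocallyZero_ext_of_quotSMulTop {M L : ModuleCat.{u} R} [Module.Finite R M]
    [Module.Finite R L] {x : R} (hx : x ∈ m) (hxM : IsSMulRegular M x) {i j : ℕ} (hij : 1 + i = j)
    (h : IsLocallyZero m (Ext (ModuleCat.of R (QuotSMulTop x M)) L j)) :
    IsLocallyZero m (Ext M L i) :=
  isLocallyZero_ext_of_smul hx _ hxM.smulShortComplex_shortExact hij h

/-- The vanishing at `m` of `Ext^j(T, L)` for all finitely generated `T` follows from that of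
`Ext^j(R/m, L)`. -/
lemma isLocallyZero_ext_of_residueField {L : ModuleCat.{u} R} [Module.Finite R L] {i : ℕ}
    (h : ∀ j, i ≤ j → IsLocallyZero m (Ext (ModuleCat.of R (R ⧸ m)) L j))
    (T : Type u) [AddCommGroup T] [Module R T] [hT : Module.Finite R T] {j : ℕ} (hj : i ≤ j) :
    IsLocallyZero m (Ext (ModuleCat.of R T) L j) := by
  suffices H : ∀ (J : Ideal R) (T : Type u) [AddCommGroup T] [Module R T] [Module.Finite R T],
      J ≤ Module.annihilator R T → ∀ j, i ≤ j → IsLocallyZero m (Ext (ModuleCat.of R T) L j) from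
    H ⊥ T bot_le j hj
  -- Noetherian induction on an ideal `J` killing `T`. A prime filtration reduces to `T = R/p`. If
  -- `p < m`, any `x` in `m` outside `p` is regular on `R/p`, and the quotient is killed by the
  -- larger ideal `p + (x)`; the Ext degree rises by one, so the induction covers all degrees `≥ i`.
  -- A prime not contained in `m` contributes nothing at `m`.
  intro J
  induction J using WellFoundedGT.induction with
  | ind J IH =>
  intro T _ _ hT
  induction hT using IsNoetherianRing.induction_on_isQuotientEquivQuotientPrime R with
  | subsingleton T =>
    intro _ j _
    refine isLocallyZero_ext_of_mem_annihilator (x := 1) hm.isPrime.one_notMem ?_ j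
    exact Module.mem_annihilator.2 fun _ => Subsingleton.elim _ _
  | exact N₁ N₂ N₃ f g hf hg hfg h₁ h₃ =>
    intro hJ j hj
    let S : ShortComplex (ModuleCat.{u} R) := ShortComplex.mk (ModuleCat.ofHom f)
      (ModuleCat.ofHom g) (ModuleCat.hom_ext hfg.linearMap_comp_eq_zero)
    have hS : S.ShortExact := ModuleCat.shortComplex_shortExact S hfg hf hg
    exact IsLocallyZero.ext_X₂ (S := S)
      (h₁ (hJ.trans (LinearMap.annihilator_le_of_injective f hf)) j hj)
      (h₃ (hJ.trans (LinearMap.annihilator_le_of_surjective g hg)) j hj) hS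
  | quotient T p e =>
    intro hJ j hj
    rw [e.annihilator_eq, Ideal.annihilator_quotient] at hJ
    refine IsLocallyZero.ext_of_iso e.symm.toModuleIso ?_
    have hann : p.1 ≤ Module.annihilator R (R ⧸ p.1) := Ideal.annihilator_quotient.ge
    obtain hlt | rfl := hJ.lt_or_eq
    · exact IH p.1 hlt (R ⧸ p.1) hann j hj
    by_cases hpm : p.1 ≤ m
    · obtain hlt | heq := hpm.lt_or_eq
      · obtain ⟨x, hx, hxp⟩ := SetLike.exists_of_lt hlt
        have hreg : IsSMulRegular (R ⧸ p.1) x := by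
          rw [isSMulRegular_iff_right_eq_zero_of_smul]
          intro y hy
          obtain ⟨y, rfl⟩ := Ideal.Quotient.mk_surjective y
          have : x * y ∈ p.1 := Ideal.Quotient.eq_zero_iff_mem.1 hy
          exact Ideal.Quotient.eq_zero_iff_mem.2 ((p.2.mem_or_mem this).resolve_left hxp)
        refine isLocallyZero_ext_of_quotSMulTop (M := ModuleCat.of R (R ⧸ p.1)) hx hreg
          (add_comm 1 j) (IH (p.1 ⊔ Ideal.span {x}) ?_ _ ?_ (j + 1) (by lia))
        · refine lt_of_le_of_ne le_sup_left fun h => hxp ?_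
          rw [h]
          exact Ideal.mem_sup_right (Ideal.mem_span_singleton_self x)
        · refine sup_le (hann.trans (LinearMap.annihilator_le_of_surjective
            (Submodule.mkQ _) (Submodule.mkQ_surjective _))) ?_
          rw [Ideal.span_singleton_le_iff_mem]
          exact QuotSMulTop.mem_annihilator _ x
      · rw [heq]
        exact h j hj
    · obtain ⟨x, hx, hxm⟩ := SetLike.not_le_iff_exists.1 hpm
      exact isLocallyZero_ext_of_mem_annihilator hxm (hann hx) j

/-- Prime avoidance: the zero divisors on `M` are the union of its finitely many associated primes,
and a maximal ideal contained in one of them equals it. -/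
lemma exists_isSMulRegular_of_notMem_associatedPrimes (M : Type u) [AddCommGroup M] [Module R M]
    [Module.Finite R M] (h : m ∉ associatedPrimes R M) : ∃ x ∈ m, IsSMulRegular M x := by
  by_contra! hx
  have hsub : (m : Set R) ⊆ ⋃ p ∈ associatedPrimes R M, (p : Set R) := by
    rw [biUnion_associatedPrimes_eq_compl_regular R M]
    exact hx
  obtain ⟨p, hp, hmp⟩ := (m.subset_union_prime_finite (associatedPrimes.finite R M) (f := id) 0 0
    fun p hp _ _ => IsAssociatedPrime.isPrime hp).1 hsub
  exact h (hm.eq_of_le (IsAssociatedPrime.isPrime hp).ne_top hmp ▸ hp)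

/-- A descending form of the inequality `injdim L ≤ dim R`. -/
lemma isLocallyZero_ext_residueField_of_supportDim {L : ModuleCat.{u} R} {j : ℕ}
    (hL : ∀ (T : Type u) [AddCommGroup T] [Module R T] [Module.Finite R T],
      IsLocallyZero m (Ext (ModuleCat.of R T) L (j + 1))) (c : ℕ) (hcj : c < j)
    (M : Type u) [AddCommGroup M] [Module R M] [Module.Finite R M]
    (hM : ⟨m, hm.isPrime⟩ ∈ Module.support R M) (hc : Module.supportDim R M ≤ c)
    (h : ∀ i, j ≤ i + c → i ≤ j → IsLocallyZero m (Ext (ModuleCat.of R M) L i)) :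
    IsLocallyZero m (Ext (ModuleCat.of R (R ⧸ m)) L j) := by
  -- When `m` is associated, `R/m` embeds in `M`. Since `Ext^(j+1)` vanishes at `m`, the map from
  -- `Ext^j(M, L)` to `Ext^j(R/m, L)` is surjective there.
  have hass (M : Type u) [AddCommGroup M] [Module R M] [Module.Finite R M]
      (h : IsLocallyZero m (Ext (ModuleCat.of R M) L j)) (hM : m ∈ associatedPrimes R M) :
      IsLocallyZero m (Ext (ModuleCat.of R (R ⧸ m)) L j) := by
    obtain ⟨f, hf⟩ := ((isAssociatedPrime_iff_exists_injective_linearMap m M).1 hM).2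
    let S : ShortComplex (ModuleCat.{u} R) := ShortComplex.mk (ModuleCat.ofHom f)
      (ModuleCat.ofHom (LinearMap.range f).mkQ) (ModuleCat.hom_ext (LinearMap.range_mkQ_comp f))
    have hS : S.ShortExact := ModuleCat.shortComplex_shortExact S
      (LinearMap.exact_map_mkQ_range f) hf (Submodule.mkQ_surjective _)
    exact IsLocallyZero.ext_X₁ (S := S) h (hL _) hS (add_comm 1 j)
  induction c generalizing M with
  | zero =>
    by_cases hm' : m ∈ associatedPrimes R M
    · exact hass M (h j (by lia) le_rfl) hm'
    · obtain ⟨x, hx, hxM⟩ := exists_isSMulRegular_of_notMem_associatedPrimes M hm'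
      have hdim := (Module.supportDim_quotSMulTop_succ_le_of_notMem_minimalPrimes
        fun _ => hxM.notMem_of_mem_minimalPrimes).trans hc
      have hx' : ⟨m, hm.isPrime⟩ ∈ Module.support R (QuotSMulTop x M) := by
        simpa [Module.support_quotSMulTop, hM] using hx
      have : Nontrivial (QuotSMulTop x M) := by
        rw [← Module.nonempty_support_iff (R := R)]
        exact ⟨_, hx'⟩
      rw [Nat.cast_zero, ENat.WithBot.add_one_le_zero_iff,
        Module.supportDim_eq_bot_iff_subsingleton] at hdim
      exact (not_subsingleton _ hdim).elim
  | succ c ih =>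
    by_cases hm' : m ∈ associatedPrimes R M
    · exact hass M (h j (by lia) le_rfl) hm'
    -- Dividing by a regular `x ∈ m` lowers the dimension, and the degrees `j - c - 1, …, j` of
    -- vanishing for `M` shrink to `j - c, …, j` for `M/xM`.
    · obtain ⟨x, hx, hxM⟩ := exists_isSMulRegular_of_notMem_associatedPrimes M hm'
      have hdim := (Module.supportDim_quotSMulTop_succ_le_of_notMem_minimalPrimes
        fun _ => hxM.notMem_of_mem_minimalPrimes).trans hc
      rw [Nat.cast_add, Nat.cast_one, ← Nat.cast_one,
        ENat.WithBot.add_le_add_natCast_right_iff] at hdim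
      refine ih (by lia) (QuotSMulTop x M) ?_ hdim fun i hi hij => ?_
      · simpa [Module.support_quotSMulTop, hM] using hx
      · obtain ⟨i, rfl⟩ : ∃ i', i = i' + 1 := ⟨i - 1, by lia⟩
        have hS := (IsSMulRegular.smulShortComplex_shortExact (M := ModuleCat.of R M) hxM)
        exact IsLocallyZero.ext_X₃ (S := ModuleCat.smulShortComplex (ModuleCat.of R M) x)
          (h i (by lia) (by lia)) (h (i + 1) (by lia) hij) hS (add_comm 1 i)

/-- If `L` has finite injective dimension, then it has injective dimension at most `dim R`
locally at `m`. -/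
lemma isLocallyZero_ext_of_ringKrullDim_lt {L : ModuleCat.{u} R} [Module.Finite R L] {n : ℕ}
    (hn : HasInjectiveDimensionLE L n) {d : ℕ} (hd : ringKrullDim R ≤ d)
    (T : Type u) [AddCommGroup T] [Module R T] [hT : Module.Finite R T] {j : ℕ} (hj : d < j) :
    IsLocallyZero m (Ext (ModuleCat.of R T) L j) := by
  -- Descending induction on the degree `i` from which Ext vanishes, starting beyond the injective
  -- dimension `n` and stopping just above `d`.
  suffices H : ∀ k i : ℕ, n < i + k → d < i → ∀ (T : Type u) [AddCommGroup T] [Module R T]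
      [Module.Finite R T], ∀ j, i ≤ j → IsLocallyZero m (Ext (ModuleCat.of R T) L j) from
    H (n + 1) j (by lia) hj T j le_rfl
  intro k
  induction k with
  | zero =>
    intro i hi _ T _ _ _ j hj
    have := HasInjectiveDimensionLT.subsingleton L (n + 1) j (by lia) (ModuleCat.of R T)
    exact IsLocallyZero.of_subsingleton m _
  | succ k ih =>
    intro i hi hdi T _ _ _ j hj
    refine isLocallyZero_ext_of_residueField (i := i) (fun j hj => ?_) T hj
    obtain hj | rfl := hj.lt_or_eq
    · exact ih (i + 1) (by lia) (by lia) _ j hj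
    -- Take `M = R`: its positive Ext groups vanish, and `j > d` keeps the required degrees `j - d,
    -- …, j` positive.
    refine isLocallyZero_ext_residueField_of_supportDim
      (fun T _ _ _ => ih (i + 1) (by lia) (by lia) T _ le_rfl) d hdi R ?_
      ((Module.supportDim_self_eq_ringKrullDim R).trans_le hd) fun t ht _ => ?_
    · rw [Module.mem_support_iff_of_finite]
      intro r hr
      have : r = 0 := by simpa using Module.mem_annihilator.1 hr 1
      exact this ▸ zero_mem m
    · obtain ⟨t, rfl⟩ : ∃ t', t = t' + 1 := ⟨t - 1, by lia⟩
      have := Ext.subsingleton_of_projective (ModuleCat.of R R) L t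
      exact IsLocallyZero.of_subsingleton m _

/-- Each element of the sequence lowers by one the degree above which Ext vanishes. For a sequence
of length `dim R` this brings the bound down to zero. -/
lemma isLocallyZero_ext_of_isWeaklyRegular {L : ModuleCat.{u} R} [Module.Finite R L]
    (rs : List R) (hrs : ∀ r ∈ rs, r ∈ m) (M : Type u) [AddCommGroup M] [Module R M]
    [Module.Finite R M] (hM : IsWeaklyRegular M rs) (a : ℕ)
    (h : ∀ (T : Type u) [AddCommGroup T] [Module R T] [Module.Finite R T],
      ∀ i, a + rs.length < i → IsLocallyZero m (Ext (ModuleCat.of R T) L i)) (i : ℕ) (hi : a < i) :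
    IsLocallyZero m (Ext (ModuleCat.of R M) L i) := by
  induction rs generalizing M a i with
  | nil => exact h M i (by simpa using hi)
  | cons r rs ih =>
    rw [isWeaklyRegular_cons_iff] at hM
    refine isLocallyZero_ext_of_quotSMulTop (M := ModuleCat.of R M) (hrs r (by simp)) hM.1
      (add_comm 1 i) ?_
    refine ih (fun s hs => hrs s (by simp [hs])) (QuotSMulTop r M) hM.2 (a + 1)
      (fun T _ _ _ j hj => h T j ?_) (i + 1) (by lia)
    simp only [List.length_cons]
    lia

/-- Over a Gorenstein ring, `Ext^i(N, R)` vanishes for `i > 0` if `N` is maximal Cohen-Macaulay. -/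
lemma IsMaximalCohenMacaulay.isLocallyZero_ext (hR : IsGorenstein R) {N : Type u} [AddCommGroup N]
    [Module R N] [Module.Finite R N] (hN : IsMaximalCohenMacaulay m N) (i : ℕ) (hi : 0 < i) :
    IsLocallyZero m (Ext (ModuleCat.of R N) (ModuleCat.of R R) i) := by
  obtain ⟨n, hn⟩ := hR
  obtain ⟨rs, hrs, hreg, hd⟩ := hN
  refine isLocallyZero_ext_of_isWeaklyRegular rs hrs N hreg.toIsWeaklyRegular 0
    (fun T _ _ _ j hj => ?_) i hi
  exact isLocallyZero_ext_of_ringKrullDim_lt hn hd.ge T (by simpa using hj)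

end LocalVanishing

/-! ### Regular local rings: domains, and finite projective dimension -/

section Regular

open Abelian IsLocalRing

/-- Exchange argument: as `x` is not in the square of the maximal ideal, one of its coefficients on
the generators is a unit, so `x` can replace that generator. -/
lemma exists_finset_card_span_map {S : Type*} [CommRing S] [IsLocalRing S] (s : Finset S)
    (hs : Ideal.span (s : Set S) = maximalIdeal S) {x : S} (hx : x ∈ maximalIdeal S)
    (hx2 : x ∉ maximalIdeal S ^ 2) :
    ∃ t : Finset S, t.card + 1 = s.card ∧ maximalIdeal S = Ideal.span (t : Set S) ⊔ Ideal.span {x} := by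
  classical
  rw [← hs, Submodule.mem_span_finset] at hx
  obtain ⟨a, -, ha⟩ := hx
  have : ∃ y ∈ s, a y ∉ maximalIdeal S := by
    by_contra! h
    refine hx2 (ha ▸ sum_mem fun y hy => ?_)
    rw [pow_two]
    exact Ideal.mul_mem_mul (h y hy) (hs ▸ Ideal.subset_span hy)
  obtain ⟨y, hy, hay⟩ := this
  refine ⟨s.erase y, Finset.card_erase_add_one hy, le_antisymm ?_ (sup_le ?_ ?_)⟩
  · rw [← hs, Ideal.span_le]
    intro z hz
    by_cases hzy : z = y
    · subst hzy
      have hu : IsUnit (a z) := by simpa using hay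
      have h : a z * z = x - ∑ w ∈ s.erase z, a w • w := by
        rw [← ha, ← Finset.add_sum_erase s _ hz]
        simp
      have : a z * z ∈ Ideal.span ((s.erase z : Finset S) : Set S) ⊔ Ideal.span {x} := by
        rw [h]
        refine sub_mem (Ideal.mem_sup_right (Ideal.mem_span_singleton_self x))
          (Ideal.mem_sup_left (sum_mem fun w hw => Ideal.mul_mem_left _ _ (Ideal.subset_span hw)))
      exact (Ideal.unit_mul_mem_iff_mem _ hu).1 this
    · exact Ideal.mem_sup_left (Ideal.subset_span (by simpa [hzy] using hz))
  · rw [← hs]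
    exact Ideal.span_mono (by simp)
  · rw [Ideal.span_singleton_le_iff_mem, ← hs, ← ha]
    exact sum_mem fun w hw => Ideal.mul_mem_left _ _ (Ideal.subset_span hw)

/-- A regular local ring of positive dimension has a regular hypersurface of smaller dimension. -/
lemma exists_isRegularLocalRing_quotient (S : Type*) [CommRing S] [hS : IsRegularLocalRing S]
    {n : ℕ} (hn : ringKrullDim S = (n + 1 : ℕ)) :
    ∃ x ∈ maximalIdeal S, (∀ q ∈ minimalPrimes S, x ∉ q) ∧
      IsRegularLocalRing (S ⧸ Ideal.span {x}) ∧ ringKrullDim (S ⧸ Ideal.span {x}) = n := by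
  classical
  have hfg : (maximalIdeal S).FG := IsNoetherian.noetherian _
  have hrank : (maximalIdeal S).spanFinrank = n + 1 := by
    have := hS.spanFinrank_maximalIdeal.trans hn
    exact_mod_cast this
  have hfin : (minimalPrimes S ∪ {maximalIdeal S ^ 2}).Finite :=
    (Ideal.finite_minimalPrimes_of_isNoetherianRing S ⊥).union (Set.finite_singleton _)
  -- Prime avoidance, with the square of the maximal ideal as a non-prime exception. Lying in a
  -- minimal prime would give height zero, and lying in its own square would give a zero maximal
  -- ideal by Nakayama; both contradict dimension `n + 1`.
  have hne : ¬ ((maximalIdeal S : Set S) ⊆ ⋃ q ∈ minimalPrimes S ∪ {maximalIdeal S ^ 2}, q) := by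
    intro h
    obtain ⟨q, hq, hmq⟩ := ((maximalIdeal S).subset_union_prime_finite hfin (f := id)
      (maximalIdeal S ^ 2) (maximalIdeal S ^ 2) fun q hq hq' _ =>
        (hq.resolve_right hq').1.1).1 h
    obtain hq | rfl := hq
    · have := hq.1.1
      have hmax : maximalIdeal S = q := le_antisymm hmq (le_maximalIdeal this.ne_top)
      have h0 : (maximalIdeal S).height = 0 := by
        rw [Ideal.height_eq_zero_iff, hmax]
        exact hq
      rw [← maximalIdeal_height_eq_ringKrullDim, h0] at hn
      have : (0 : ℕ) = n + 1 := by exact_mod_cast hn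
      lia
    · have hbot : maximalIdeal S = ⊥ := Submodule.eq_bot_of_le_smul_of_le_jacobson_bot
        (maximalIdeal S) _ hfg (by simpa [pow_two] using hmq) (maximalIdeal_le_jacobson ⊥)
      rw [hbot, Submodule.spanFinrank_bot] at hrank
      lia
  obtain ⟨x, hx, hxq⟩ := Set.not_subset.1 hne
  simp only [Set.mem_iUnion, not_exists] at hxq
  have hx2 : x ∉ maximalIdeal S ^ 2 := hxq _ (Or.inr rfl)
  obtain ⟨s, hs, hspan⟩ := Submodule.FG.exists_span_finset_card_eq_spanFinrank hfg
  obtain ⟨t, ht, hmt⟩ := exists_finset_card_span_map s hspan hx hx2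
  have hne_top : Ideal.span {x} ≠ ⊤ := fun h => (maximalIdeal.isMaximal S).ne_top
    (top_le_iff.1 (h ▸ (Ideal.span_singleton_le_iff_mem _).2 hx))
  have : Nontrivial (S ⧸ Ideal.span {x}) := Ideal.Quotient.nontrivial_iff.2 hne_top
  have hloc : IsLocalRing (S ⧸ Ideal.span {x}) :=
    IsLocalRing.of_surjective' _ Ideal.Quotient.mk_surjective
  -- Killing `x` saves one generator, whereas the dimension drops by at most one; so the quotient
  -- has at most as many generators as its dimension.
  have hle : (maximalIdeal (S ⧸ Ideal.span {x})).spanFinrank ≤ n := by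
    have : maximalIdeal (S ⧸ Ideal.span {x}) =
        Ideal.span ((t.image (Ideal.Quotient.mk (Ideal.span {x})) : Finset _) : Set _) := by
      have h1 : maximalIdeal (S ⧸ Ideal.span {x}) =
          (maximalIdeal S).map (Ideal.Quotient.mk (Ideal.span {x})) :=
        (map_maximalIdeal_of_surjective _ Ideal.Quotient.mk_surjective).symm
      rw [h1, hmt, Ideal.map_sup, Ideal.map_quotient_self, sup_bot_eq, Ideal.map_span,
        Finset.coe_image]
    rw [this]
    refine (Submodule.spanFinrank_span_le_ncard_of_finite (Finset.finite_toSet _)).trans ?_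
    rw [Set.ncard_coe_finset]
    exact Finset.card_image_le.trans (by lia)
  have hge : ringKrullDim S ≤ ringKrullDim (S ⧸ Ideal.span {x}) + 1 := by
    have := ringKrullDim_le_ringKrullDim_quotient_add_encard ({x} : Set S)
      (by simpa [IsLocalRing.ringJacobson_eq_maximalIdeal] using hx)
    simpa using this
  have hge' : (n : WithBot ℕ∞) ≤ ringKrullDim (S ⧸ Ideal.span {x}) := by
    rw [hn, Nat.cast_add, Nat.cast_one, ← Nat.cast_one (R := WithBot ℕ∞)] at hge
    exact ENat.WithBot.add_le_add_natCast_right_iff.1 hge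
  have hreg : IsRegularLocalRing (S ⧸ Ideal.span {x}) :=
    IsRegularLocalRing.of_spanFinrank_maximalIdeal_le _
      (le_trans (by exact_mod_cast hle) hge')
  refine ⟨x, hx, fun q hq => hxq q (Or.inl hq), hreg, le_antisymm ?_ hge'⟩
  rw [← hreg.spanFinrank_maximalIdeal]
  exact_mod_cast hle

lemma isField_of_ringKrullDim_eq_zero (S : Type*) [CommRing S] [hS : IsRegularLocalRing S]
    (hn : ringKrullDim S = 0) : IsField S := by
  rw [isField_iff_maximalIdeal_eq, ← Submodule.spanFinrank_eq_zero_iff_eq_bot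
    (IsNoetherian.noetherian _)]
  have := hS.spanFinrank_maximalIdeal.trans hn
  exact_mod_cast this

lemma exists_ringKrullDim_eq (S : Type*) [CommRing S] [hS : IsRegularLocalRing S] :
    ∃ n : ℕ, ringKrullDim S = n := ⟨_, hS.spanFinrank_maximalIdeal.symm⟩

/-- Induction on the dimension. The quotient by `x` is a domain, so `(x)` is prime and contains a
minimal prime `q` with `x ∉ q`. Then `q = xq`, and Nakayama gives `q = 0`. -/
lemma isDomain_of_isRegularLocalRing (S : Type*) [CommRing S] [hS : IsRegularLocalRing S] :
    IsDomain S := by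
  obtain ⟨n, hn⟩ := exists_ringKrullDim_eq S
  induction n generalizing S with
  | zero => exact (isField_of_ringKrullDim_eq_zero S hn).isDomain
  | succ n ih =>
    obtain ⟨x, hx, hxq, hreg, hdim⟩ := exists_isRegularLocalRing_quotient S hn
    have := ih _ hdim
    have hprime : (Ideal.span {x}).IsPrime := (Ideal.Quotient.isDomain_iff_prime _).1 this
    obtain ⟨q, hq, hqx⟩ := Ideal.exists_minimalPrimes_le (bot_le (a := Ideal.span {x}))
    have := hq.1.1
    have hle : q ≤ Ideal.span {x} • q := fun y hy => by
      obtain ⟨z, rfl⟩ := Ideal.mem_span_singleton'.1 (hqx hy)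
      rw [mul_comm]
      exact Submodule.smul_mem_smul (Ideal.mem_span_singleton_self x)
        ((this.mem_or_mem hy).resolve_right (hxq q hq))
    have hbot : q = ⊥ := Submodule.eq_bot_of_le_smul_of_le_jacobson_bot _ _
      (IsNoetherian.noetherian _) hle (((Ideal.span_singleton_le_iff_mem _).2 hx).trans
        (maximalIdeal_le_jacobson ⊥))
    exact (IsDomain.of_bot_isPrime S (hbp := hbot ▸ this))

variable {R : Type u} [CommRing R]

lemma shortExact_quotient_sup_span {I : Ideal R} [hI : I.IsPrime] {x : R} (hx : x ∉ I) :
    ∃ (g : ModuleCat.of R (R ⧸ I) ⟶ ModuleCat.of R (R ⧸ I ⊔ Ideal.span {x}))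
      (w : (x • 𝟙 (ModuleCat.of R (R ⧸ I))) ≫ g = 0),
      (ShortComplex.mk (x • 𝟙 (ModuleCat.of R (R ⧸ I))) g w).ShortExact := by
  let g : (R ⧸ I) →ₗ[R] (R ⧸ I ⊔ Ideal.span {x}) := Submodule.factor le_sup_left
  have hg (r : R) : g (Ideal.Quotient.mk I r) = Ideal.Quotient.mk _ r := rfl
  have hexact : Function.Exact (x • LinearMap.id : (R ⧸ I) →ₗ[R] (R ⧸ I)) g := by
    intro y
    obtain ⟨y, rfl⟩ := Ideal.Quotient.mk_surjective y
    rw [hg, Ideal.Quotient.eq_zero_iff_mem]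
    constructor
    · intro hy
      obtain ⟨i, hi, z, hz, rfl⟩ := Submodule.mem_sup.1 hy
      obtain ⟨r, rfl⟩ := Ideal.mem_span_singleton'.1 hz
      refine ⟨Ideal.Quotient.mk I r, ?_⟩
      rw [map_add, Ideal.Quotient.eq_zero_iff_mem.2 hi, zero_add, mul_comm]
      rfl
    · rintro ⟨r, hr⟩
      obtain ⟨r, rfl⟩ := Ideal.Quotient.mk_surjective r
      have : Ideal.Quotient.mk I (x * r) = Ideal.Quotient.mk I y := hr
      rw [Ideal.Quotient.eq] at this
      rw [← sub_sub_cancel (x * r) y]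
      exact sub_mem (Ideal.mem_sup_right (Ideal.mul_mem_right _ _
        (Ideal.mem_span_singleton_self x))) (Ideal.mem_sup_left this)
  refine ⟨ModuleCat.ofHom g, ModuleCat.hom_ext hexact.linearMap_comp_eq_zero,
    ModuleCat.shortComplex_shortExact _ hexact ?_ ?_⟩
  · change Function.Injective (x • LinearMap.id : (R ⧸ I) →ₗ[R] (R ⧸ I))
    rw [injective_iff_map_eq_zero]
    intro y hy
    obtain ⟨y, rfl⟩ := Ideal.Quotient.mk_surjective y
    have : x * y ∈ I := Ideal.Quotient.eq_zero_iff_mem.1 hy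
    exact Ideal.Quotient.eq_zero_iff_mem.2 ((hI.mem_or_mem this).resolve_left hx)
  · exact Submodule.factor_surjective le_sup_left

/-- The residue field of a regular local ring has finite projective dimension. -/
lemma exists_hasProjectiveDimensionLE_residueField [IsLocalRing R] (n : ℕ) (I : Ideal R)
    [hI : IsRegularLocalRing (R ⧸ I)] (hn : ringKrullDim (R ⧸ I) = n)
    (h : ∃ a, HasProjectiveDimensionLE (ModuleCat.of R (R ⧸ I)) a) :
    ∃ b, HasProjectiveDimensionLE (ModuleCat.of R (R ⧸ maximalIdeal R)) b := by
  -- Each cut of `R/I` by a regular element raises the projective dimension by at most one, and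
  -- after `n` cuts the quotient is the residue field.
  induction n generalizing I with
  | zero =>
    have : I.IsMaximal := Ideal.Quotient.maximal_of_isField I
      (isField_of_ringKrullDim_eq_zero _ hn)
    rwa [← eq_maximalIdeal this]
  | succ n ih =>
    obtain ⟨x, -, hxq, hreg, hdim⟩ := exists_isRegularLocalRing_quotient (R ⧸ I) hn
    obtain ⟨x, rfl⟩ := Ideal.Quotient.mk_surjective x
    have hdom := isDomain_of_isRegularLocalRing (R ⧸ I)
    have : I.IsPrime := (Ideal.Quotient.isDomain_iff_prime _).1 hdom
    have hx : x ∉ I := fun h => hxq ⊥ (by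
      rw [IsDomain.minimalPrimes_eq_singleton_bot]; rfl) (Ideal.Quotient.eq_zero_iff_mem.2 h)
    have e : ((R ⧸ I) ⧸ Ideal.span {Ideal.Quotient.mk I x}) ≃+* R ⧸ I ⊔ Ideal.span {x} :=
      (Ideal.quotEquivOfEq (by rw [Ideal.map_span, Set.image_singleton])).trans
        (DoubleQuot.quotQuotEquivQuotSup I (Ideal.span {x}))
    have := IsRegularLocalRing.of_ringEquiv e
    rw [ringKrullDim_eq_of_ringEquiv e] at hdim
    obtain ⟨a, ha⟩ := h
    obtain ⟨g, w, hS⟩ := shortExact_quotient_sup_span hx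
    refine ih _ hdim ⟨a + 1, hS.hasProjectiveDimensionLT_X₃ (a + 1) ha
      (hasProjectiveDimensionLT_of_ge _ (a + 1) (a + 2) (by lia))⟩

/-- Finitely generated modules over a regular local ring have finite projective dimension. -/
lemma exists_hasProjectiveDimensionLE_of_isRegularLocalRing [IsRegularLocalRing R]
    (T : ModuleCat.{u} R) [Module.Finite R T] : ∃ n, HasProjectiveDimensionLE T n := by
  have := IsRegularLocalRing.of_ringEquiv (RingEquiv.quotientBot R).symm
  obtain ⟨n, hn⟩ := exists_ringKrullDim_eq (R ⧸ (⊥ : Ideal R))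
  obtain ⟨b, hb⟩ := exists_hasProjectiveDimensionLE_residueField n ⊥ hn ⟨0, by
    have : Module.Free R (R ⧸ (⊥ : Ideal R)) :=
      Module.Free.of_equiv (Submodule.quotEquivOfEqBot ⊥ rfl).symm
    rw [HasProjectiveDimensionLE, zero_add, ← projective_iff_hasProjectiveDimensionLT_one]
    exact ModuleCat.projective_of_free (Module.Free.chooseBasis R _)⟩
  refine ⟨b, ModuleCat.hasProjectiveDimensionLT_of_forall_finite T (b + 1) fun L _ => ⟨?_⟩⟩
  -- The vanishing for the residue field spreads to all finitely generated `T`; over a local ring,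
  -- an element outside the maximal ideal is a unit, so local vanishing is vanishing.
  have hzero (e : Ext T L (b + 1)) : e = 0 := by
    obtain ⟨s, hs, he⟩ := isLocallyZero_ext_of_residueField (m := maximalIdeal R) (L := L)
      (i := b + 1) (fun j hj => by
        have := HasProjectiveDimensionLT.subsingleton
          (ModuleCat.of R (R ⧸ maximalIdeal R)) (b + 1) j hj L
        exact IsLocallyZero.of_subsingleton _ _) T le_rfl e
    have hs' : IsUnit s := by simpa using hs
    exact (IsUnit.smul_eq_zero hs').1 he
  exact fun e e' => (hzero e).trans (hzero e').symm

end Regular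

/-! ### Maximal Cohen-Macaulay modules are projective on the regular locus -/

section LocallyFree

open Abelian

variable {R : Type u} [CommRing R]

/-- Locally at `p`, the module `T` is a direct summand of a free module: a multiple of the identity
by some `s ∉ p` factors through a free module. -/
def IsLocallyProjective (p : Ideal R) (T : Type*) [AddCommGroup T] [Module R T] : Prop :=
  ∃ s ∉ p, ∃ (n : ℕ) (a : T →ₗ[R] (Fin n → R)) (b : (Fin n → R) →ₗ[R] T),
    b ∘ₗ a = s • LinearMap.id

/-- The obstruction to extending a coordinate of `a` is a class in `Ext¹(S.X₃, R)`, killed by some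
element outside `p`. The product over the coordinates serves for all of them. -/
lemma exists_extension {p : Ideal R} [hp : p.IsPrime] {S : ShortComplex (ModuleCat.{u} R)}
    (hS : S.ShortExact) (h : IsLocallyZero p (Ext S.X₃ (ModuleCat.of R R) 1)) {n : ℕ}
    (a : S.X₁ →ₗ[R] (Fin n → R)) :
    ∃ s ∉ p, ∃ a' : S.X₂ →ₗ[R] (Fin n → R), a' ∘ₗ S.f.hom = s • a := by
  classical
  have key (j : Fin n) : ∃ s ∉ p, ∃ c : S.X₂ →ₗ[R] R,
      c ∘ₗ S.f.hom = s • (LinearMap.proj j ∘ₗ a) := by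
    let α : S.X₁ ⟶ ModuleCat.of R R := ModuleCat.ofHom (LinearMap.proj j ∘ₗ a)
    obtain ⟨s, hs, he⟩ := h (hS.extClass.comp (Ext.mk₀ α) (add_zero 1))
    rw [← Ext.comp_smul, ← Ext.mk₀_smul] at he
    obtain ⟨e, he'⟩ := Ext.contravariant_sequence_exact₁ hS _ _ _ he
    obtain ⟨c, rfl⟩ := (Ext.mk₀_bijective _ _).2 e
    rw [Ext.mk₀_comp_mk₀, (Ext.mk₀_bijective _ _).1.eq_iff] at he'
    exact ⟨s, hs, c.hom, congrArg ModuleCat.Hom.hom he'⟩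
  choose s hs c hc using key
  refine ⟨∏ j, s j, fun hprod => ?_, LinearMap.pi fun j => (∏ i ∈ Finset.univ.erase j, s i) • c j,
    ?_⟩
  · obtain ⟨j, -, hj⟩ := (Ideal.IsPrime.prod_mem_iff (p := p)).1 hprod
    exact hs j hj
  · ext x j
    have := LinearMap.congr_fun (hc j) x
    simp only [LinearMap.comp_apply, LinearMap.smul_apply, LinearMap.proj_apply] at this
    simp only [LinearMap.comp_apply, LinearMap.pi_apply, LinearMap.smul_apply, this,
      Pi.smul_apply, smul_smul]
    rw [mul_comm, Finset.mul_prod_erase _ _ (Finset.mem_univ j)]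

/-- If the syzygy `K` in `0 ⟶ K ⟶ F ⟶ T ⟶ 0` is locally projective and `Ext¹(T, R)` vanishes
locally, then `T` is locally projective. -/
lemma isLocallyProjective_of_syzygy {p : Ideal R} [hp : p.IsPrime]
    {S : ShortComplex (ModuleCat.{u} R)} (hS : S.ShortExact)
    (h : IsLocallyZero p (Ext S.X₃ (ModuleCat.of R R) 1)) {m : ℕ} (e : S.X₂ ≃ₗ[R] (Fin m → R))
    (hK : IsLocallyProjective p S.X₁) : IsLocallyProjective p S.X₃ := by
  obtain ⟨s, hs, n, a, b, hab⟩ := hK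
  obtain ⟨t, ht, a', ha'⟩ := exists_extension hS h a
  have hexact := (ShortComplex.ShortExact.moduleCat_exact_iff_function_exact S).1 hS.exact
  have hsurj : Function.Surjective S.g.hom := hS.moduleCat_surjective_g
  have hsf (x : S.X₁) : b (a' (S.f.hom x)) = (t * s) • x := by
    have h₁ := LinearMap.congr_fun ha' x
    have h₂ := LinearMap.congr_fun hab x
    simp only [LinearMap.comp_apply, LinearMap.smul_apply, LinearMap.id_apply] at h₁ h₂
    rw [h₁, map_smul, h₂, smul_smul]
  -- This endomorphism vanishes on the image of `S.f`, so it descends to a map from `S.X₃` to `S.X₂`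
  -- which is a section of `S.g` up to the factor `t * s`.
  let ψ : S.X₂ →ₗ[R] S.X₂ := (t * s) • LinearMap.id - S.f.hom ∘ₗ b ∘ₗ a'
  have hψ : LinearMap.ker S.g.hom ≤ LinearMap.ker ψ := fun y hy => by
    obtain ⟨x, rfl⟩ := (hexact y).1 hy
    change (t * s) • S.f.hom x - S.f.hom (b (a' (S.f.hom x))) = 0
    rw [hsf, map_smul, sub_self]
  let σ : S.X₃ →ₗ[R] S.X₂ := (LinearMap.ker S.g.hom).liftQ ψ hψ ∘ₗ
    (S.g.hom.quotKerEquivOfSurjective hsurj).symm.toLinearMap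
  refine ⟨t * s, hp.mul_notMem ht hs, m, e.toLinearMap ∘ₗ σ, S.g.hom ∘ₗ e.symm.toLinearMap, ?_⟩
  ext z
  obtain ⟨y, rfl⟩ := hsurj z
  have hσ : σ (S.g.hom y) = ψ y := by
    have : (S.g.hom.quotKerEquivOfSurjective hsurj).symm (S.g.hom y) =
        (LinearMap.ker S.g.hom).mkQ y := by
      rw [LinearEquiv.symm_apply_eq]; rfl
    change (LinearMap.ker S.g.hom).liftQ ψ hψ ((S.g.hom.quotKerEquivOfSurjective hsurj).symm _) = _
    rw [this]; rfl
  have hgf : S.g.hom (S.f.hom (b (a' y))) = 0 := (hexact _).2 ⟨_, rfl⟩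
  change S.g.hom (e.symm (e (σ (S.g.hom y)))) = (t * s) • S.g.hom y
  rw [e.symm_apply_apply, hσ]
  change S.g.hom ((t * s) • y - S.f.hom (b (a' y))) = _
  rw [map_sub, map_smul, hgf, sub_zero]

variable [IsNoetherianRing R]

/-- A splitting of the localized presentation comes from a map over `R` after clearing a
denominator, and the splitting identity holds after multiplying by one further element outside `p`.
-/
lemma isLocallyProjective_of_projective_localizedModule (p : Ideal R) [p.IsPrime]
    (T : Type u) [AddCommGroup T] [Module R T] [Module.Finite R T]
    {T' : Type u} [AddCommGroup T'] [Module R T'] [Module (Localization.AtPrime p) T']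
    [IsScalarTower R (Localization.AtPrime p) T']
    (f : T →ₗ[R] T') [IsLocalizedModule p.primeCompl f]
    [hT : Module.Projective (Localization.AtPrime p) T'] : IsLocallyProjective p T := by
  obtain ⟨n, π, hπ⟩ := Module.Finite.exists_fin' R T
  have := Module.finitePresentation_of_finite R T
  let f₀ : (Fin n → R) →ₗ[R] (Fin n → Localization.AtPrime p) :=
    LinearMap.pi fun i => Algebra.linearMap R (Localization.AtPrime p) ∘ₗ LinearMap.proj i
  have hf₀ : IsLocalizedModule p.primeCompl f₀ := inferInstance
  let π' : (Fin n → Localization.AtPrime p) →ₗ[Localization.AtPrime p] T' :=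
    IsLocalizedModule.mapExtendScalars p.primeCompl f₀ f (Localization.AtPrime p) π
  have hπ' (x) : π' (f₀ x) = f (π x) := IsLocalizedModule.map_apply p.primeCompl f₀ f π x
  have hsurj : Function.Surjective π' :=
    IsLocalizedModule.map_surjective p.primeCompl f₀ f π hπ
  obtain ⟨σ, hσ⟩ := Module.projective_lifting_property π' LinearMap.id hsurj
  obtain ⟨σ', s, hs⟩ := Module.FinitePresentation.exists_lift_of_isLocalizedModule p.primeCompl f₀
    (σ.restrictScalars R ∘ₗ f)
  have hcomp : f ∘ₗ (π ∘ₗ σ') = f ∘ₗ (s • LinearMap.id) := by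
    ext x
    have h₁ : f₀ (σ' x) = s.1 • σ (f x) := LinearMap.congr_fun hs x
    have h₂ : π' (σ (f x)) = f x := LinearMap.congr_fun hσ (f x)
    change f (π (σ' x)) = f (s.1 • x)
    rw [← hπ', h₁, ← algebraMap_smul (Localization.AtPrime p) s.1, map_smul, h₂, algebraMap_smul,
      map_smul]
  obtain ⟨t, ht⟩ := Module.Finite.exists_smul_of_comp_eq_of_isLocalizedModule p.primeCompl f _ _
    hcomp
  refine ⟨(t * s : p.primeCompl), (t * s).2, n, σ', t.1 • π, ?_⟩
  ext x
  have : t.1 • π (σ' x) = t.1 • s.1 • x := LinearMap.congr_fun ht x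
  change t.1 • π (σ' x) = (t.1 * s.1) • x
  rw [this, mul_smul]

/-- A syzygy inherits the vanishing of Ext into `R` and has smaller projective dimension at `p`.
Once the localization is projective, `isLocallyProjective_of_syzygy` climbs back. -/
lemma isLocallyProjective_of_hasProjectiveDimensionLE {p : Ideal R} [hp : p.IsPrime] (n : ℕ)
    (T : ModuleCat.{u} R) [Module.Finite R T]
    (hT : HasProjectiveDimensionLE (T.localizedModule p.primeCompl) n)
    (h : ∀ i, 0 < i → IsLocallyZero p (Ext T (ModuleCat.of R R) i)) :
    IsLocallyProjective p T := by
  induction n generalizing T with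
  | zero =>
    rw [HasProjectiveDimensionLE, zero_add, ← projective_iff_hasProjectiveDimensionLT_one,
      ← IsProjective.iff_projective] at hT
    exact isLocallyProjective_of_projective_localizedModule p T
      (T.localizedModuleMkLinearMap p.primeCompl)
  | succ n ih =>
    obtain ⟨m, π, hπ⟩ := Module.Finite.exists_fin' R T
    let S : ShortComplex (ModuleCat.{u} R) := π.shortComplexKer
    have hS : S.ShortExact := LinearMap.shortExact_shortComplexKer hπ
    have hS' := hS.map_of_exact (ModuleCat.localizedModuleFunctor p.primeCompl)
    have hfree : Projective S.X₂ := ModuleCat.projective_of_free (Pi.basisFun R (Fin m))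
    have hproj := (ModuleCat.localizedModuleFunctor.{u} p.primeCompl).projective_obj S.X₂
    refine isLocallyProjective_of_syzygy hS (h 1 one_pos) (LinearEquiv.refl R _) ?_
    have : Module.Finite R S.X₁ := inferInstanceAs (Module.Finite R (LinearMap.ker π))
    refine ih S.X₁ ((hS'.hasProjectiveDimensionLT_X₃_iff n hproj).1 hT) fun i hi => ?_
    refine IsLocallyZero.ext_X₁ ?_ (h (i + 1) (by lia)) hS (add_comm 1 i)
    obtain ⟨i, rfl⟩ : ∃ i', i = i' + 1 := ⟨i - 1, by lia⟩
    have := Ext.subsingleton_of_projective S.X₂ (ModuleCat.of R R) i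
    exact IsLocallyZero.of_subsingleton p _

/-- A maximal Cohen-Macaulay module over a Gorenstein ring is projective on the regular locus. -/
theorem IsMaximalCohenMacaulay.isLocallyProjective {m : Ideal R} [hm : m.IsMaximal]
    (hR : IsGorenstein R) {N : Type u} [AddCommGroup N] [Module R N] [Module.Finite R N]
    (hN : IsMaximalCohenMacaulay m N) {p : Ideal R} [p.IsPrime] (hpm : p ≤ m)
    [IsRegularLocalRing (Localization.AtPrime p)] : IsLocallyProjective p N := by
  have hloc := ModuleCat.localizedModule_isLocalizedModule (ModuleCat.of R N) p.primeCompl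
  have : Module.Finite (Localization.AtPrime p)
      ((ModuleCat.of R N).localizedModule p.primeCompl) :=
    Module.Finite.of_isLocalizedModule p.primeCompl
      ((ModuleCat.of R N).localizedModuleMkLinearMap p.primeCompl)
  obtain ⟨n, hn⟩ := exists_hasProjectiveDimensionLE_of_isRegularLocalRing
    ((ModuleCat.of R N).localizedModule p.primeCompl)
  exact isLocallyProjective_of_hasProjectiveDimensionLE n (ModuleCat.of R N) hn fun i hi =>
    (hN.isLocallyZero_ext hR i hi).mono hpm

end LocallyFree

/-! ### Endomorphism rings of indecomposable modules are local -/

section LocalEnd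

/-- `R/m^s` is noetherian of dimension zero, hence artinian, and `X` is a quotient of one of its
finite powers. -/
lemma isArtinian_of_pow_le_annihilator {R : Type*} [CommRing R] [IsNoetherianRing R] (m : Ideal R)
    [m.IsMaximal] (X : Type*) [AddCommGroup X] [Module R X] [Module.Finite R X] (s : ℕ)
    (h : m ^ s ≤ Module.annihilator R X) : IsArtinian R X := by
  have hdim : Ring.KrullDimLE 0 (R ⧸ m ^ s) := by
    rw [Ideal.krullDimLE_zero_quotient_iff_forall_minimalPrimes_isMaximal]
    intro J hJ
    have hmJ : m ≤ J := hJ.1.1.le_of_pow_le hJ.1.2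
    rwa [← Ideal.IsMaximal.eq_of_le ‹_› hJ.1.1.ne_top hmJ]
  have hart : IsArtinianRing (R ⧸ m ^ s) := IsNoetherianRing.isArtinianRing_of_krullDimLE_zero
  have hart' : IsArtinian R (R ⧸ m ^ s) :=
    isArtinian_of_surjective_algebraMap (R := R ⧸ m ^ s) Ideal.Quotient.mk_surjective
  obtain ⟨n, π, hπ⟩ := Module.Finite.exists_fin' R X
  let g (j : Fin n) : (R ⧸ m ^ s) →ₗ[R] X := (m ^ s).liftQ
    (LinearMap.toSpanSingleton R X (π (Pi.single j 1))) fun r hr =>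
      Module.mem_annihilator.1 (h hr) _
  refine isArtinian_of_surjective (M := Fin n → R ⧸ m ^ s) (LinearMap.lsum R _ ℕ g) fun x => ?_
  obtain ⟨a, rfl⟩ := hπ x
  refine ⟨fun j => Ideal.Quotient.mk _ (a j), ?_⟩
  rw [LinearMap.lsum_apply, LinearMap.sum_apply]
  conv_rhs => rw [pi_eq_sum_univ' a]
  rw [map_sum]
  refine Finset.sum_congr rfl fun j _ => ?_
  change a j • π (Pi.single j 1) = π (a j • _)
  rw [map_smul]

/-- A commutative ring which is complete with respect to an ideal with artinian quotient, and whose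
only idempotents are `0` and `1`, is local. -/
lemma isUnit_or_isUnit_one_sub {B : Type*} [CommRing B] (J : Ideal B) [IsAdicComplete J B]
    [IsArtinianRing (B ⧸ J)] (hB : ∀ b : B, b * b = b → b = 0 ∨ b = 1) (b : B) :
    IsUnit b ∨ IsUnit (1 - b) := by
  have hJ : J ≤ Ideal.jacobson ⊥ := IsAdicComplete.le_jacobson_bot J
  have := isLocalHom_of_le_jacobson_bot J hJ
  have hunit (c : B) (hc : IsUnit (Ideal.Quotient.mk J c)) : IsUnit c := isUnit_of_map_unit _ c hc
  let β := Ideal.Quotient.mk J b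
  -- Fitting's argument: the powers of `β` stabilize up to multiples, so `β ^ n * y ^ n` is an
  -- idempotent. It equals `0` only if `β` is nilpotent and `1` only if `β` is invertible.
  obtain ⟨n, y, hy⟩ := IsArtinian.exists_pow_succ_smul_dvd β (1 : B ⧸ J)
  simp only [smul_eq_mul, mul_one, Nat.succ_eq_add_one] at hy
  have hpow (k : ℕ) : β ^ n = β ^ (n + k) * y ^ k := by
    induction k with
    | zero => simp
    | succ k ih =>
      calc β ^ n = β ^ k * β ^ n * y ^ k := by rw [← pow_add, add_comm k, ← ih]
        _ = β ^ k * (β ^ (n + 1) * y) * y ^ k := by rw [hy]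
        _ = β ^ (n + (k + 1)) * y ^ (k + 1) := by ring
  let ε := β ^ n * y ^ n
  have hε : ε * ε = ε := by
    calc β ^ n * y ^ n * (β ^ n * y ^ n) = (β ^ (n + n) * y ^ n) * y ^ n := by ring
      _ = β ^ n * y ^ n := by rw [← hpow]
  have hβε : β ^ n * ε = β ^ n := by
    calc β ^ n * (β ^ n * y ^ n) = β ^ (n + n) * y ^ n := by ring
      _ = β ^ n := (hpow n).symm
  obtain ⟨a₀, ha₀⟩ := Ideal.Quotient.mk_surjective ε
  -- Hensel's lemma lifts the idempotent as a root of `X² - X`, whose derivative `2ε - 1` is its own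
  -- inverse.
  obtain ⟨a, ha, haa₀⟩ := (IsAdicComplete.henselianRing B J).is_henselian
    (Polynomial.X ^ 2 - Polynomial.X) (by monicity!) a₀ (by
      rw [← Ideal.Quotient.eq_zero_iff_mem]
      simp [ha₀, pow_two, hε]) (by
      have h : ((1 + 1) * ε - 1) * ((1 + 1) * ε - 1) = 1 := by linear_combination 4 * hε
      simpa [ha₀] using IsUnit.of_mul_eq_one _ h)
  have haε : Ideal.Quotient.mk J a = ε := by
    rw [← ha₀]
    exact Ideal.Quotient.eq.2 haa₀
  have haa : a * a = a := by
    have : a ^ 2 - a = 0 := by simpa [Polynomial.IsRoot] using ha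
    linear_combination this
  obtain rfl | rfl := hB a haa
  · right
    rw [map_zero] at haε
    rw [← haε, mul_zero] at hβε
    refine hunit _ ?_
    rw [map_sub, map_one]
    exact IsNilpotent.isUnit_one_sub ⟨n, hβε.symm⟩
  · left
    rw [map_one] at haε
    have : β ^ n * y ^ n = 1 := haε.symm
    refine hunit b ?_
    by_cases hn : n = 0
    · subst hn
      rw [zero_add, pow_one, pow_zero] at hy
      exact IsUnit.of_mul_eq_one _ hy
    · exact (isUnit_pow_iff hn).1 (IsUnit.of_mul_eq_one _ this)

/-- Separatedness holds because `I` lies in the Jacobson radical. For surjectivity onto the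
completion, the latter is covered by the tensor product of the completed ring with `M`, and `R` is
already complete. -/
lemma isAdicComplete_of_finite {R : Type*} [CommRing R] [IsNoetherianRing R] (I : Ideal R)
    [IsAdicComplete I R] (M : Type*) [AddCommGroup M] [Module R M] [Module.Finite R M] :
    IsAdicComplete I M := by
  have h₁ : IsHausdorff I M := IsHausdorff.of_le_jacobson I M (IsAdicComplete.le_jacobson_bot I)
  have h₂ : IsPrecomplete I M := by
    rw [← AdicCompletion.of_surjective_iff]
    intro y
    obtain ⟨z, rfl⟩ := AdicCompletion.ofTensorProduct_surjective_of_finite I M y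
    induction z using TensorProduct.induction_on with
    | zero => exact ⟨0, by simp⟩
    | add a b ha hb =>
      obtain ⟨x, hx⟩ := ha
      obtain ⟨x', hx'⟩ := hb
      exact ⟨x + x', by rw [map_add, map_add, hx, hx']⟩
    | tmul r x =>
      obtain ⟨r, rfl⟩ := AdicCompletion.of_surjective I R r
      refine ⟨r • x, ?_⟩
      rw [AdicCompletion.ofTensorProduct_tmul, map_smul]
      ext n
      rfl
  exact { }

/-- The endomorphism ring of a finitely generated indecomposable module over a complete local ring
is local. -/
lemma IsIndecomposableModule.isUnit_or_isUnit_one_sub {R : Type u} [CommRing R] [IsLocalRing R]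
    [IsNoetherianRing R] [IsAdicComplete (IsLocalRing.maximalIdeal R) R] {N : Type u}
    [AddCommGroup N] [Module R N] [Module.Finite R N] (hN : IsIndecomposableModule R N)
    (f : Module.End R N) : IsUnit f ∨ IsUnit (1 - f) := by
  -- The commutative ring `R[f]` is finite over `R`, hence complete, and its idempotents are
  -- projections of `N`, which are trivial by indecomposability.
  let B := Algebra.adjoin R {f}
  have := Algebra.isMulCommutative_adjoin R (s := {f}) (by simp)
  let : CommRing B := inferInstance
  have : Module.Finite R B := inferInstanceAs (Module.Finite R (Subalgebra.toSubmodule B))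
  let J : Ideal B := (IsLocalRing.maximalIdeal R).map (algebraMap R B)
  have : IsAdicComplete J B := (IsAdicComplete.map_algebraMap_iff _ _).2
    (isAdicComplete_of_finite (IsLocalRing.maximalIdeal R) B)
  have : IsArtinianRing (B ⧸ J) := by
    have : IsArtinian R (B ⧸ J) :=
      isArtinian_of_pow_le_annihilator (IsLocalRing.maximalIdeal R) (B ⧸ J) 1 (by
        rw [pow_one]
        intro r hr
        rw [Module.mem_annihilator]
        intro x
        obtain ⟨x, rfl⟩ := Ideal.Quotient.mk_surjective x
        have : r • Ideal.Quotient.mk J x = Ideal.Quotient.mk J (algebraMap R B r * x) := by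
          rw [← Algebra.smul_def]; rfl
        rw [this, Ideal.Quotient.eq_zero_iff_mem]
        exact Ideal.mul_mem_right _ _ (Ideal.mem_map_of_mem _ hr))
    exact isArtinian_of_tower R this
  have hf : f ∈ B := Algebra.self_mem_adjoin_singleton R f
  have hB (b : B) (hb : b * b = b) : b = 0 ∨ b = 1 := by
    have hb' : IsIdempotentElem b.1 := congrArg Subtype.val hb
    obtain h | h := hN.2 _ _ (LinearMap.IsIdempotentElem.isCompl hb')
    · left
      exact Subtype.ext (LinearMap.range_eq_bot.1 h)
    · right
      refine Subtype.ext (LinearMap.ext fun x => LinearMap.ker_eq_bot.1 h ?_)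
      exact LinearMap.congr_fun hb' x
  exact (NCR.isUnit_or_isUnit_one_sub J hB ⟨f, hf⟩).imp (fun h => h.map B.val) fun h =>
    h.map B.val

end LocalEnd

/-! ### Modules annihilated by the idempotent of the free summand -/

section Annihilation

variable {R : Type u} [CommRing R] {M : Type u} [AddCommGroup M] [Module R M]
  {π : M →ₗ[R] R} {z : M} {e : Module.End R M}
  {X : Type*} [AddCommGroup X] [Module (Module.End R M) X]

/-- An endomorphism factoring through `R` also factors through `e`, so it lies in the two-sided
ideal generated by `e`. -/
lemma smulRight_smul_eq_zero (hz : π z = 1) (he : ∀ x, e x = π x • z)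
    (hX : ∀ x : X, e • x = 0) (a : M →ₗ[R] R) (b : M) (x : X) :
    (show Module.End R M from a.smulRight b) • x = 0 := by
  have h : (show Module.End R M from a.smulRight b) =
      (show Module.End R M from π.smulRight b) * e * (show Module.End R M from a.smulRight z) := by
    ext y
    change a y • b = π (e (a y • z)) • b
    rw [he, map_smul, map_smul, hz, smul_eq_mul, mul_one, smul_eq_mul, mul_one]
  rw [h, mul_smul, mul_smul, hX, smul_zero]

/-- If `e` is the projection of `M = R ⊕ ⨁ N i` to `R`, and if the modules `N i` are locally
projective at `p`, then every `End(M)`-module `X` with `eX = 0` vanishes locally at `p`. -/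
lemma exists_notMem_forall_smul_eq_zero (hz : π z = 1) (he : ∀ x, e x = π x • z)
    (hX : ∀ x : X, e • x = 0) {ι : Type*} [Fintype ι] {N : ι → Type*} [∀ i, AddCommGroup (N i)]
    [∀ i, Module R (N i)] (α : ∀ i, N i →ₗ[R] M) (β : ∀ i, M →ₗ[R] N i)
    (hαβ : ∀ x, e x + ∑ i, α i (β i x) = x) {p : Ideal R} [hp : p.IsPrime]
    (hN : ∀ i, IsLocallyProjective p (N i)) :
    ∃ s ∉ p, ∀ x : X, algebraMap R (Module.End R M) s • x = 0 := by
  classical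
  choose s hs n a b hab using hN
  let φ (i : ι) : Module.End R M := α i ∘ₗ β i
  -- The multiple of `φ i` by `s i` factors through a finite free module, so it is a sum of
  -- endomorphisms factoring through `R`.
  have hφ (i : ι) (x : X) : algebraMap R (Module.End R M) (s i) • φ i • x = 0 := by
    have h : algebraMap R (Module.End R M) (s i) * φ i = ∑ j, (show Module.End R M from
        (LinearMap.proj j ∘ₗ a i ∘ₗ β i).smulRight (α i (b i (Pi.single j 1)))) := by
      ext y
      have hy : b i (a i (β i y)) = s i • β i y := LinearMap.congr_fun (hab i) (β i y)
      rw [pi_eq_sum_univ' (a i (β i y)), map_sum] at hy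
      rw [LinearMap.sum_apply]
      change s i • α i (β i y) = ∑ j, a i (β i y) j • α i (b i (Pi.single j 1))
      rw [← map_smul, ← hy, map_sum]
      refine Finset.sum_congr rfl fun j _ => ?_
      rw [← map_smul, ← map_smul]
    rw [← mul_smul, h, Finset.sum_smul]
    exact Finset.sum_eq_zero fun j _ => smulRight_smul_eq_zero hz he hX _ _ x
  have hone : (1 : Module.End R M) = e + ∑ i, φ i := by
    ext x
    rw [LinearMap.add_apply, LinearMap.sum_apply]
    exact (hαβ x).symm
  refine ⟨∏ i, s i, fun hprod => ?_, fun x => ?_⟩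
  · obtain ⟨i, -, hi⟩ := (Ideal.IsPrime.prod_mem_iff (p := p)).1 hprod
    exact hs i hi
  · have hx : x = ∑ i, φ i • x := by
      conv_lhs => rw [← one_smul (Module.End R M) x, hone, add_smul, hX, zero_add, Finset.sum_smul]
    rw [hx, Finset.smul_sum]
    refine Finset.sum_eq_zero fun i _ => ?_
    rw [← Finset.prod_erase_mul _ _ (Finset.mem_univ i), map_mul, mul_smul, hφ, smul_zero]

end Annihilation

/-! ### Local idempotents and their simple modules -/

section LocalIdempotent

variable {A : Type u} [Ring A]

/-- The corner ring `eAe` of an idempotent is local: if a sum of two elements is the unit element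
`e`, then one of the two has a left inverse. -/
def IsLocalIdempotent (e : A) : Prop := IsIdempotentElem e ∧
  ∀ a b : A, e * a * e + e * b * e = e → (∃ u, u * (e * a * e) = e) ∨ ∃ u, u * (e * b * e) = e

variable {e : A}

lemma mul_eq_of_mem_span (he : IsIdempotentElem e) {x : A} (hx : x ∈ Submodule.span A {e}) :
    x * e = x := by
  obtain ⟨a, rfl⟩ := Submodule.mem_span_singleton.1 hx
  rw [smul_eq_mul, mul_assoc, he.eq]

/-- The element `e` of `Ae`. -/
def spanGen (e : A) : Submodule.span A {e} := ⟨e, Submodule.mem_span_singleton_self e⟩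

lemma eq_top_of_spanGen_mem {K : Submodule A (Submodule.span A {e})} (h : spanGen e ∈ K) :
    K = ⊤ := by
  rw [eq_top_iff]
  rintro ⟨x, hx⟩ -
  obtain ⟨a, rfl⟩ := Submodule.mem_span_singleton.1 hx
  exact K.smul_mem a h

/-- Write `e` as a sum of elements of `K` and `K'`. Locality of the corner gives one of them a left
inverse there, so that its submodule contains the generator `e`. -/
lemma IsLocalIdempotent.eq_top_or_eq_top (he : IsLocalIdempotent e)
    {K K' : Submodule A (Submodule.span A {e})} (h : K ⊔ K' = ⊤) : K = ⊤ ∨ K' = ⊤ := by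
  obtain ⟨k, hk, k', hk', hkk'⟩ := Submodule.mem_sup.1 (h ▸ Submodule.mem_top : spanGen e ∈ K ⊔ K')
  have hsum : k.1 + k'.1 = e := congrArg Subtype.val hkk'
  have key {L : Submodule A (Submodule.span A {e})} {x : Submodule.span A {e}} (hx : x ∈ L)
      (hu : ∃ u, u * (e * x.1 * e) = e) : L = ⊤ := by
    obtain ⟨u, hu⟩ := hu
    have : spanGen e = (u * e) • x := Subtype.ext (by
      change e = (u * e) * x.1
      rw [mul_assoc e, mul_eq_of_mem_span he.1 x.2, ← mul_assoc] at hu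
      exact hu.symm)
    exact eq_top_of_spanGen_mem (this ▸ L.smul_mem _ hx)
  refine (he.2 k.1 k'.1 ?_).imp (key hk) (key hk')
  rw [← add_mul, ← mul_add, hsum, he.1.eq, he.1.eq]

lemma IsLocalIdempotent.jacobson_eq (he : IsLocalIdempotent e)
    {K : Submodule A (Submodule.span A {e})} (hK : IsCoatom K) :
    Module.jacobson A (Submodule.span A {e}) = K := by
  refine le_antisymm (sInf_le hK) (le_sInf fun K' hK' => ?_)
  by_contra hle
  have h : K ⊔ K' = ⊤ := hK'.2 _ (lt_of_le_of_ne le_sup_right fun h => hle (h ▸ le_sup_left))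
  exact (he.eq_top_or_eq_top h).elim hK.1 hK'.1

/-- The map `a ↦ a • x` sends `Ae` onto the simple module `X`. Its kernel is a maximal submodule,
and the only one is the radical. -/
lemma IsLocalIdempotent.exists_equiv (he : IsLocalIdempotent e) {X : Type*} [AddCommGroup X]
    [Module A X] [IsSimpleModule A X] {x : X} (hx : e • x ≠ 0) :
    Nonempty (X ≃ₗ[A] topModule e) := by
  let g : Submodule.span A {e} →ₗ[A] X := LinearMap.toSpanSingleton A X x ∘ₗ Submodule.subtype _
  have hg : g (spanGen e) = e • x := rfl
  have hne : g ≠ 0 := fun h => hx (by rw [← hg, h, LinearMap.zero_apply])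
  have hsurj : Function.Surjective g := LinearMap.surjective_of_ne_zero hne
  have hcoatom : IsCoatom (LinearMap.ker g) := by
    rw [← isSimpleModule_iff_isCoatom]
    exact IsSimpleModule.congr (g.quotKerEquivOfSurjective hsurj)
  exact ⟨(g.quotKerEquivOfSurjective hsurj).symm.trans
    (Submodule.quotEquivOfEq _ _ (he.jacobson_eq hcoatom).symm)⟩

/-- If `f • x` avoided a maximal submodule it would generate `Ae`, so `e` would factor through `f`.
For `f = e₀` such a factorization makes a summand of `M` a retract of `R`. -/
lemma IsLocalIdempotent.smul_topModule_eq_zero (he : IsLocalIdempotent e) {f : A}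
    (hf : ∀ a b u : A, u * (e * (a * f * b) * e) ≠ e) (x : topModule e) : f • x = 0 := by
  obtain ⟨x, rfl⟩ := Submodule.mkQ_surjective _ x
  refine (Submodule.Quotient.mk_eq_zero (Module.jacobson A (Submodule.span A {e}))
    (x := f • x)).2 ?_
  refine Submodule.mem_sInf.2 fun K hK => ?_
  by_contra hx
  have h : K ⊔ Submodule.span A {f • x} = ⊤ := hK.2 _ (lt_of_le_of_ne le_sup_left fun h =>
    hx (h ▸ Submodule.mem_sup_right (Submodule.mem_span_singleton_self _)))
  have htop := (he.eq_top_or_eq_top h).resolve_left hK.1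
  obtain ⟨a, ha⟩ := Submodule.mem_span_singleton.1 (htop ▸ Submodule.mem_top :
    spanGen e ∈ Submodule.span A {f • x})
  have ha' : a * (f * x.1) = e := congrArg Subtype.val ha
  refine hf a x.1 1 ?_
  rw [one_mul, mul_assoc a, ha', he.1.eq, he.1.eq]

end LocalIdempotent

/-! ### Modules of finite length -/

section FiniteLength

variable {A : Type u} [Ring A]

/-- A class of modules closed under extensions contains a module of finite length if it contains
its simple subquotients. -/
lemma prop_of_isArtinian (T : ObjectProperty (ModuleCat.{u} A)) [T.IsClosedUnderIsomorphisms]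
    [T.ContainsZero] [T.IsClosedUnderExtensions] (X : ModuleCat.{u} A) [IsArtinian A X]
    [IsNoetherian A X] (h : ∀ (K : Submodule A X) (L : Submodule A K),
      IsSimpleModule A (K ⧸ L) → T (ModuleCat.of A (K ⧸ L))) : T X := by
  suffices H : ∀ K : Submodule A X, T (ModuleCat.of A K) from
    T.prop_of_iso (Submodule.topEquiv.toModuleIso : ModuleCat.of A (⊤ : Submodule A X) ≅ X) (H ⊤)
  intro K
  induction K using WellFoundedLT.induction with
  | ind K IH =>
  by_cases hK : K = ⊥
  · subst hK
    exact T.prop_of_isZero (ModuleCat.isZero_of_subsingleton _)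
  have : Nontrivial K := Submodule.nontrivial_iff_ne_bot.2 hK
  obtain ⟨L, hL, -⟩ := (eq_top_or_exists_le_coatom (⊥ : Submodule A K)).resolve_left bot_ne_top
  have hlt : L.map K.subtype < K := by
    refine lt_of_le_of_ne (Submodule.map_subtype_le K L) fun h => hL.1 ?_
    rw [← Submodule.comap_map_eq_of_injective K.injective_subtype L, h, Submodule.comap_subtype_self]
  let S : ShortComplex (ModuleCat.{u} A) := ShortComplex.mk (ModuleCat.ofHom L.subtype)
    (ModuleCat.ofHom L.mkQ) (ModuleCat.hom_ext (LinearMap.exact_subtype_mkQ L).linearMap_comp_eq_zero)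
  have hS : S.ShortExact := ModuleCat.shortComplex_shortExact S (LinearMap.exact_subtype_mkQ L)
    L.injective_subtype L.mkQ_surjective
  exact T.prop_X₂_of_shortExact hS
    (T.prop_of_iso (Submodule.equivMapOfInjective K.subtype K.injective_subtype L).symm.toModuleIso
      (IH _ hlt)) (h K L (isSimpleModule_iff_isCoatom.2 hL))

end FiniteLength

/-! ### `M` as a cyclic projective module over its endomorphism ring -/

section Generators

variable {R : Type u} [CommRing R] {M : Type u} [AddCommGroup M] [Module R M]
  (π : M →ₗ[R] R) {z : M} {e : Module.End R M} {n : ℕ}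
  {Y : Type u} [AddCommGroup Y] [Module (Module.End R M) Y]

/-- The endomorphism `y ↦ π(y)x` of `M`. -/
def rankOne (x : M) : Module.End R M := π.smulRight x

lemma rankOne_apply (x y : M) : rankOne π x y = π y • x := rfl

lemma rankOne_add (x x' : M) : rankOne π (x + x') = rankOne π x + rankOne π x' := by
  ext y
  simp [rankOne_apply]

lemma rankOne_smul (φ : Module.End R M) (x : M) : rankOne π (φ • x) = φ * rankOne π x := by
  ext y
  simp [rankOne_apply]

lemma rankOne_zero : rankOne π (0 : M) = 0 := by
  ext y
  simp [rankOne_apply]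

/-- The map `M^n → Y` of `End(M)`-modules determined by elements `y j` of `Y`. -/
def genMap (y : Fin n → Y) : (Fin n → M) →ₗ[Module.End R M] Y where
  toFun x := ∑ j, rankOne π (x j) • y j
  map_add' x x' := by simp [rankOne_add, add_smul, Finset.sum_add_distrib]
  map_smul' φ x := by simp only [Pi.smul_apply, rankOne_smul, mul_smul, ← Finset.smul_sum]; rfl

lemma genMap_apply (y : Fin n → Y) (x : Fin n → M) :
    genMap π y x = ∑ j, rankOne π (x j) • y j := rfl

variable {π}

lemma eq_rankOne (he : ∀ x, e x = π x • z) : e = rankOne π z := LinearMap.ext he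

lemma genMap_single (he : ∀ x, e x = π x • z) (y : Fin n → Y) (j : Fin n) :
    genMap π y (Pi.single j z) = e • y j := by
  rw [genMap_apply, Finset.sum_eq_single j, Pi.single_eq_same, ← eq_rankOne he]
  · intro i _ hij
    rw [Pi.single_eq_of_ne hij, rankOne_zero, zero_smul]
  · simp

lemma apply_eq_of_rank (hz : π z = 1) (he : ∀ x, e x = π x • z) : e z = z := by
  rw [he, hz, one_smul]

/-- Every `x` in `M` is the image of `z` under a rank-one endomorphism, so `M` is generated by `z`
over `End(M)`. This is the isomorphism `Λe ≅ M` in disguise. -/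
lemma eq_genMap (hz : π z = 1) (g : (Fin n → M) →ₗ[Module.End R M] Y) :
    g = genMap π fun j => g (Pi.single j z) := by
  refine LinearMap.ext fun x => ?_
  have hx : x = ∑ j, rankOne π (x j) • (Pi.single j z : Fin n → M) := by
    conv_lhs => rw [← Finset.univ_sum_single x]
    refine Finset.sum_congr rfl fun j _ => ?_
    rw [← Pi.single_smul]
    congr 1
    change x j = π z • x j
    rw [hz, one_smul]
  conv_lhs => rw [hx, map_sum]
  simp only [map_smul]
  rfl

lemma genMap_hom_ext (hz : π z = 1) {g g' : (Fin n → M) →ₗ[Module.End R M] Y}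
    (h : ∀ j, g (Pi.single j z) = g' (Pi.single j z)) : g = g' := by
  rw [eq_genMap hz g, eq_genMap hz g']
  congr 1
  exact funext h

lemma smul_single_gen (hz : π z = 1) (he : ∀ x, e x = π x • z) (j : Fin n) :
    e • (Pi.single j z : Fin n → M) = Pi.single j z := by
  rw [← Pi.single_smul]
  congr 1
  exact apply_eq_of_rank hz he

/-- The corner `e(M^n)` is the free module `R^n`. -/
def cornerEquiv (hz : π z = 1) (he : ∀ x, e x = π x • z) :
    Corner e (Fin n → M) ≃ₗ[R] (Fin n → R) where
  toFun x j := π (Corner.incl e _ x j)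
  map_add' x y := by
    ext j
    simp
  map_smul' r x := by
    ext j
    change π (r • _) = _
    rw [map_smul]
    rfl
  invFun r := ⟨fun j => r j • z, fun j => r j • z, by
    ext j
    change e (r j • z) = r j • z
    rw [map_smul, apply_eq_of_rank hz he]⟩
  left_inv x := by
    obtain ⟨_, y, rfl⟩ := x
    refine Subtype.ext (funext fun j => ?_)
    change π (e (y j)) • z = e (y j)
    rw [← he, he (y j), map_smul, apply_eq_of_rank hz he]
  right_inv r := by
    ext j
    change π (r j • z) = r j
    rw [map_smul, hz, smul_eq_mul, mul_one]

/-- The element of the corner `e(M^n)` given by the `j`-th generator. -/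
def cornerGen (hz : π z = 1) (he : ∀ x, e x = π x • z) (j : Fin n) : Corner e (Fin n → M) :=
  ⟨Pi.single j z, Pi.single j z, smul_single_gen hz he j⟩

lemma cornerEquiv_gen (hz : π z = 1) (he : ∀ x, e x = π x • z) (j : Fin n) :
    cornerEquiv hz he (cornerGen hz he j) = Pi.single j 1 := by
  ext i
  change π ((Pi.single j z : Fin n → M) i) = _
  by_cases hij : i = j
  · subst hij; simp [hz]
  · simp [Pi.single_eq_of_ne hij]

lemma corner_hom_ext (hz : π z = 1) (he : ∀ x, e x = π x • z) {W : Type*} [AddCommGroup W]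
    [Module R W] {g g' : Corner e (Fin n → M) →ₗ[R] W}
    (h : ∀ j, g (cornerGen hz he j) = g' (cornerGen hz he j)) : g = g' := by
  have : g ∘ₗ (cornerEquiv hz he).symm.toLinearMap = g' ∘ₗ (cornerEquiv hz he).symm.toLinearMap := by
    refine (Pi.basisFun R (Fin n)).ext fun j => ?_
    rw [Pi.basisFun_apply, ← cornerEquiv_gen hz he j]
    simpa using h j
  ext x
  have := LinearMap.congr_fun this (cornerEquiv hz he x)
  simpa using this

/-- Restriction to the corner is a bijection from the maps `M^n → Y` of `End(M)`-modules to the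
maps `e(M^n) → eY` of `R`-modules. -/
lemma cornerMap_injective (hz : π z = 1) (he : ∀ x, e x = π x • z)
    {g g' : (Fin n → M) →ₗ[Module.End R M] Y}
    (h : ∀ x : Corner e (Fin n → M), g (Corner.incl e _ x) = g' (Corner.incl e _ x)) : g = g' :=
  genMap_hom_ext hz fun j => h (cornerGen hz he j)

/-- The surjectivity half of the bijection: a map on the corner is determined by the generators, and
`genMap` with the same values restricts to it because `e` fixes these values. -/
lemma genMap_incl_apply (hz : π z = 1) (he : ∀ x, e x = π x • z) (hee : IsIdempotentElem e)
    (g : Corner e (Fin n → M) →ₗ[R] Corner e Y) (x : Corner e (Fin n → M)) :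
    genMap π (fun j => Corner.incl e Y (g (cornerGen hz he j))) (Corner.incl e _ x) =
      Corner.incl e Y (g x) := by
  let g' : Corner e (Fin n → M) →ₗ[R] Corner e Y := Corner.map R e
    (genMap π fun j => Corner.incl e Y (g (cornerGen hz he j)))
  have : g' = g := corner_hom_ext hz he fun j => Corner.incl_injective e (by
    change genMap π (fun j => Corner.incl e Y (g (cornerGen hz he j))) (Pi.single j z) = _
    rw [genMap_single he, Corner.smul_incl hee])
  exact congrArg (Corner.incl e Y) (LinearMap.congr_fun this x)

end Generators

/-! ### Relatively projective modules -/

section RelativelyProjective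

variable {R : Type u} [CommRing R] {M : Type u} [AddCommGroup M] [Module R M] [Module.Finite R M]
  {π : M →ₗ[R] R} {z : M} {e : Module.End R M} (hee : IsIdempotentElem e)

/-- Maps out of `M^n` amount to `n` elements of `eY`, which lift along surjections. Maps out of the
corner, which is `R^n`, amount to the same data. -/
lemma isRelativelyProjective_pi (hz : π z = 1) (he : ∀ x, e x = π x • z) (n : ℕ) :
    IsRelativelyProjective (cornerFunctor.{u, u} R hee) (finitelyGenerated (Module.End R M))
      (ModuleCat.of (Module.End R M) (Fin n → M)) where
  mem := by
    have : Module.Finite (Module.End R M) M := Module.Finite.of_restrictScalars_finite R _ _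
    exact inferInstanceAs (Module.Finite (Module.End R M) (Fin n → M))
  projective := by
    rw [← IsProjective.iff_projective]
    refine Module.Projective.of_lifting_property'' fun f hf => ?_
    choose y hy using fun j : Fin n => hf (Pi.single j z)
    refine ⟨genMap π y, genMap_hom_ext hz fun j => ?_⟩
    change f (genMap π y (Pi.single j z)) = Pi.single j z
    rw [genMap_single he, map_smul, hy]
    exact smul_single_gen hz he j
  projective_obj := ModuleCat.projective_of_free
    ((Pi.basisFun R (Fin n)).map (cornerEquiv hz he).symm)
  homBijective Y _ := by
    constructor
    · intro g g' h
      refine ModuleCat.hom_ext (cornerMap_injective hz he fun x => ?_)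
      have := LinearMap.congr_fun (congrArg ModuleCat.Hom.hom h) x
      exact congrArg (Corner.incl e Y) this
    · intro g
      refine ⟨ModuleCat.ofHom (genMap π fun j => Corner.incl e Y (g.hom (cornerGen hz he j))), ?_⟩
      refine ModuleCat.hom_ext (LinearMap.ext fun x => Corner.incl_injective e ?_)
      exact genMap_incl_apply hz he hee g.hom x

lemma exists_isRelativelyProjective (hz : π z = 1) (he : ∀ x, e x = π x • z)
    (W : ModuleCat.{u} R) (hW : finitelyGenerated R W) :
    ∃ (N : ModuleCat.{u} (Module.End R M)) (ρ : (cornerFunctor R hee).obj N ⟶ W),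
      IsRelativelyProjective (cornerFunctor R hee) (finitelyGenerated (Module.End R M)) N ∧
        Epi ρ := by
  have : Module.Finite R W := hW
  obtain ⟨n, f, hf⟩ := Module.Finite.exists_fin' R W
  refine ⟨_, ModuleCat.ofHom (f ∘ₗ (cornerEquiv hz he).toLinearMap),
    isRelativelyProjective_pi hee hz he n, ?_⟩
  exact (ModuleCat.epi_iff_surjective _).2 (hf.comp (cornerEquiv hz he).surjective)

end RelativelyProjective

/-! ### Modules supported at the maximal ideal -/

lemma exists_pow_le_of_forall_minimalPrimes {R : Type*} [CommRing R] [IsNoetherianRing R]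
    {m J : Ideal R} (h : ∀ p ∈ J.minimalPrimes, m ≤ p) : ∃ s, m ^ s ≤ J := by
  refine Ideal.exists_pow_le_of_le_radical_of_fg ?_ (IsNoetherian.noetherian m)
  rw [← Ideal.sInf_minimalPrimes]
  exact le_sInf h

/-- The ideal of the elements of `R` which annihilate the `A`-module `X`, for an `R`-algebra
`A`. -/
def scalarAnnihilator (R : Type*) [CommRing R] (A : Type*) [Ring A] [Algebra R A] (X : Type*)
    [AddCommGroup X] [Module A X] : Ideal R := (Module.annihilator A X).comap (algebraMap R A)

lemma mem_scalarAnnihilator {R : Type*} [CommRing R] {A : Type*} [Ring A] [Algebra R A] {X : Type*}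
    [AddCommGroup X] [Module A X] {r : R} :
    r ∈ scalarAnnihilator R A X ↔ ∀ x : X, algebraMap R A r • x = 0 := Module.mem_annihilator

/-- The ideal `m` lies in the radical of the annihilator, so some power of it kills `X`, which is
finite over `R` because `A` is. -/
lemma isArtinian_of_forall_minimalPrimes {R : Type*} [CommRing R] [IsNoetherianRing R] {A : Type*}
    [Ring A] [Algebra R A] [Module.Finite R A] (m : Ideal R) [m.IsMaximal] (X : Type*)
    [AddCommGroup X] [Module A X] [Module.Finite A X]
    (h : ∀ p ∈ (scalarAnnihilator R A X).minimalPrimes, m ≤ p) : IsArtinian A X := by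
  let _ : Module R X := Module.compHom X (algebraMap R A)
  have : IsScalarTower R A X := ⟨fun r a x => by
    change (r • a) • x = algebraMap R A r • (a • x)
    rw [Algebra.smul_def, mul_smul]⟩
  have : Module.Finite R X := Module.Finite.trans A X
  obtain ⟨s, hs⟩ := exists_pow_le_of_forall_minimalPrimes h
  have : IsArtinian R X := isArtinian_of_pow_le_annihilator m X s fun r hr =>
    Module.mem_annihilator.2 (mem_scalarAnnihilator.1 (hs hr))
  exact isArtinian_of_tower R this

/-! ### Summands of `M` and retracts of `R` -/

section Summand

variable {R : Type*} [CommRing R] {M N : Type*} [AddCommGroup M] [Module R M] [AddCommGroup N]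
  [Module R N] {α : N →ₗ[R] M} {β : M →ₗ[R] N} {e : Module.End R M}

/-- Through `α` and `β`, the corner of `End(M)` at `e` is the ring `End(N)`. -/
lemma isLocalIdempotent_of_summand (hβα : ∀ x, β (α x) = x) (he : ∀ x, e x = α (β x))
    (hN : ∀ f : Module.End R N, IsUnit f ∨ IsUnit (1 - f)) : IsLocalIdempotent e := by
  have hee : IsIdempotentElem e := LinearMap.ext fun x => by
    change e (e x) = e x
    rw [he, he, hβα]
  refine ⟨hee, fun a b hab => ?_⟩
  have key (c : Module.End R M) (hc : IsUnit (β ∘ₗ c ∘ₗ α : Module.End R N)) :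
      ∃ u, u * (e * c * e) = e := by
    obtain ⟨w, hw⟩ := hc.exists_left_inv
    refine ⟨α ∘ₗ w ∘ₗ β, LinearMap.ext fun x => ?_⟩
    change α (w (β (e (c (e x))))) = e x
    rw [he, he, hβα]
    exact congrArg α (LinearMap.congr_fun hw (β x))
  refine (hN (β ∘ₗ a ∘ₗ α)).imp (key a) fun h => key b ?_
  convert h using 1
  ext x
  have := congrArg β (LinearMap.congr_fun hab (α x))
  change β (e (a (e (α x))) + e (b (e (α x)))) = β (e (α x)) at this
  rw [map_add, he (a _), he (b _), he, hβα, hβα, hβα] at this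
  change β (b (α x)) = x - β (a (α x))
  rw [eq_sub_iff_add_eq', this, hβα]

/-- The composite `h ∘ g` is multiplication by the idempotent `h (g 1)`, which cannot be zero since
`N` is nonzero. The equation in `hr` is kept so that the graded case can use the degree of this
element. -/
lemma comp_eq_id_of_retract [Nontrivial N] {h : N →ₗ[R] R} {g : R →ₗ[R] N}
    (hgh : ∀ x, g (h x) = x) (hr : ∀ r, r = h (g 1) → r * r = r → r = 0 ∨ r = 1) (r : R) :
    h (g r) = r := by
  have hlin (r : R) : h (g r) = r * h (g 1) := by
    rw [← smul_eq_mul, ← map_smul, ← map_smul, smul_eq_mul, mul_one]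
  rcases hr _ rfl (by rw [← hlin, hgh]) with h0 | h1
  · obtain ⟨x, hx⟩ := exists_ne (0 : N)
    refine (hx ?_).elim
    have := hlin (h x)
    rw [hgh, h0, mul_zero] at this
    rw [← hgh x, this, map_zero]
  · rw [hlin, h1, mul_one]

lemma isEmpty_retract_of_isLocalRing [IsLocalRing R] [Nontrivial N] (hN : IsEmpty (N ≃ₗ[R] R))
    (h : N →ₗ[R] R) (g : R →ₗ[R] N) : ∃ x, g (h x) ≠ x := by
  by_contra! hgh
  refine hN.false (LinearEquiv.ofLinearMap h g (LinearMap.ext fun r => ?_) (LinearMap.ext hgh))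
  refine comp_eq_id_of_retract hgh (fun r _ hrr => ?_) r
  have h0 : r * (1 - r) = 0 := by rw [mul_sub, hrr, mul_one, sub_self]
  rcases IsLocalRing.isUnit_or_isUnit_one_sub_self r with hu | hu
  · exact Or.inr (sub_eq_zero.1 (hu.mul_right_eq_zero.1 h0)).symm
  · exact Or.inl (hu.mul_left_eq_zero.1 h0)

end Summand

lemma finitelyGenerated_topModule {A : Type u} [Ring A] (e : A) :
    finitelyGenerated A (topModule e) :=
  Module.Finite.of_surjective (Submodule.mkQ (Module.jacobson A (Submodule.span A {e})))
    (Submodule.mkQ_surjective _)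

/-! ### The complete case -/

section CompleteCase

variable (R : Type u) [CommRing R] {l : ℕ} (N : Fin l → Type u) [∀ i, AddCommGroup (N i)]
  [∀ i, Module R (N i)]

lemma e₀_add_sum_idem (x : Total R N) : e₀ R N x + ∑ i, idem R N i x = x := by
  refine Prod.ext ?_ ?_
  · rw [Prod.fst_add, Prod.fst_sum]
    change x.1 + ∑ i : Fin l, (0 : R) = x.1
    simp
  · rw [Prod.snd_add, Prod.snd_sum]
    change 0 + ∑ i, Pi.single i (x.2 i) = x.2
    rw [zero_add, Finset.univ_sum_single]

lemma isZero_cornerFunctor_iff {A : Type u} [Ring A] [Algebra R A] {e : A}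
    (he : IsIdempotentElem e) (X : ModuleCat.{v} A) :
    IsZero ((cornerFunctor R he).obj X) ↔ ∀ x : X, e • x = 0 := by
  rw [ModuleCat.isZero_iff_subsingleton]
  constructor
  · intro h x
    obtain ⟨y, hy⟩ := Corner.exists_incl_eq e x
    have : y = 0 := Subsingleton.elim (α := (cornerFunctor R he).obj X) y 0
    rw [← hy, this, map_zero]
  · intro h
    refine ⟨fun x y => Corner.incl_injective e ?_⟩
    rw [← Corner.smul_incl he x, ← Corner.smul_incl he y, h, h]

variable [IsLocalRing R] [IsNoetherianRing R] [IsAdicComplete (IsLocalRing.maximalIdeal R) R]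
  [∀ i, Module.Finite R (N i)]

variable {R N} in
lemma isLocalIdempotent_idem (hN : ∀ i, IsIndecomposableModule R (N i)) (i : Fin l) :
    IsLocalIdempotent (idem R N i) :=
  isLocalIdempotent_of_summand (α := LinearMap.inr R R (∀ i, N i) ∘ₗ LinearMap.single R N i)
    (β := LinearMap.proj i ∘ₗ LinearMap.snd R R (∀ i, N i)) (fun x => Pi.single_eq_same i x)
    (fun _ => rfl) (hN i).isUnit_or_isUnit_one_sub

variable {R N} in
-- A factorization of the idempotent of `N i` through `e₀` would make `N i` a retract of `R`, hence
-- isomorphic to `R`, as a local ring has only trivial idempotents.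
lemma e₀_smul_simpleModule (hN : ∀ i, IsIndecomposableModule R (N i))
    (hNR : ∀ i, IsEmpty (N i ≃ₗ[R] R)) (i : Fin l) (x : simpleModule R N i) :
    e₀ R N • x = 0 := by
  refine (isLocalIdempotent_idem hN i).smul_topModule_eq_zero (fun a b u h => ?_) x
  have := (hN i).1
  let α := LinearMap.inr R R (∀ i, N i) ∘ₗ LinearMap.single R N i
  let β := LinearMap.proj i ∘ₗ LinearMap.snd R R (∀ i, N i)
  obtain ⟨y, hy⟩ := isEmpty_retract_of_isLocalRing (hNR i)
    (LinearMap.fst R R _ ∘ₗ b ∘ₗ idem R N i ∘ₗ α)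
    (β ∘ₗ u ∘ₗ idem R N i ∘ₗ a ∘ₗ LinearMap.inl R R _)
  refine hy ((congrArg β (LinearMap.congr_fun h (α y))).trans ?_)
  exact Pi.single_eq_same i ((Pi.single i y : ∀ i, N i) i) |>.trans (Pi.single_eq_same i y)

variable {R N} in
-- At a prime other than the maximal ideal the `N i` are projective, so `X` vanishes there and has
-- finite length. On a simple subquotient `e₀` is zero, so some other summand idempotent acts
-- nontrivially and identifies it.
lemma prop_of_e₀_smul_eq_zero (hR : IsGorenstein R)
    (hsing : HasIsolatedSingularity (IsLocalRing.maximalIdeal R))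
    (hCM : ∀ i, IsMaximalCohenMacaulay (IsLocalRing.maximalIdeal R) (N i))
    (hN : ∀ i, IsIndecomposableModule R (N i)) (T : ObjectProperty (ModuleCat.{u} (Lam R N)))
    [T.IsClosedUnderIsomorphisms] [T.ContainsZero] [T.IsClosedUnderExtensions]
    (hT : ∀ i, T (simpleModule R N i)) (X : ModuleCat.{u} (Lam R N)) [Module.Finite (Lam R N) X]
    (hX : ∀ x : X, e₀ R N • x = 0) : T X := by
  have : IsArtinian (Lam R N) X := by
    refine isArtinian_of_forall_minimalPrimes (IsLocalRing.maximalIdeal R) X fun p hp => ?_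
    by_contra hpm
    have := hp.1.1
    have := hsing p fun h => hpm h.ge
    obtain ⟨s, hs, hsX⟩ := exists_notMem_forall_smul_eq_zero (π := LinearMap.fst R R (∀ i, N i))
      (z := (1, 0)) (e := e₀ R N) rfl (fun x => by
        refine Prod.ext ?_ ?_
        · exact (mul_one _).symm
        · exact (smul_zero _).symm) hX
      (fun i => LinearMap.inr R R (∀ i, N i) ∘ₗ LinearMap.single R N i)
      (fun i => LinearMap.proj i ∘ₗ LinearMap.snd R R (∀ i, N i)) (e₀_add_sum_idem R N)
      (p := p) fun i => (hCM i).isLocallyProjective hR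
        (IsLocalRing.le_maximalIdeal hp.1.1.ne_top)
    exact hs (hp.1.2 (mem_scalarAnnihilator.2 hsX))
  refine prop_of_isArtinian T X fun K L hKL => ?_
  have hQ (x : K ⧸ L) : e₀ R N • x = 0 := by
    obtain ⟨x, rfl⟩ := L.mkQ_surjective x
    rw [← map_smul, show e₀ R N • x = 0 from Subtype.ext (hX x.1), map_zero]
  have : Nontrivial (K ⧸ L) := IsSimpleModule.nontrivial (Lam R N) _
  obtain ⟨x, hx⟩ := exists_ne (0 : K ⧸ L)
  have hone : (1 : Lam R N) = e₀ R N + ∑ i, idem R N i := by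
    refine LinearMap.ext fun x => ?_
    rw [LinearMap.add_apply, LinearMap.sum_apply]
    exact (e₀_add_sum_idem R N x).symm
  obtain ⟨i, hi⟩ : ∃ i, idem R N i • x ≠ 0 := by
    by_contra! h
    refine hx ?_
    rw [← one_smul (Lam R N) x, hone, add_smul, hQ, Finset.sum_smul, zero_add]
    exact Finset.sum_eq_zero fun i _ => h i
  obtain ⟨f⟩ := (isLocalIdempotent_idem hN i).exists_equiv hi
  exact T.prop_of_iso f.symm.toModuleIso (hT i)

variable {R N} in
theorem verdierLift_xi (hR : IsGorenstein R)
    (hsing : HasIsolatedSingularity (IsLocalRing.maximalIdeal R))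
    (hCM : ∀ i, IsMaximalCohenMacaulay (IsLocalRing.maximalIdeal R) (N i))
    (hN : ∀ i, IsIndecomposableModule R (N i)) (hNR : ∀ i, IsEmpty (N i ≃ₗ[R] R))
    [HasDerivedCategory.{w₁} (ModuleCat.{u} (Lam R N))]
    [HasDerivedCategory.{w₂} (ModuleCat.{u} R)] :
    ∃ h : (triangulatedSpan (simples R N)).trW.IsInvertedBy (Xi R N),
      (verdierLift (simples R N) (Xi R N) h).IsTriangulated ∧
      (verdierLift (simples R N) (Xi R N) h).IsEquivalence := by
  refine verdierLift_boundedDerivedMap _ (fun i => ?_) (fun i => ?_) (fun T _ _ _ hT X hX h0 => ?_)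
    (fun W hW => ?_)
  · exact finitelyGenerated_topModule _
  · exact (isZero_cornerFunctor_iff R _ _).2 (e₀_smul_simpleModule hN hNR i)
  · have : Module.Finite (Lam R N) X := hX
    exact prop_of_e₀_smul_eq_zero hR hsing hCM hN T hT X ((isZero_cornerFunctor_iff R _ _).1 h0)
  · exact exists_isRelativelyProjective (π := LinearMap.fst R R (∀ i, N i)) (z := (1, 0))
      (isIdempotentElem_e₀ R N) rfl (fun x => Prod.ext (mul_one _).symm (smul_zero _).symm) W hW

end CompleteCase

/-! ### Graded modules: isomorphisms, simplicity and finite length -/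

namespace GrMod

section General

variable {A : Type u} [Ring A] {𝒜 : ℤ → AddSubgroup A} {X Y : GrMod.{u, v} 𝒜}

lemma mono_of_injective (f : X ⟶ Y) (hf : Function.Injective f.lin) : Mono f where
  right_cancellation _ _ w := hom_ext (LinearMap.ext fun x =>
    hf (LinearMap.congr_fun (congrArg Hom.lin w) x))

lemma epi_of_surjective (f : X ⟶ Y) (hf : Function.Surjective f.lin) : Epi f where
  left_cancellation _ _ w := hom_ext (LinearMap.ext fun y => by
    obtain ⟨x, rfl⟩ := hf y
    exact LinearMap.congr_fun (congrArg Hom.lin w) x)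

/-- A bijective morphism of graded modules is an isomorphism. -/
def isoOfBijective (f : X ⟶ Y) (hf : Function.Bijective f.lin) : X ≅ Y :=
  have := mono_of_injective f hf.1
  have := epi_of_surjective f hf.2
  have := isIso_of_mono_of_epi f
  asIso f

lemma isZero_iff_subsingleton : IsZero X ↔ Subsingleton X := by
  rw [IsZero.iff_id_eq_zero]
  constructor
  · intro h
    exact ⟨fun x y => (LinearMap.congr_fun (congrArg Hom.lin h) x).trans
      (LinearMap.congr_fun (congrArg Hom.lin h) y).symm⟩
  · intro h
    exact hom_ext (LinearMap.ext fun x => Subsingleton.elim _ _)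

lemma isHomogeneous_sup {K L : Submodule A X} (hK : X.IsHomogeneous K) (hL : X.IsHomogeneous L) :
    X.IsHomogeneous (K ⊔ L) := fun i x hx => by
  obtain ⟨k, hk, l, hl, rfl⟩ := Submodule.mem_sup.1 hx
  rw [map_add]
  exact Submodule.add_mem_sup (hK i k hk) (hL i l hl)

lemma isHomogeneous_comap (f : X ⟶ Y) {K : Submodule A Y} (hK : Y.IsHomogeneous K) :
    X.IsHomogeneous (K.comap f.lin) := fun i x hx => by
  rw [Submodule.mem_comap] at hx ⊢
  rw [← Hom.proj_apply]
  exact hK i _ hx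

lemma isHomogeneous_map (f : X ⟶ Y) {K : Submodule A X} (hK : X.IsHomogeneous K) :
    Y.IsHomogeneous (K.map f.lin) := by
  rintro i _ ⟨x, hx, rfl⟩
  exact ⟨X.proj i x, hK i x hx, (Hom.proj_apply f i x).symm⟩

lemma exists_mem_deg_of_surjective (f : X ⟶ Y) (hf : Function.Surjective f.lin) {d : ℤ} {y : Y}
    (hy : y ∈ Y.deg d) : ∃ x ∈ X.deg d, f.lin x = y := by
  obtain ⟨x, rfl⟩ := hf y
  exact ⟨X.proj d x, X.proj_mem d x, by rw [← Hom.proj_apply, Y.proj_of_mem d _ hy]⟩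

lemma exists_proj_ne_zero {x : X} (hx : x ≠ 0) : ∃ d, X.proj d x ≠ 0 := by
  by_contra! h
  exact hx (X.mem_of_proj ⊥ x fun i => h i)

/-- The inclusion of a homogeneous submodule. -/
def subIncl (X : GrMod.{u, v} 𝒜) (K : Submodule A X) (hK : X.IsHomogeneous K) : X.sub K hK ⟶ X where
  lin := K.subtype
  map_mem _ _ h := h

/-- The projection to the quotient by a homogeneous submodule. -/
def quotProj (X : GrMod.{u, v} 𝒜) (K : Submodule A X) (hK : X.IsHomogeneous K) :
    X ⟶ X.quot K hK where
  lin := K.mkQ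
  map_mem _ x h := ⟨x, h, rfl⟩

lemma quotProj_eq_zero_iff {K : Submodule A X} {hK : X.IsHomogeneous K} {x : X} :
    (X.quotProj K hK).lin x = 0 ↔ x ∈ K := Submodule.Quotient.mk_eq_zero K

lemma quotProj_surjective (K : Submodule A X) (hK : X.IsHomogeneous K) :
    Function.Surjective (X.quotProj K hK).lin := K.mkQ_surjective

/-- A nonzero graded module without nontrivial homogeneous submodules. -/
def IsSimple (X : GrMod.{u, v} 𝒜) : Prop :=
  Nontrivial X ∧ ∀ K : Submodule A X, X.IsHomogeneous K → K = ⊥ ∨ K = ⊤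

/-- The inclusion of homogeneous submodules. -/
def subInclusion {K L : Submodule A X} (hK : X.IsHomogeneous K) (hL : X.IsHomogeneous L)
    (h : L ≤ K) : X.sub L hL ⟶ X.sub K hK where
  lin := Submodule.inclusion h
  map_mem _ _ hx := hx

/-- A class of graded modules closed under extensions contains a graded module of finite length if
it contains its simple subquotients. -/
lemma prop_of_isArtinian (T : ObjectProperty (GrMod.{u, v} 𝒜)) [T.IsClosedUnderIsomorphisms]
    [T.ContainsZero] [T.IsClosedUnderExtensions] (X : GrMod.{u, v} 𝒜) [IsArtinian A X]
    [IsNoetherian A X] (h : ∀ (K : Submodule A X) (hK : X.IsHomogeneous K)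
      (L : Submodule A (X.sub K hK)) (hL : (X.sub K hK).IsHomogeneous L),
      ((X.sub K hK).quot L hL).IsSimple → T ((X.sub K hK).quot L hL)) : T X := by
  suffices H : ∀ (K : Submodule A X) (hK : X.IsHomogeneous K), T (X.sub K hK) from
    T.prop_of_iso (isoOfBijective (X.subIncl ⊤ fun _ _ _ => trivial)
      ⟨Subtype.val_injective, fun x => ⟨⟨x, trivial⟩, rfl⟩⟩) (H ⊤ fun _ _ _ => trivial)
  intro K
  induction K using WellFoundedLT.induction with
  | ind K IH =>
  intro hK
  by_cases hbot : K = ⊥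
  · subst hbot
    refine T.prop_of_isZero (isZero_iff_subsingleton.2 ?_)
    exact inferInstanceAs (Subsingleton (⊥ : Submodule A X))
  have hbotH : X.IsHomogeneous (⊥ : Submodule A X) := fun i x hx => by
    rw [(Submodule.mem_bot A).1 hx, map_zero]
    exact zero_mem _
  -- A homogeneous submodule maximal among those strictly inside `K`, so that the quotient has no
  -- nontrivial homogeneous submodules.
  obtain ⟨L, ⟨hLH, hLK⟩, hLmax⟩ := (wellFounded_gt (α := Submodule A X)).has_min
    {L : Submodule A X | X.IsHomogeneous L ∧ L < K} ⟨⊥, hbotH, bot_lt_iff_ne_bot.2 hbot⟩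
  have hL' := isHomogeneous_comap (X.subIncl K hK) hLH
  let S : ShortComplex (GrMod.{u, v} 𝒜) := ShortComplex.mk (subInclusion hK hLH hLK.le)
    ((X.sub K hK).quotProj _ hL') (hom_ext (LinearMap.ext fun x =>
      quotProj_eq_zero_iff.2 x.2))
  have hS : S.ShortExact := by
    refine shortExact_of_exact S (Submodule.inclusion_injective hLK.le) (fun x => ?_)
      (quotProj_surjective _ hL')
    constructor
    · intro hx
      exact ⟨⟨x.1, (quotProj_eq_zero_iff (hK := hL')).1 hx⟩, rfl⟩
    · rintro ⟨y, rfl⟩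
      exact (quotProj_eq_zero_iff (hK := hL')).2 y.2
  refine T.prop_X₂_of_shortExact hS (IH L hLK hLH) (h K hK _ hL' ⟨?_, fun U hU => ?_⟩)
  · obtain ⟨x, hxK, hxL⟩ := SetLike.exists_of_lt hLK
    exact nontrivial_of_ne (((X.sub K hK).quotProj _ hL').lin (⟨x, hxK⟩ : K)) 0 fun h =>
      hxL ((quotProj_eq_zero_iff (hK := hL')).1 h)
  -- The preimage of `U` in `X` lies between `L` and `K`; by maximality of `L` it is one of the two.
  · let V : Submodule A X :=
      (U.comap ((X.sub K hK).quotProj _ hL').lin).map (X.subIncl K hK).lin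
    have hV : X.IsHomogeneous V := isHomogeneous_map _ (isHomogeneous_comap _ hU)
    have hVK : V ≤ K := by
      rintro _ ⟨x, -, rfl⟩
      exact x.2
    have hLV : L ≤ V := fun x hx => by
      refine ⟨(⟨x, hLK.le hx⟩ : K), ?_, rfl⟩
      have h0 : ((X.sub K hK).quotProj _ hL').lin (⟨x, hLK.le hx⟩ : K) = 0 :=
        (quotProj_eq_zero_iff (hK := hL')).2 hx
      exact Submodule.mem_comap.2 (h0 ▸ zero_mem U)
    by_cases hVe : V = K
    · refine Or.inr (eq_top_iff.2 fun q _ => ?_)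
      obtain ⟨x, rfl⟩ := quotProj_surjective _ hL' q
      obtain ⟨y, hy, hyx⟩ := (hVe.ge x.2 : x.1 ∈ V)
      have hyx' : y = x := Subtype.ext hyx
      exact hyx' ▸ Submodule.mem_comap.1 hy
    · refine Or.inl (eq_bot_iff.2 fun q hq => ?_)
      obtain ⟨x, rfl⟩ := quotProj_surjective _ hL' q
      have hVL : V ≤ L := by
        by_contra hne
        exact hLmax V ⟨hV, lt_of_le_of_ne hVK hVe⟩ (lt_of_le_not_ge hLV hne)
      exact (Submodule.mem_bot A).2 ((quotProj_eq_zero_iff (hK := hL')).2 (hVL ⟨x, hq, rfl⟩))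

end General

end GrMod

/-! ### Graded local idempotents and their simple modules -/

namespace GrMod

section Shift

variable {A : Type u} [Ring A] {𝒜 : ℤ → AddSubgroup A} (X : GrMod.{u, v} 𝒜)

lemma proj_shift (n i : ℤ) (x : X) : (X.shift n).proj i x = X.proj (n + i) x := by
  refine DFunLike.congr_fun ((X.shift n).induction_proj ((X.shift n).proj i) (X.proj (n + i))
    fun j y hy => ?_) x
  by_cases hij : i = j
  · subst hij
    exact ((X.shift n).proj_of_mem i y hy).trans (X.proj_of_mem (n + i) y hy).symm
  · exact ((X.shift n).proj_of_mem_ne i j hij y hy).trans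
      (X.proj_of_mem_ne (n + i) (n + j) (by simpa using hij) y hy).symm

variable {X} in
lemma isHomogeneous_of_shift {n : ℤ} {K : Submodule A X} (hK : (X.shift n).IsHomogeneous K) :
    X.IsHomogeneous K := fun i x hx => by
  have := hK (i - n) x hx
  rwa [proj_shift, add_sub_cancel] at this

variable {X} in
lemma isHomogeneous_shift {n : ℤ} {K : Submodule A X} (hK : X.IsHomogeneous K) :
    (X.shift n).IsHomogeneous K := fun i x hx => by
  exact (X.proj_shift n i x).symm ▸ hK (n + i) x hx

end Shift

section Top

variable {R : Type u} [CommRing R] {𝓡 : ℤ → AddSubgroup R} [GradedRing 𝓡] {M : GrMod.{u, u} 𝓡}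
  [Module.Finite R M] {e : M ⟶ M}

/-- The degree `0` part of the corner ring `eΛe`, with `Λ = End(M)`, is local: if a sum of
two elements is the unit element `e`, then one of the two has a left inverse. -/
def IsLocalIdempotent (e : M ⟶ M) : Prop := IsIdempotentElem (M := Module.End R M) e.lin ∧
  ∀ a ∈ M.endDeg 0, ∀ b ∈ M.endDeg 0, ((e.lin : Module.End R M) * a * e.lin + e.lin * b * e.lin :
    Module.End R M) = e.lin → (∃ u : Module.End R M, u * (e.lin * a * e.lin) = e.lin) ∨
      ∃ u : Module.End R M, u * (e.lin * b * e.lin) = e.lin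

/-- The action of `Λ = End(M)` on a homogeneous element of a graded `Λ`-module. -/
def orbitMap {X : GrMod.{u, u} M.endDeg} {d : ℤ} {x : X} (hx : x ∈ X.deg d) :
    M.endSelf.shift (-d) ⟶ X where
  lin := LinearMap.toSpanSingleton (Module.End R M) X x
  map_mem i a ha := by
    have := X.smul_mem _ _ a ha x hx
    rwa [neg_add_cancel_comm] at this

lemma isHomogeneous_span_singleton {X : GrMod.{u, u} M.endDeg} {d : ℤ} {x : X}
    (hx : x ∈ X.deg d) : X.IsHomogeneous (Submodule.span (Module.End R M) {x}) := by
  have := isHomogeneous_range (orbitMap hx)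
  rwa [show LinearMap.range (orbitMap hx).lin = Submodule.span (Module.End R M) {x} from
    LinearMap.range_toSpanSingleton _] at this

/-- The orbit map of a homogeneous element is a graded morphism, so a coefficient may be replaced by
its component of degree `i - d`. -/
lemma exists_mem_endDeg_smul_eq {X : GrMod.{u, u} M.endDeg} {d i : ℤ} {x y : X}
    (hx : x ∈ X.deg d) (hy : y ∈ X.deg i) (hxy : y ∈ Submodule.span (Module.End R M) {x}) :
    ∃ a ∈ M.endDeg (i - d), a • x = y := by
  obtain ⟨a, rfl⟩ := Submodule.mem_span_singleton.1 hxy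
  refine ⟨(M.endSelf.shift (-d)).proj i a, ?_, ?_⟩
  · have h : (M.endSelf.shift (-d)).proj i a ∈ M.endDeg (-d + i) :=
      (M.endSelf.shift (-d)).proj_mem i a
    rwa [neg_add_eq_sub] at h
  · exact ((orbitMap hx).proj_apply i a).symm.trans (X.proj_of_mem i _ hy)

/-- The element `e` of `Λe`. -/
def projGen (e : M ⟶ M) : M.endProj e :=
  (⟨e.lin, (1 : Module.End R M), one_smul (Module.End R M) (e.lin : Module.End R M)⟩ :
    LinearMap.range (M.endMulRight e).lin)

lemma projGen_mem (e : M ⟶ M) : projGen e ∈ (M.endProj e).deg 0 := M.mem_endDeg_zero e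

/-- The inclusion of `Λe` into `Λ`. -/
def projIncl (e : M ⟶ M) : M.endProj e ⟶ M.endSelf := M.endSelf.subIncl _ _

lemma projIncl_injective (e : M ⟶ M) : Function.Injective (projIncl e).lin :=
  Subtype.val_injective

/-- The endomorphism of `M` given by an element of `Λe`. -/
def projVal (x : M.endProj e) : Module.End R M := (projIncl e).lin x

lemma projVal_mem {x : M.endProj e} {d : ℤ} (hx : x ∈ (M.endProj e).deg d) :
    projVal x ∈ M.endDeg d := hx

lemma projVal_injective : Function.Injective (projVal (e := e)) := projIncl_injective e

lemma projVal_gen : projVal (projGen e) = e.lin := rfl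

lemma projVal_smul (a : Module.End R M) (x : M.endProj e) : projVal (a • x) = a * projVal x := rfl

lemma projVal_add (x y : M.endProj e) : projVal (x + y) = projVal x + projVal y := rfl

lemma exists_smul_projGen (x : M.endProj e) : ∃ a : Module.End R M, a • projGen e = x := by
  obtain ⟨_, a, rfl⟩ := x
  exact ⟨a, rfl⟩

lemma projVal_mul (he : IsIdempotentElem (M := Module.End R M) e.lin) (x : M.endProj e) :
    projVal x * e.lin = projVal x := by
  obtain ⟨a, rfl⟩ := exists_smul_projGen x
  rw [projVal_smul, projVal_gen, mul_assoc]
  exact congrArg (a * ·) he.eq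

lemma eq_top_of_projGen_mem {K : Submodule (Module.End R M) (M.endProj e)}
    (h : projGen e ∈ K) : K = ⊤ := by
  refine eq_top_iff.2 fun x _ => ?_
  obtain ⟨a, rfl⟩ := exists_smul_projGen x
  exact K.smul_mem a h

/-- The generator `e` has degree zero, so the decomposition of `e` can be projected to degree zero.
Hence only the degree zero part of the corner ring has to be local. -/
lemma IsLocalIdempotent.eq_top_or_eq_top (he : IsLocalIdempotent e)
    {K K' : Submodule (Module.End R M) (M.endProj e)} (hK : (M.endProj e).IsHomogeneous K)
    (hK' : (M.endProj e).IsHomogeneous K') (h : K ⊔ K' = ⊤) : K = ⊤ ∨ K' = ⊤ := by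
  obtain ⟨k₁, hk₁, k₁', hk₁', hkk₁⟩ :=
    Submodule.mem_sup.1 (h ▸ Submodule.mem_top : projGen e ∈ K ⊔ K')
  obtain ⟨k, hk, hk0, k', hk', hk0', hkk'⟩ : ∃ k ∈ K, k ∈ (M.endProj e).deg 0 ∧
      ∃ k' ∈ K', k' ∈ (M.endProj e).deg 0 ∧ k + k' = projGen e :=
    ⟨_, hK 0 _ hk₁, proj_mem _ _ _, _, hK' 0 _ hk₁', proj_mem _ _ _, by
      rw [← map_add, hkk₁, proj_of_mem _ _ _ (projGen_mem e)]⟩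
  have hsum : projVal k + projVal k' = e.lin := by
    rw [← projVal_add, hkk', projVal_gen]
  have key {L : Submodule (Module.End R M) (M.endProj e)} {x : M.endProj e} (hx : x ∈ L)
      (hu : ∃ u : Module.End R M, u * (e.lin * projVal x * e.lin) = e.lin) : L = ⊤ := by
    obtain ⟨u, hu⟩ := hu
    have : projGen e = (u * (e.lin : Module.End R M)) • x := projVal_injective (by
      rw [projVal_smul, projVal_gen]
      refine hu.symm.trans ?_
      rw [mul_assoc (e.lin : Module.End R M), projVal_mul he.1, mul_assoc])
    exact eq_top_of_projGen_mem (this ▸ L.smul_mem _ hx)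
  refine (he.2 _ (projVal_mem hk0) _ (projVal_mem hk0') ?_).imp (key hk) (key hk')
  rw [← add_mul, ← mul_add, hsum]
  exact (congrArg (· * (e.lin : Module.End R M)) he.1.eq).trans he.1.eq

lemma IsLocalIdempotent.radical_eq (he : IsLocalIdempotent e)
    {K : Submodule (Module.End R M) (M.endProj e)}
    (hK : Maximal (fun L => (M.endProj e).IsHomogeneous L ∧ L ≠ ⊤) K) :
    (M.endProj e).radical = K := by
  refine le_antisymm (sInf_le hK) (le_sInf fun K' hK' => ?_)
  have hK' : Maximal (fun L => (M.endProj e).IsHomogeneous L ∧ L ≠ ⊤) K' := hK'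
  have h : K ⊔ K' ≠ ⊤ := fun h =>
    (he.eq_top_or_eq_top hK.prop.1 hK'.prop.1 h).elim hK.prop.2 hK'.prop.2
  exact le_sup_left.trans (hK'.le_of_ge ⟨isHomogeneous_sup hK.prop.1 hK'.prop.1, h⟩ le_sup_right)

/-- The action on `x` sends `Λe` onto `X` and raises degrees by `d`, which the shift by `-d`
absorbs. The kernel is maximal among proper homogeneous submodules, hence the radical. -/
lemma IsLocalIdempotent.exists_iso (he : IsLocalIdempotent e) {X : GrMod.{u, u} M.endDeg}
    (hX : X.IsSimple) {d : ℤ} {x : X} (hx : x ∈ X.deg d)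
    (hex : (e.lin : Module.End R M) • x ≠ 0) : Nonempty ((M.endTop e).shift (-d) ≅ X) := by
  let g : (M.endProj e).shift (-d) ⟶ X :=
    ⟨(orbitMap hx).lin ∘ₗ (projIncl e).lin, fun i y hy => (orbitMap hx).map_mem i _ hy⟩
  let g' : M.endProj e →ₗ[Module.End R M] X := g.lin
  have hgen : g.lin (projGen e) = (e.lin : Module.End R M) • x := rfl
  have hsurj : Function.Surjective g.lin := by
    refine LinearMap.range_eq_top.1 ((hX.2 _ (isHomogeneous_range g)).resolve_left fun h => hex ?_)
    have : g.lin (projGen e) ∈ LinearMap.range g.lin := ⟨_, rfl⟩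
    rw [h, hgen] at this
    exact (Submodule.mem_bot _).1 this
  let K : Submodule (Module.End R M) (M.endProj e) := LinearMap.ker g.lin
  have hK : Maximal (fun L => (M.endProj e).IsHomogeneous L ∧ L ≠ ⊤) K := by
    refine ⟨⟨isHomogeneous_of_shift (isHomogeneous_ker g), fun h => hex ?_⟩, fun L hL hKL => ?_⟩
    · exact (h ▸ Submodule.mem_top : projGen e ∈ K)
    · let L' : Submodule (Module.End R M) ((M.endProj e).shift (-d)) := L
      rcases hX.2 _ (isHomogeneous_map g (K := L') (isHomogeneous_shift hL.1)) with h | h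
      · intro y hy
        have hgy : g.lin y ∈ L'.map g.lin := ⟨y, hy, rfl⟩
        rw [h] at hgy
        exact (Submodule.mem_bot _).1 hgy
      · refine (hL.2 (eq_top_iff.2 fun y _ => ?_)).elim
        obtain ⟨y', hy', hyy'⟩ : g' y ∈ L.map g' := h ▸ Submodule.mem_top
        have hsub : y - y' ∈ L := hKL (show g' (y - y') = 0 by
          rw [map_sub, hyy', sub_self])
        have := L.add_mem hsub hy'
        rwa [sub_add_cancel] at this
  have hrad := he.radical_eq hK
  have hker : (M.endProj e).radical = LinearMap.ker g' := hrad
  let f : (M.endTop e).shift (-d) ⟶ X := ⟨(M.endProj e).radical.liftQ g' hker.le, by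
    rintro i _ ⟨y, hy, rfl⟩
    exact g.map_mem i y hy⟩
  refine ⟨isoOfBijective f ⟨?_, ?_⟩⟩
  · exact LinearMap.ker_eq_bot.1 (Submodule.ker_liftQ_eq_bot' _ g' hker)
  · intro q
    obtain ⟨y, rfl⟩ := hsurj q
    exact ⟨Submodule.Quotient.mk y, rfl⟩

/-- A degree `0` endomorphism annihilates `Λe/rad(Λe)` if `e` does not factor through it. -/
lemma IsLocalIdempotent.smul_endTop_eq_zero (he : IsLocalIdempotent e) {f : Module.End R M}
    (hf₀ : f ∈ M.endDeg 0)
    (hf : ∀ n, ∀ a ∈ M.endDeg (-n), ∀ b ∈ M.endDeg n, a * f * b ≠ e.lin) (x : M.endTop e) :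
    f • x = 0 := by
  obtain ⟨x, rfl⟩ := quotProj_surjective (X := M.endProj e) _ (M.endProj e).isHomogeneous_radical x
  refine (map_smul _ f x).symm.trans ((quotProj_eq_zero_iff (X := M.endProj e)
    (hK := (M.endProj e).isHomogeneous_radical)).2 ?_)
  refine Submodule.mem_sInf.2 fun K hK => ?_
  have hK : Maximal (fun L => (M.endProj e).IsHomogeneous L ∧ L ≠ ⊤) K := hK
  -- Membership is tested on homogeneous components, so that `e` would factor through `f` by
  -- homogeneous endomorphisms of opposite degrees.
  refine (M.endProj e).mem_of_proj K.toAddSubgroup (f • x) fun n => ?_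
  rw [(M.endProj e).proj_smul hf₀]
  by_contra hx
  have hxn := (M.endProj e).proj_mem n x
  have hfx : f • (M.endProj e).proj n x ∈ (M.endProj e).deg n := by
    simpa using (M.endProj e).smul_mem 0 n f hf₀ _ hxn
  have hspan := isHomogeneous_span_singleton hfx
  have h : K ⊔ Submodule.span (Module.End R M) {f • (M.endProj e).proj n x} = ⊤ := by
    by_contra h
    exact hx (hK.le_of_ge ⟨isHomogeneous_sup hK.prop.1 hspan, h⟩ le_sup_left
      (Submodule.mem_sup_right (Submodule.mem_span_singleton_self _)))
  have htop := (he.eq_top_or_eq_top hK.prop.1 hspan h).resolve_left hK.prop.2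
  obtain ⟨a, ha, hax⟩ := exists_mem_endDeg_smul_eq hfx (projGen_mem e)
    (htop ▸ Submodule.mem_top)
  rw [zero_sub] at ha
  refine hf n a ha (projVal ((M.endProj e).proj n x)) (projVal_mem hxn) ?_
  have := congrArg projVal hax
  rwa [projVal_smul, projVal_smul, ← mul_assoc] at this

end Top

end GrMod

/-! ### Graded relatively projective modules -/

namespace GrMod

lemma exists_homogeneous_generators {A : Type u} [Ring A] {𝒜 : ℤ → AddSubgroup A}
    (W : GrMod.{u, v} 𝒜) [Module.Finite A W] :
    ∃ (n : ℕ) (d : Fin n → ℤ) (w : Fin n → W), (∀ j, w j ∈ W.deg (d j)) ∧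
      Submodule.span A (Set.range w) = ⊤ := by
  obtain ⟨S, hS⟩ := Module.Finite.fg_top (R := A) (M := W)
  choose t ht using W.exists_sum_proj
  let σ := Σ s : S, t s.1
  let ε := (Fintype.equivFin σ).symm
  refine ⟨Fintype.card σ, fun j => (ε j).2.1, fun j => W.proj (ε j).2.1 (ε j).1.1,
    fun j => W.proj_mem _ _, ?_⟩
  rw [eq_top_iff, ← hS, Submodule.span_le]
  intro s hs
  rw [← ht s]
  refine sum_mem fun i hi => Submodule.subset_span ⟨ε.symm ⟨⟨s, hs⟩, i, hi⟩, ?_⟩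
  exact congrArg (fun q : σ => W.proj q.2.1 q.1.1) (ε.apply_symm_apply ⟨⟨s, hs⟩, i, hi⟩)

section RelativelyProjective

variable {R : Type u} [CommRing R] {𝓡 : ℤ → AddSubgroup R} [GradedRing 𝓡]

/-- A graded module `M`, as a graded module over its endomorphism ring. -/
def tautological (M : GrMod.{u, u} 𝓡) : GrMod.{u, u} M.endDeg where
  carrier := M
  deg := M.deg
  isInternal := M.isInternal
  smul_mem _ j _ ha x hx := ha j x hx

/-- The graded `End(M)`-module `⨁ M(c j)`. -/
def tautSum (M : GrMod.{u, u} 𝓡) {n : ℕ} (c : Fin n → ℤ) : GrMod.{u, u} M.endDeg :=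
  GrMod.pi fun j => M.tautological.shift (c j)

variable {M : GrMod.{u, u} 𝓡} {π : M →ₗ[R] R} {z : M} {e : Module.End R M} {n : ℕ} {c : Fin n → ℤ}

lemma rankOne_mem (hπ : ∀ d, ∀ x ∈ M.deg d, π x ∈ 𝓡 d) {d : ℤ} {x : M} (hx : x ∈ M.deg d) :
    rankOne π x ∈ M.endDeg d := fun i y hy => by
  rw [rankOne_apply, add_comm]
  exact M.smul_mem i d _ (hπ i y hy) x hx

/-- A degree zero element of `M` has degree `-c j` in the shift `M(c j)`; this fixes the degrees
required of the targets of generators below. -/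
lemma single_mem_tautSum (hz₀ : z ∈ M.deg 0) (j : Fin n) :
    (Pi.single j z : Fin n → M) ∈ (M.tautSum c).deg (-c j) := by
  intro i _
  change (Pi.single j z : Fin n → M) i ∈ M.deg (c i + -c j)
  by_cases hij : i = j
  · subst hij
    rwa [Pi.single_eq_same, add_neg_cancel]
  · rw [Pi.single_eq_of_ne hij]
    exact zero_mem _

/-- The map `⨁ M(c j) → Y` of graded `End(M)`-modules determined by homogeneous elements. -/
def genHom (hπ : ∀ d, ∀ x ∈ M.deg d, π x ∈ 𝓡 d) {Y : GrMod.{u, u} M.endDeg} {y : Fin n → Y}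
    (hy : ∀ j, y j ∈ Y.deg (-c j)) : M.tautSum c ⟶ Y where
  lin := genMap π y
  map_mem i x hx := by
    refine (sum_mem fun j _ => ?_ :
      ∑ j, rankOne π ((show Fin n → M from x) j) • y j ∈ Y.deg i)
    have := Y.smul_mem _ _ _ (rankOne_mem hπ (show x j ∈ M.deg (c j + i) from hx j trivial)) _ (hy j)
    rwa [add_neg_cancel_comm] at this

/-- The map `e(⨁ M(c j)) → W` of graded `R`-modules determined by homogeneous elements. -/
def cornerGenHom (hee : IsIdempotentElem e) (he₀ : e ∈ M.endDeg 0) (hz : π z = 1)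
    (he : ∀ x, e x = π x • z) (hπ : ∀ d, ∀ x ∈ M.deg d, π x ∈ 𝓡 d) {W : GrMod.{u, u} 𝓡}
    {w : Fin n → W} (hw : ∀ j, w j ∈ W.deg (-c j)) :
    (M.tautSum c).corner 𝓡 hee he₀ M.algebraMap_mem_endDeg ⟶ W where
  lin := Fintype.linearCombination R w ∘ₗ (cornerEquiv hz he).toLinearMap
  map_mem i x hx := by
    refine (sum_mem fun j _ => ?_ :
      ∑ j, π (Corner.incl e (Fin n → M) x j) • w j ∈ W.deg i)
    have hxj : Corner.incl e (Fin n → M) x j ∈ M.deg (c j + i) := hx j trivial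
    have := W.smul_mem _ _ _ (hπ _ _ hxj) _ (hw j)
    rwa [add_neg_cancel_comm] at this

lemma cornerGenHom_gen (hee : IsIdempotentElem e) (he₀ : e ∈ M.endDeg 0) (hz : π z = 1)
    (he : ∀ x, e x = π x • z) (hπ : ∀ d, ∀ x ∈ M.deg d, π x ∈ 𝓡 d) {W : GrMod.{u, u} 𝓡}
    {w : Fin n → W} (hw : ∀ j, w j ∈ W.deg (-c j)) (j : Fin n) :
    (cornerGenHom hee he₀ hz he hπ hw).lin (cornerGen hz he j) = w j := by
  change Fintype.linearCombination R w (cornerEquiv hz he (cornerGen hz he j)) = w j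
  rw [cornerEquiv_gen, Fintype.linearCombination_apply_single, one_smul]

variable [Module.Finite R M]

/-- The argument for `M^n` applies once lifts of the generators are chosen homogeneous of degree `-c
j`. -/
lemma isRelativelyProjective_tautSum (hee : IsIdempotentElem e) (he₀ : e ∈ M.endDeg 0)
    (hz : π z = 1) (hz₀ : z ∈ M.deg 0) (he : ∀ x, e x = π x • z)
    (hπ : ∀ d, ∀ x ∈ M.deg d, π x ∈ 𝓡 d) (c : Fin n → ℤ) :
    IsRelativelyProjective (grCornerFunctor.{u, u} 𝓡 hee he₀ M.algebraMap_mem_endDeg)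
      (fg M.endDeg) (M.tautSum c) where
  mem := by
    have : Module.Finite (Module.End R M) M := Module.Finite.of_restrictScalars_finite R _ _
    exact inferInstanceAs (Module.Finite (Module.End R M) (Fin n → M))
  projective := ⟨fun {E X} g f _ => by
    let g' : (Fin n → M) →ₗ[Module.End R M] X := g.lin
    choose y hy hfy using fun j : Fin n => exists_mem_deg_of_surjective f (surjective_of_epi f)
      (g.map_mem _ _ (single_mem_tautSum (c := c) hz₀ j))
    refine ⟨genHom hπ hy, hom_ext (genMap_hom_ext hz (g := f.lin ∘ₗ genMap π y) (g' := g')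
      fun j => ?_)⟩
    rw [LinearMap.comp_apply, genMap_single he, map_smul, hfy, ← smul_single_gen hz he j, map_smul,
      smul_single_gen hz he j]
    rfl⟩
  projective_obj := ⟨fun {E X} g f _ => by
    let g' : Corner e (Fin n → M) →ₗ[R] X := g.lin
    choose y hy hfy using fun j : Fin n => exists_mem_deg_of_surjective f (surjective_of_epi f)
      (g.map_mem _ (cornerGen hz he j) (single_mem_tautSum (c := c) hz₀ j))
    refine ⟨cornerGenHom hee he₀ hz he hπ hy, hom_ext (corner_hom_ext hz he
      (g := f.lin ∘ₗ (cornerGenHom hee he₀ hz he hπ hy).lin) (g' := g') fun j => ?_)⟩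
    refine Eq.trans (congrArg f.lin ?_) (hfy j)
    exact cornerGenHom_gen hee he₀ hz he hπ hy j⟩
  homBijective Y _ := by
    constructor
    · intro g g' h
      refine hom_ext (cornerMap_injective hz he (g := g.lin) (g' := g'.lin) fun x => ?_)
      exact congrArg (Corner.incl e Y) (LinearMap.congr_fun (congrArg Hom.lin h) x)
    · intro g
      let g' : Corner e (Fin n → M) →ₗ[R] Corner e Y := g.lin
      have hy (j : Fin n) : Corner.incl e Y (g' (cornerGen hz he j)) ∈ Y.deg (-c j) :=
        g.map_mem _ (cornerGen hz he j) (single_mem_tautSum (c := c) hz₀ j)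
      refine ⟨genHom hπ hy, hom_ext (LinearMap.ext fun x => Corner.incl_injective e ?_)⟩
      exact genMap_incl_apply hz he hee g' x

lemma exists_isRelativelyProjective (hee : IsIdempotentElem e) (he₀ : e ∈ M.endDeg 0)
    (hz : π z = 1) (hz₀ : z ∈ M.deg 0) (he : ∀ x, e x = π x • z)
    (hπ : ∀ d, ∀ x ∈ M.deg d, π x ∈ 𝓡 d) (W : GrMod.{u, u} 𝓡) (hW : fg 𝓡 W) :
    ∃ (N : GrMod.{u, u} M.endDeg)
      (ρ : (grCornerFunctor 𝓡 hee he₀ M.algebraMap_mem_endDeg).obj N ⟶ W),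
      IsRelativelyProjective (grCornerFunctor 𝓡 hee he₀ M.algebraMap_mem_endDeg)
        (fg M.endDeg) N ∧ Epi ρ := by
  have : Module.Finite R W := hW
  obtain ⟨n, d, w, hw, hspan⟩ := W.exists_homogeneous_generators
  -- The shifts are `c j = -d j`, so that the generators of the cover have the degrees of the `w j`.
  have hw' (j : Fin n) : w j ∈ W.deg (- -d j) := (neg_neg (d j)).symm ▸ hw j
  refine ⟨_, cornerGenHom hee he₀ hz he hπ hw',
    isRelativelyProjective_tautSum hee he₀ hz hz₀ he hπ _, epi_of_surjective _ ?_⟩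
  have h : Function.Surjective (Fintype.linearCombination R w) := by
    rw [← LinearMap.range_eq_top, Fintype.range_linearCombination, hspan]
  exact h.comp (cornerEquiv hz he).surjective

end RelativelyProjective

end GrMod

/-! ### Connected graded rings and degree zero endomorphisms -/

section GradedRing

variable {R : Type u} [CommRing R] {𝓡 : ℤ → AddSubgroup R} [GradedRing 𝓡]

section Annihilator

variable {A : Type u} [Ring A] [Algebra R A] {𝒜 : ℤ → AddSubgroup A}
  (X : GrMod.{u, v} 𝒜)

lemma GrMod.proj_algebraMap_smul (h𝓡 : ∀ i, ∀ r ∈ 𝓡 i, algebraMap R A r ∈ 𝒜 i) {d : ℤ} {x : X}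
    (hx : x ∈ X.deg d) (i : ℤ) (r : R) :
    X.proj (i + d) (algebraMap R A r • x) = algebraMap R A (GradedRing.proj 𝓡 i r) • x := by
  let φ : R →+ X := ((smulAddHom A X).flip x).comp (algebraMap R A).toAddMonoidHom
  let φ₁ : R →+ X := (X.proj (i + d)).comp φ
  let φ₂ : R →+ X := φ.comp (GradedRing.proj 𝓡 i)
  refine DFunLike.congr_fun ((GrMod.self 𝓡).induction_proj φ₁ φ₂ fun j (s : R) (hs : s ∈ 𝓡 j) => ?_) r
  change X.proj (i + d) (algebraMap R A s • x) = algebraMap R A (GradedRing.proj 𝓡 i s) • x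
  have hsx := X.smul_mem j d _ (h𝓡 j s hs) x hx
  rw [GradedRing.proj_apply]
  by_cases hij : i = j
  · subst hij
    rw [X.proj_of_mem _ _ hsx, DirectSum.decompose_of_mem_same 𝓡 hs]
  · rw [X.proj_of_mem_ne _ _ (by simpa using hij) _ hsx,
      DirectSum.decompose_of_mem_ne 𝓡 hs (Ne.symm hij), map_zero, zero_smul]

lemma isHomogeneous_scalarAnnihilator (h𝓡 : ∀ i, ∀ r ∈ 𝓡 i, algebraMap R A r ∈ 𝒜 i) :
    (scalarAnnihilator R A X).IsHomogeneous 𝓡 := by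
  intro i r hr
  refine mem_scalarAnnihilator.2 fun x => ?_
  refine DFunLike.congr_fun (X.induction_proj (DistribSMul.toAddMonoidHom X
    (algebraMap R A (DirectSum.decompose 𝓡 r i : R))) 0 fun d y hy => ?_) x
  have := X.proj_algebraMap_smul h𝓡 hy i r
  rw [mem_scalarAnnihilator.1 hr, map_zero, GradedRing.proj_apply] at this
  exact this.symm

end Annihilator

/-- The homogeneous core of `p` is prime and still contains the homogeneous ideal `J`, so it equals
`p` by minimality. -/
lemma isHomogeneous_of_mem_minimalPrimes {J p : Ideal R} (hJ : J.IsHomogeneous 𝓡)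
    (hp : p ∈ J.minimalPrimes) : p.IsHomogeneous 𝓡 := by
  have hprime := hp.1.1
  have hle : J ≤ (p.homogeneousCore 𝓡).toIdeal := by
    rw [← hJ.toIdeal_homogeneousCore_eq_self]
    exact Ideal.homogeneousCore_mono 𝓡 hp.1.2
  have : p = (p.homogeneousCore 𝓡).toIdeal :=
    le_antisymm (hp.2 ⟨hprime.homogeneousCore, hle⟩ (Ideal.toIdeal_homogeneousCore_le 𝓡 p))
      (Ideal.toIdeal_homogeneousCore_le 𝓡 p)
  rw [this]
  exact (p.homogeneousCore 𝓡).isHomogeneous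

section Connected

lemma gradedProj_mem (i : ℤ) (r : R) : GradedRing.proj 𝓡 i r ∈ 𝓡 i := (DirectSum.decompose 𝓡 r i).2

variable {k : Type v} [Field k] [Algebra k R]

lemma mem_irrelevantIdeal_iff (hneg : ∀ n < 0, 𝓡 n = ⊥) {r : R} :
    r ∈ irrelevantIdeal 𝓡 ↔ GradedRing.proj 𝓡 0 r = 0 := by
  classical
  constructor
  · intro hr
    induction hr using Submodule.closure_induction with
    | zero => exact map_zero _
    | add x y _ _ hx hy => rw [map_add, hx, hy, add_zero]
    | smul_mem s x hx =>
      obtain ⟨n, hn, hx⟩ := hx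
      have h := DirectSum.coe_decompose_mul_add_of_right_mem 𝓡 (i := -n) (a := s) hx
      have hs : (DirectSum.decompose 𝓡 s (-n) : R) = 0 :=
        (hneg (-n) (by lia)).le (gradedProj_mem (-n) s)
      rw [neg_add_cancel, hs, zero_mul] at h
      exact h
  · intro hr
    rw [← DirectSum.sum_support_decompose 𝓡 r]
    refine sum_mem fun i _ => ?_
    rcases lt_trichotomy i 0 with hi | rfl | hi
    · rw [show (DirectSum.decompose 𝓡 r i : R) = 0 from (hneg i hi).le (gradedProj_mem i r)]
      exact zero_mem _
    · rw [GradedRing.proj_apply] at hr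
      rw [hr]
      exact zero_mem _
    · exact Ideal.subset_span ⟨i, hi, (DirectSum.decompose 𝓡 r i).2⟩

lemma isUnit_of_mem_zero (h₀ : (𝓡 0 : Set R) = Set.range (algebraMap k R)) {r : R}
    (hr : r ∈ 𝓡 0) (hr₀ : r ≠ 0) : IsUnit r := by
  obtain ⟨c, rfl⟩ := (h₀ ▸ hr : r ∈ Set.range (algebraMap k R))
  exact (isUnit_iff_ne_zero.2 fun hc => hr₀ (by rw [hc, map_zero])).map (algebraMap k R)

lemma proj_zero_of_mem {r : R} (hr : r ∈ 𝓡 0) : GradedRing.proj 𝓡 0 r = r :=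
  DirectSum.decompose_of_mem_same 𝓡 hr

lemma isMaximal_irrelevantIdeal [Nontrivial R] (hneg : ∀ n < 0, 𝓡 n = ⊥)
    (h₀ : (𝓡 0 : Set R) = Set.range (algebraMap k R)) : (irrelevantIdeal 𝓡).IsMaximal := by
  refine Ideal.isMaximal_iff.2 ⟨fun h => one_ne_zero (α := R) ?_, fun J r hJ hr hrJ => ?_⟩
  · rw [mem_irrelevantIdeal_iff hneg, proj_zero_of_mem SetLike.GradedOne.one_mem] at h
    exact h
  · have hsub : r - GradedRing.proj 𝓡 0 r ∈ irrelevantIdeal 𝓡 := by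
      rw [mem_irrelevantIdeal_iff hneg, map_sub, proj_zero_of_mem (gradedProj_mem 0 r), sub_self]
    have hmem : GradedRing.proj 𝓡 0 r ∈ J := by
      have := J.sub_mem hrJ (hJ hsub)
      rwa [sub_sub_cancel] at this
    have hu := isUnit_of_mem_zero h₀ (gradedProj_mem 0 r) fun h =>
      hr ((mem_irrelevantIdeal_iff hneg).2 h)
    exact (Ideal.eq_top_of_isUnit_mem _ hmem hu) ▸ Submodule.mem_top

/-- The degree zero component of an element of `p` lies in `p`, and it would be a unit if it were
nonzero. -/
lemma le_irrelevantIdeal (hneg : ∀ n < 0, 𝓡 n = ⊥)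
    (h₀ : (𝓡 0 : Set R) = Set.range (algebraMap k R)) {p : Ideal R} (hp : p.IsHomogeneous 𝓡)
    (hp' : p ≠ ⊤) : p ≤ irrelevantIdeal 𝓡 := by
  intro r hr
  rw [mem_irrelevantIdeal_iff hneg]
  by_contra h
  exact hp' (Ideal.eq_top_of_isUnit_mem _ (hp 0 hr) (isUnit_of_mem_zero h₀ (gradedProj_mem 0 r) h))

lemma eq_zero_or_one_of_mem_zero (h₀ : (𝓡 0 : Set R) = Set.range (algebraMap k R)) {r : R}
    (hr : r ∈ 𝓡 0) (hrr : r * r = r) : r = 0 ∨ r = 1 := by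
  by_cases h : r = 0
  · exact Or.inl h
  · exact Or.inr ((isUnit_of_mem_zero h₀ hr h).mul_left_cancel (by rw [hrr, mul_one]))

/-- A degree-preserving endomorphism of a finitely generated graded module is integral over the
field `R₀`. -/
lemma GrMod.exists_monic_aeval_eq_zero (h₀ : (𝓡 0 : Set R) = Set.range (algebraMap k R))
    [IsNoetherianRing R]
    {N : GrMod.{u, u} 𝓡} [Module.Finite R N] {f : Module.End R N} (hf : f ∈ N.endDeg 0) :
    ∃ p : Polynomial k, p.Monic ∧ Polynomial.aeval f (p.map (algebraMap k R)) = 0 := by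
  obtain ⟨p, hp, hpf⟩ : IsIntegral R f := IsIntegral.of_finite R f
  -- Replacing each coefficient of an integral equation over `R` by its degree zero part keeps the
  -- equation valid, because `f` preserves degrees.
  choose c hc using fun r : R => (h₀ ▸ gradedProj_mem 0 r :
    GradedRing.proj 𝓡 0 r ∈ Set.range (algebraMap k R))
  let n := p.natDegree
  -- The leading term is put in by hand, since `c` picks arbitrary preimages in `k`.
  refine ⟨Polynomial.X ^ n + ∑ j ∈ Finset.range n, Polynomial.C (c (p.coeff j)) * Polynomial.X ^ j,
    ?_, ?_⟩
  · refine Polynomial.monic_X_pow_add ?_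
    refine (Polynomial.degree_sum_le _ _).trans_lt ((Finset.sup_lt_iff (WithBot.bot_lt_coe n)).2
      fun j hj => ?_)
    exact (Polynomial.degree_C_mul_X_pow_le _ _).trans_lt
      (WithBot.coe_lt_coe.2 (Finset.mem_range.1 hj))
  · have hfj (j : ℕ) : f ^ j ∈ N.endDeg 0 := by
      induction j with
      | zero => exact fun d x hx => by simpa using hx
      | succ j ih =>
        intro d x hx
        rw [pow_succ]
        have := ih _ _ (hf d x hx)
        rwa [zero_add] at this
    refine N.end_ext fun d x hx => ?_
    have hx' := LinearMap.congr_fun hpf x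
    rw [← Polynomial.aeval_def, Polynomial.aeval_eq_sum_range, LinearMap.sum_apply] at hx'
    have hx'' := congrArg (N.proj d) hx'
    rw [map_sum, LinearMap.zero_apply, map_zero, Finset.sum_range_succ] at hx''
    have hterm (j : ℕ) : N.proj d ((p.coeff j • f ^ j) x) =
        algebraMap k R (c (p.coeff j)) • (f ^ j) x := by
      have hmem : (f ^ j) x ∈ N.deg d := by simpa using hfj j d x hx
      have := N.proj_algebraMap_smul (A := R) (𝓡 := 𝓡) (fun _ _ h => h) hmem 0 (p.coeff j)
      rw [zero_add] at this
      rw [hc]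
      exact this
    have hone : algebraMap k R (c (p.coeff n)) = 1 := by
      rw [hc, hp.coeff_natDegree, proj_zero_of_mem SetLike.GradedOne.one_mem]
    simp only [hterm] at hx''
    rw [hone, one_smul] at hx''
    simp only [Polynomial.map_add, Polynomial.map_pow, Polynomial.map_X, Polynomial.map_sum,
      Polynomial.map_mul, Polynomial.map_C, map_add, map_pow, Polynomial.aeval_X, map_sum, map_mul,
      Polynomial.aeval_C]
    rw [LinearMap.add_apply, LinearMap.sum_apply, add_comm]
    exact hx''

/-- The ring of degree-preserving endomorphisms of a finitely generated indecomposable graded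
module is local. -/
lemma GrMod.IsIndecomposable.isUnit_or_isUnit_one_sub
    (h₀ : (𝓡 0 : Set R) = Set.range (algebraMap k R))
    [IsNoetherianRing R] {N : GrMod.{u, u} 𝓡} [Module.Finite R N] (hN : N.IsIndecomposable)
    {f : Module.End R N} (hf : f ∈ N.endDeg 0) :
    IsUnit f ∨ IsUnit (1 - f) := by
  let _ : Algebra k (Module.End R N) := Algebra.compHom _ (algebraMap k R)
  have : IsScalarTower k R (Module.End R N) := IsScalarTower.of_algebraMap_eq fun _ => rfl
  let D : Subalgebra k (Module.End R N) :=
    { carrier := N.endDeg 0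
      mul_mem' := fun {a b} ha hb d x hx => by
        have := ha _ _ (hb d x hx)
        rwa [zero_add] at this
      add_mem' := fun ha hb => add_mem ha hb
      algebraMap_mem' := fun c => N.algebraMap_mem_endDeg 0 _ (by
        rw [← SetLike.mem_coe, h₀]
        exact ⟨c, rfl⟩) }
  -- The ring `k[f]` is finite over `k` and consists of degree-preserving maps, so its idempotents
  -- split `N` into homogeneous summands.
  let B := Algebra.adjoin k {f}
  have hBD : B ≤ D := Algebra.adjoin_le (Set.singleton_subset_iff.2 hf)
  have := Algebra.isMulCommutative_adjoin k (s := {f}) (by simp)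
  let : CommRing B := inferInstance
  obtain ⟨p, hp, hpf⟩ := GrMod.exists_monic_aeval_eq_zero h₀ hf
  rw [Polynomial.aeval_map_algebraMap] at hpf
  have : Module.Finite k B := Module.Finite.iff_fg.2 (IsIntegral.fg_adjoin_singleton ⟨p, hp, hpf⟩)
  have : IsArtinianRing B := IsArtinianRing.of_finite k B
  have hB (b : B) (hb : b * b = b) : b = 0 ∨ b = 1 := by
    have hb' : IsIdempotentElem b.1 := congrArg Subtype.val hb
    let b₀ : N ⟶ N := ⟨b.1, fun d x hx => by simpa using hBD b.2 d x hx⟩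
    obtain h | h := hN.2 _ _ (GrMod.isHomogeneous_range b₀) (GrMod.isHomogeneous_ker b₀)
      (LinearMap.IsIdempotentElem.isCompl hb')
    · left
      exact Subtype.ext (LinearMap.range_eq_bot.1 h)
    · right
      refine Subtype.ext (LinearMap.ext fun x => LinearMap.ker_eq_bot.1 h ?_)
      exact LinearMap.congr_fun hb' x
  -- As `k[f]` is itself artinian, the complete-ring criterion applies with the zero ideal.
  exact (NCR.isUnit_or_isUnit_one_sub ⊥ hB ⟨f, Algebra.self_mem_adjoin_singleton k f⟩).imp
    (fun h => h.map B.val) fun h => h.map B.val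

end Connected

end GradedRing

/-! ### The graded case -/

variable {R : Type u} [CommRing R] {𝓡 : ℤ → AddSubgroup R} [GradedRing 𝓡]

lemma GrMod.isLocalIdempotent_of_summand {M N : GrMod.{u, u} 𝓡} [Module.Finite R M] {α : N ⟶ M}
    {β : M ⟶ N} {e : M ⟶ M} (hβα : ∀ x, β.lin (α.lin x) = x)
    (he : ∀ x, e.lin x = α.lin (β.lin x))
    (hN : ∀ f ∈ N.endDeg 0, IsUnit f ∨ IsUnit (1 - f)) : IsLocalIdempotent e := by
  refine ⟨LinearMap.ext fun x => ?_, fun a ha b _ hab => ?_⟩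
  · change e.lin (e.lin x) = e.lin x
    rw [he, he, hβα]
  have key (c : Module.End R M) (hc : IsUnit (β.lin ∘ₗ c ∘ₗ α.lin : Module.End R N)) :
      ∃ u : Module.End R M, u * (e.lin * c * e.lin) = e.lin := by
    obtain ⟨w, hw⟩ := hc.exists_left_inv
    refine ⟨α.lin ∘ₗ w ∘ₗ β.lin, LinearMap.ext fun x => ?_⟩
    change α.lin (w (β.lin (e.lin (c (e.lin x))))) = e.lin x
    rw [he, he, hβα]
    exact congrArg α.lin (LinearMap.congr_fun hw (β.lin x))
  refine (hN (β.lin ∘ₗ a ∘ₗ α.lin) fun d x hx => ?_).imp (key a) fun h => key b ?_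
  · exact β.map_mem _ _ (ha d _ (α.map_mem d x hx))
  convert h using 1
  refine LinearMap.ext fun x => ?_
  have := congrArg β.lin (LinearMap.congr_fun hab (α.lin x))
  change β.lin (e.lin (a (e.lin (α.lin x))) + e.lin (b (e.lin (α.lin x)))) =
    β.lin (e.lin (α.lin x)) at this
  rw [map_add, he (a _), he (b _), he, hβα, hβα, hβα] at this
  change β.lin (b (α.lin x)) = x - β.lin (a (α.lin x))
  rw [eq_sub_iff_add_eq', this, hβα]

lemma GrMod.finite_endTop {M : GrMod.{u, u} 𝓡} [Module.Finite R M] (e : M ⟶ M) :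
    Module.Finite (Module.End R M) (M.endTop e) := by
  let q := (M.endProj e).quotProj _ (M.endProj e).isHomogeneous_radical
  refine Module.Finite.of_surjective
    (LinearMap.toSpanSingleton (Module.End R M) (M.endTop e) (q.lin (projGen e))) fun y => ?_
  obtain ⟨y, rfl⟩ := quotProj_surjective (X := M.endProj e) _ (M.endProj e).isHomogeneous_radical y
  obtain ⟨a, rfl⟩ := exists_smul_projGen y
  exact ⟨a, (map_smul q.lin a (projGen e)).symm⟩

lemma isZero_grCornerFunctor_iff {A : Type u} [Ring A] [Algebra R A] {𝒜 : ℤ → AddSubgroup A}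
    {e : A} (he : IsIdempotentElem e) (he₀ : e ∈ 𝒜 0)
    (h𝓡 : ∀ i, ∀ r ∈ 𝓡 i, algebraMap R A r ∈ 𝒜 i) (X : GrMod.{u, v} 𝒜) :
    IsZero ((grCornerFunctor 𝓡 he he₀ h𝓡).obj X) ↔ ∀ x : X, e • x = 0 := by
  rw [GrMod.isZero_iff_subsingleton]
  constructor
  · intro h x
    obtain ⟨y, hy⟩ := Corner.exists_incl_eq e x
    have : y = 0 := Subsingleton.elim (α := (grCornerFunctor 𝓡 he he₀ h𝓡).obj X) y 0
    rw [← hy, this, map_zero]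
  · intro h
    refine ⟨fun x y => Corner.incl_injective e ?_⟩
    rw [← Corner.smul_incl he x, ← Corner.smul_incl he y, h, h]

variable {l : ℕ} (N : Fin l → GrMod.{u, u} 𝓡)

/-- The inclusion of the summand `N i` into `M`. -/
def grSummandIncl (i : Fin l) : N i ⟶ grTotal N where
  lin := LinearMap.inr R R (∀ i, N i) ∘ₗ LinearMap.single R (fun i => N i) i
  map_mem d x hx := ⟨zero_mem _, fun j _ => by
    change Pi.single (M := fun i => N i) i x j ∈ (N j).deg d
    by_cases hij : j = i
    · subst hij
      rwa [Pi.single_eq_same]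
    · rw [Pi.single_eq_of_ne hij]
      exact zero_mem _⟩

/-- The projection of `M` to the summand `N i`. -/
def grSummandProj (i : Fin l) : grTotal N ⟶ N i where
  lin := LinearMap.proj i ∘ₗ LinearMap.snd R R (∀ i, N i)
  map_mem _ _ hx := hx.2 i trivial

/-- The projection of `M` to the summand `R`. -/
def grFst : grTotal N →ₗ[R] R := LinearMap.fst R R (∀ i, N i)

/-- The inclusion of the summand `R` into `M`. -/
def grInl : R →ₗ[R] grTotal N := LinearMap.inl R R (∀ i, N i)

lemma grSummandProj_incl (i : Fin l) (x : N i) :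
    (grSummandProj N i).lin ((grSummandIncl N i).lin x) = x :=
  Pi.single_eq_same (M := fun i => N i) i x

lemma grFst_mem (d : ℤ) (x : grTotal N) (hx : x ∈ (grTotal N).deg d) : grFst N x ∈ 𝓡 d := hx.1

lemma grInl_mem {d : ℤ} {r : R} (hr : r ∈ 𝓡 d) : grInl N r ∈ (grTotal N).deg d :=
  ⟨hr, zero_mem _⟩

lemma grFst_grInl (r : R) : grFst N (grInl N r) = r := rfl

lemma grE₀_apply (x : grTotal N) : grE₀ N x = grFst N x • grInl N 1 := by
  rw [← map_smul, smul_eq_mul, mul_one]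
  rfl

lemma grE₀_add_sum_grProj (x : grTotal N) : grE₀ N x + ∑ i, (grProj N i).lin x = x :=
  e₀_add_sum_idem R (fun i => N i) x

section Simple

variable [IsNoetherianRing R] [∀ i, Module.Finite R (N i)] {k : Type v} [Field k] [Algebra k R]

variable {N} in
lemma isLocalIdempotent_grProj (h₀ : (𝓡 0 : Set R) = Set.range (algebraMap k R))
    (hN : ∀ i, (N i).IsIndecomposable) (i : Fin l) : GrMod.IsLocalIdempotent (grProj N i) :=
  GrMod.isLocalIdempotent_of_summand (α := grSummandIncl N i) (β := grSummandProj N i)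
    (grSummandProj_incl N i) (fun _ => rfl) fun _ hf => (hN i).isUnit_or_isUnit_one_sub h₀ hf

variable {N} in
-- A factorization of the idempotent of `N i` through `e₀` by maps of degrees `n` and `-n` makes `N
-- i` a graded retract of `R(n)`. The resulting idempotent of `R` has degree zero, hence is trivial,
-- so `N i` would be `R(n)`.
lemma grE₀_smul_grSimpleModule (h₀ : (𝓡 0 : Set R) = Set.range (algebraMap k R))
    (hN : ∀ i, (N i).IsIndecomposable)
    (hNR : ∀ i (n : ℤ), IsEmpty (N i ≅ (GrMod.self 𝓡).shift n)) (i : Fin l)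
    (x : grSimpleModule N i) : grE₀ N • x = 0 := by
  refine (isLocalIdempotent_grProj h₀ hN i).smul_endTop_eq_zero (grE₀_mem N)
    (fun n a ha b hb h => ?_) x
  have := (hN i).1
  let f : N i →ₗ[R] R := grFst N ∘ₗ b ∘ₗ (grSummandIncl N i).lin
  let g : R →ₗ[R] N i := (grSummandProj N i).lin ∘ₗ a ∘ₗ grInl N
  have hf (d : ℤ) (y : N i) (hy : y ∈ (N i).deg d) : f y ∈ 𝓡 (n + d) :=
    grFst_mem N _ _ (hb d _ ((grSummandIncl N i).map_mem d y hy))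
  have hg (d : ℤ) (r : R) (hr : r ∈ 𝓡 d) : g r ∈ (N i).deg (-n + d) :=
    (grSummandProj N i).map_mem _ _ (ha d _ (grInl_mem N hr))
  have hgf (y : N i) : g (f y) = y := by
    refine (congrArg (grSummandProj N i).lin
      (LinearMap.congr_fun h ((grSummandIncl N i).lin y))).trans ?_
    refine Eq.trans ?_ (grSummandProj_incl N i y)
    exact congrArg _ (congrArg (grSummandIncl N i).lin (grSummandProj_incl N i y))
  have hfg (r : R) : f (g r) = r := comp_eq_id_of_retract hgf (fun r hr hrr => by
    refine eq_zero_or_one_of_mem_zero h₀ ?_ hrr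
    have := hf _ _ (hg 0 1 SetLike.GradedOne.one_mem)
    rwa [add_zero, add_neg_cancel, ← hr] at this) r
  refine (hNR i n).false (GrMod.isoOfBijective ⟨f, hf⟩ ⟨?_, fun r => ⟨g r, hfg r⟩⟩)
  exact Function.LeftInverse.injective hgf

variable {N} in
-- The annihilator is homogeneous, so its minimal primes are homogeneous and lie in the irrelevant
-- ideal; this is where local projectivity is available. Hence `X` has finite length, and a
-- homogeneous element not killed by some `e_i` identifies each simple subquotient up to shift.
lemma prop_of_grE₀_smul_eq_zero [Nontrivial R] (hneg : ∀ n < 0, 𝓡 n = ⊥)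
    (h₀ : (𝓡 0 : Set R) = Set.range (algebraMap k R)) (hR : IsGorenstein R)
    (hsing : HasIsolatedSingularity (irrelevantIdeal 𝓡))
    (hCM : ∀ i, IsMaximalCohenMacaulay (irrelevantIdeal 𝓡) (N i))
    (hN : ∀ i, (N i).IsIndecomposable) (T : ObjectProperty (GrModLam N))
    [T.IsClosedUnderIsomorphisms] [T.ContainsZero] [T.IsClosedUnderExtensions]
    (hT : ∀ j : Fin l × ℤ, T ((grSimpleModule N j.1).shift j.2)) (X : GrModLam N)
    [Module.Finite (grLam N) X] (hX : ∀ x : X, grE₀ N • x = 0) : T X := by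
  have hmax := isMaximal_irrelevantIdeal hneg h₀
  have : IsArtinian (grLam N) X := by
    refine isArtinian_of_forall_minimalPrimes (irrelevantIdeal 𝓡) X fun p hp => ?_
    by_contra hpm
    have := hp.1.1
    have := hsing p fun h => hpm h.ge
    have hle := le_irrelevantIdeal hneg h₀ (isHomogeneous_of_mem_minimalPrimes
      (isHomogeneous_scalarAnnihilator X (grTotal N).algebraMap_mem_endDeg) hp) hp.1.1.ne_top
    obtain ⟨s, hs, hsX⟩ := exists_notMem_forall_smul_eq_zero (grFst_grInl N 1) (grE₀_apply N) hX
      (fun i => (grSummandIncl N i).lin) (fun i => (grSummandProj N i).lin)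
      (grE₀_add_sum_grProj N) (p := p) fun i => (hCM i).isLocallyProjective hR hle
    exact hs (hp.1.2 (mem_scalarAnnihilator.2 hsX))
  refine GrMod.prop_of_isArtinian T X fun K hK L hL hKL => ?_
  generalize hQ : (X.sub K hK).quot L hL = Q at hKL
  have hQ₀ (x : Q) : grE₀ N • x = 0 := by
    subst hQ
    obtain ⟨x, rfl⟩ := GrMod.quotProj_surjective L hL x
    have hx : grE₀ N • x = 0 := Subtype.ext (hX x.1)
    exact (map_smul _ (grE₀ N) x).symm.trans ((congrArg _ hx).trans (map_zero _))
  have := hKL.1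
  obtain ⟨x, hx⟩ := exists_ne (0 : Q)
  obtain ⟨d, hd⟩ := GrMod.exists_proj_ne_zero hx
  have hone : (1 : grLam N) = grE₀ N + ∑ i, (grProj N i).lin := by
    refine LinearMap.ext fun x => ?_
    rw [LinearMap.add_apply, LinearMap.sum_apply]
    exact (grE₀_add_sum_grProj N x).symm
  obtain ⟨i, hi⟩ : ∃ i, ((grProj N i).lin : grLam N) • Q.proj d x ≠ 0 := by
    by_contra! h
    refine hd ?_
    rw [← one_smul (grLam N) (Q.proj d x), hone, add_smul, hQ₀, zero_add]
    exact Finset.sum_smul.trans (Finset.sum_eq_zero fun i _ => h i)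
  obtain ⟨f⟩ := (isLocalIdempotent_grProj h₀ hN i).exists_iso hKL (Q.proj_mem d x) hi
  exact T.prop_of_iso f (hT (i, -d))

variable {N} in
theorem verdierLift_grXi [Nontrivial R] (hneg : ∀ n < 0, 𝓡 n = ⊥)
    (h₀ : (𝓡 0 : Set R) = Set.range (algebraMap k R)) (hR : IsGorenstein R)
    (hsing : HasIsolatedSingularity (irrelevantIdeal 𝓡))
    (hCM : ∀ i, IsMaximalCohenMacaulay (irrelevantIdeal 𝓡) (N i))
    (hN : ∀ i, (N i).IsIndecomposable)
    (hNR : ∀ i (n : ℤ), IsEmpty (N i ≅ (GrMod.self 𝓡).shift n))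
    [HasDerivedCategory.{w₁} (GrModLam N)] [HasDerivedCategory.{w₂} (GrMod.{u, u} 𝓡)] :
    ∃ h : (triangulatedSpan (grSimples N)).trW.IsInvertedBy (grXi N),
      (verdierLift (grSimples N) (grXi N) h).IsTriangulated ∧
      (verdierLift (grSimples N) (grXi N) h).IsEquivalence := by
  refine verdierLift_boundedDerivedMap _ (fun j => ?_) (fun j => ?_) (fun T _ _ _ hT X hX h0 => ?_)
    (fun W hW => ?_)
  · exact GrMod.finite_endTop (grProj N j.1)
  · exact (isZero_grCornerFunctor_iff _ _ _ _).2 (grE₀_smul_grSimpleModule h₀ hN hNR j.1)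
  · have : Module.Finite (grLam N) X := hX
    exact prop_of_grE₀_smul_eq_zero hneg h₀ hR hsing hCM hN T hT X
      ((isZero_grCornerFunctor_iff _ _ _ _).1 h0)
  · exact GrMod.exists_isRelativelyProjective (isIdempotentElem_grE₀ N) (grE₀_mem N)
      (grFst_grInl N 1) (grInl_mem N SetLike.GradedOne.one_mem) (grE₀_apply N) (grFst_mem N) W hW

end Simple

end NCR

end

theorem lemma5p1p3 :
    -- the complete case
    (∀ (k : Type v) [Field k] (R : Type u) [CommRing R] [Algebra k R] [IsLocalRing R]
      [IsNoetherianRing R] [IsAdicComplete (IsLocalRing.maximalIdeal R) R]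
      (_ : IsGorenstein R) (_ : HasIsolatedSingularity (IsLocalRing.maximalIdeal R))
      (l : ℕ) (N : Fin l → Type u) [∀ i, AddCommGroup (N i)] [∀ i, Module R (N i)]
      [∀ i, Module.Finite R (N i)]
      (_ : ∀ i, IsMaximalCohenMacaulay (IsLocalRing.maximalIdeal R) (N i))
      (_ : ∀ i, IsIndecomposableModule R (N i))
      (_ : ∀ i j, i ≠ j → IsEmpty (N i ≃ₗ[R] N j))
      (_ : ∀ i, IsEmpty (N i ≃ₗ[R] R))
      (_ : HasFiniteGlobalDimension (Lam R N))
      [HasDerivedCategory.{w₁} (ModuleCat.{u} (Lam R N))]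
      [HasDerivedCategory.{w₂} (ModuleCat.{u} R)],
      ∃ h : (triangulatedSpan (simples R N)).trW.IsInvertedBy (Xi R N),
        (verdierLift (simples R N) (Xi R N) h).IsTriangulated ∧
        (verdierLift (simples R N) (Xi R N) h).IsEquivalence) ∧
    -- the graded case
    (∀ (k : Type v) [Field k] (R : Type u) [CommRing R] [Algebra k R] [Nontrivial R]
      [IsNoetherianRing R] (𝓡 : ℤ → AddSubgroup R) [GradedRing 𝓡]
      (_ : ∀ n < 0, 𝓡 n = ⊥) (_ : (𝓡 0 : Set R) = Set.range (algebraMap k R))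
      (_ : IsGorenstein R) (_ : HasIsolatedSingularity (irrelevantIdeal 𝓡))
      (l : ℕ) (N : Fin l → GrMod.{u, u} 𝓡) [∀ i, Module.Finite R (N i)]
      (_ : ∀ i, IsMaximalCohenMacaulay (irrelevantIdeal 𝓡) (N i))
      (_ : ∀ i, (N i).IsIndecomposable)
      (_ : ∀ i j, i ≠ j → IsEmpty (N i ≅ N j))
      (_ : ∀ i (n : ℤ), IsEmpty (N i ≅ (GrMod.self 𝓡).shift n))
      (_ : HasFiniteGlobalDimension (grLam N))
      [HasDerivedCategory.{w₁} (GrModLam N)] [HasDerivedCategory.{w₂} (GrMod.{u, u} 𝓡)],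
      ∃ h : (triangulatedSpan (grSimples N)).trW.IsInvertedBy (grXi N),
        (verdierLift (grSimples N) (grXi N) h).IsTriangulated ∧
        (verdierLift (grSimples N) (grXi N) h).IsEquivalence) := by
  constructor
  · intro k _ R _ _ _ _ _ hR hsing l N _ _ _ hCM hN _ hNR _ _ _
    exact verdierLift_xi hR hsing hCM hN hNR
  · intro k _ R _ _ _ _ 𝓡 _ hneg h₀ hR hsing l N _ hCM hN _ hNR _ _ _
    exact verdierLift_grXi hneg h₀ hR hsing hCM hN hNR
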